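/- **Conventions.** All processes are $n$-dimensional Lévy processes (started at $0$, independent stationary increments, càdlàg paths a.s.); $X\overset{D}{=}Y$ means that the characteristic exponents agree, $\Psi_X=\Psi_Y$, where $\mathbb E e^{i\langle\theta,X(t)\rangle}=e^{t\Psi_X(\theta)}$. Write $X\sim L^n(\mu,\Sigma,\mathcal X)$ if $X$ has canonical triplet $(\mu,\Sigma,\mathcal X)$ with respect to truncation on the closed unit ball, and $BM^n(\mu,\Sigma)=L^n(\mu,\Sigma,0)$, where $\Sigma$ is an arbitrary (possibly singular) covariance matrix. For $x\in[0,\infty)^n$ put $x\diamond\mu=(x_k\mu_k)_k$ and $x\diamond\Sigma=((x_k\wedge x_l)\Sigma_{kl})_{k,l}$. An $n$-dimensional *Thorin measure* is a Borel measure $\mathcal U$ on $[0,\infty)^n\setminus\{0\}$ with $\int (1+\ln^-\|u\|)\wedge(1/\|u\|)\,\mathcal U(du)<\infty$. A *Thorin subordinator* $T\sim GGC^n_S(d,\mathcal U)$, $d\in[0,\infty)^n$, is an $n$-dimensional subordinator with $-\ln\mathbb E e^{-\langle\lambda,T(t)\rangle}=t\langle d,\lambda\rangle+t\int\ln\frac{\|u\|^2+\langle\lambda,u\rangle}{\|u\|^2}\,\mathcal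 U(du)$ for $t\ge0$, $\lambda\in[0,\infty)^n$. A *gamma subordinator* $G\sim\Gamma_S(b)$, $b>0$, is a subordinator with $G(t)$ gamma distributed with shape $bt$ and rate $b$ for $t>0$. - $X\sim VG^n(b,\mu,\Sigma)$ if $X\overset{D}{=}(B(G(t)))_{t\ge0}$ with independent $B\sim BM^n(\mu,\Sigma)$ and $G\sim\Gamma_S(b)$. - $X\sim VGG^{n,1}(d,\mu,\Sigma,\mathcal U)$ if $X\overset{D}{=}(B(T(t)))_{t\ge0}$ with independent $B\sim BM^n(\mu,\Sigma)$ and $T\sim GGC^1_S(d,\mathcal U)$. - $X\sim WVGG^n(d,\mu,\Sigma,\mathcal U)$ if $X\overset{D}{=}B\odot T$ (weak subordination) with $B\sim BM^n(\mu,\Sigma)$ and $T\sim GGC^n_S(d,\mathcal U)$: if $T$ has drift $d$ and Lévy measure $\mathcal T$, and $B(t)=(B_1(t_1),\dots,B_n(t_n))$ for $t\in[0,\infty)^n$, then $$X\sim L^n\Big(d\diamond\mu+\int \mathbb E\big[B(t)\mathbf 1_{\{\|B(t)\|\le1\}}\big]\,\mathcal T(dt),\ d\diamond\Sigma,\ \mathcal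 X\Big),\qquad \mathcal X(dx)=\int\mathbb P(B(t)\in dx)\,\mathcal T(dt)\ \text{ on }\mathbb R^n\setminus\{0\}.$$ - $WVGG^n_0$ is the class of $WVGG^n(d,\mu,\Sigma,\mathcal U)$ processes with $\mu=0$. - $GVGC^n_0$ is the smallest class of Lévy processes (identified with their distributions at time $1$) that contains all $VG^n(b,0,\Sigma)$ processes and is closed under convolution and under convergence in distribution. - $X\sim BM^n+GVGC^n_0$ if $X\overset{D}{=}B+Y$ with independent $B\sim BM^n(m,C)$, for some drift $m\in\mathbb R^n$ and covariance matrix $C$, and $Y\sim GVGC^n_0$. - $X\sim SD^n$ if $X(1)$ is self-decomposable: for every $0<b<1$ there is a random vector $Z_b$ independent of $X(1)$ with $X(1)\overset{D}{=}bX(1)+Z_b$. **Theorem.** For $n=1$, $$VG^1\subseteq VGG^{1,1}=WVGG^1\subseteq SD^1 .$$ If $n\ge2$, then the implications (i) $\Leftarrow$ (ii) $\Leftarrow$ (iii) hold, where (i) $X\sim SD^n$; (ii) $X\sim BM^n+GVGC^n_0$; (iii) $X\sim WVGG^n_0$. -/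

import Mathlib

open MeasureTheory ProbabilityTheory Filter Topology Complex Matrix WithLp
open scoped NNReal ENNReal RealInnerProductSpace

noncomputable section

namespace VarianceGamma

/-- `n`-dimensional Euclidean space. -/
abbrev E (n : ℕ) := EuclideanSpace ℝ (Fin n)

variable {n : ℕ} {Ω Ω' : Type*} [MeasurableSpace Ω] [MeasurableSpace Ω']

/-! ### Matrix and vector operations -/

/-- The Hadamard product `x ⋄ μ` of two vectors. -/
def diamondVec (x μ : E n) : E n := toLp 2 fun k => x k * μ k

/-- `x ⋄ Σ`, the Hadamard product of `Σ` with the matrix of minima `min (x k) (x l)`. -/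
def diamondMat (x : E n) (S : Matrix (Fin n) (Fin n) ℝ) : Matrix (Fin n) (Fin n) ℝ :=
  Matrix.of fun k l => min (x k) (x l) * S k l

/-! ### Lévy processes -/

/-- An `n`-dimensional Lévy process: it starts at zero, has independent and stationary increments,
and almost all of its paths are right-continuous with left limits. -/
structure IsLevyProcess (P : Measure Ω) (X : ℝ≥0 → Ω → E n) : Prop where
  measurable : ∀ t, Measurable (X t)
  zero : ∀ᵐ ω ∂P, X 0 ω = 0
  indep : HasIndepIncrements X P
  stationary : ∀ s t, P.map (fun ω => X (s + t) ω - X s ω) = P.map (X t)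
  cadlag : ∀ᵐ ω ∂P, ∀ t, ContinuousWithinAt (fun s => X s ω) (Set.Ioi t) t ∧
    ∃ l, Tendsto (fun s => X s ω) (𝓝[<] t) (𝓝 l)

/-- `Ψ` is the characteristic exponent of the process `X`: `𝔼 exp (i ⟪θ, X t⟫) = exp (t Ψ θ)`. -/
def HasExponent (P : Measure Ω) (X : ℝ≥0 → Ω → E n) (Ψ : E n → ℂ) : Prop :=
  ∀ (t : ℝ≥0) (θ : E n), charFun (P.map (X t)) θ = cexp (t * Ψ θ)

/-- Two processes are identical in law if they have a common characteristic exponent. -/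
def EqInLaw (P : Measure Ω) (X : ℝ≥0 → Ω → E n) (Q : Measure Ω') (Y : ℝ≥0 → Ω' → E n) : Prop :=
  ∃ Ψ, HasExponent P X Ψ ∧ HasExponent Q Y Ψ

/-- A Lévy measure, as a measure on the whole space that does not charge the origin. -/
structure IsLevyMeasure (𝒳 : Measure (E n)) : Prop where
  zero : 𝒳 {0} = 0
  lintegral_lt_top : ∫⁻ x, ENNReal.ofReal (min 1 (‖x‖ ^ 2)) ∂𝒳 < ∞

/-- The Lévy-Khintchine exponent of the triplet `(μ, Σ, 𝒳)`, truncated on the closed unit ball. -/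
def levyKhintchine (μ : E n) (S : Matrix (Fin n) (Fin n) ℝ) (𝒳 : Measure (E n)) (θ : E n) : ℂ :=
  I * (⟪μ, θ⟫ : ℝ) - ((θ ⬝ᵥ S *ᵥ θ : ℝ) : ℂ) / 2 +
    ∫ x, (cexp (I * (⟪θ, x⟫ : ℝ)) - 1 -
      (Metric.closedBall (0 : E n) 1).indicator (fun y => I * (⟪θ, y⟫ : ℝ)) x) ∂𝒳

/-- `X` is a Lévy process with canonical triplet `(μ, Σ, 𝒳)`. -/
structure IsLevy (P : Measure Ω) (X : ℝ≥0 → Ω → E n) (μ : E n) (S : Matrix (Fin n) (Fin n) ℝ)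
    (𝒳 : Measure (E n)) : Prop where
  isLevyProcess : IsLevyProcess P X
  posSemidef : S.PosSemidef
  isLevyMeasure : IsLevyMeasure 𝒳
  hasExponent : HasExponent P X (levyKhintchine μ S 𝒳)

/-- Brownian motion with drift `μ` and covariance matrix `Σ`. -/
def IsBM (P : Measure Ω) (B : ℝ≥0 → Ω → E n) (μ : E n) (S : Matrix (Fin n) (Fin n) ℝ) : Prop :=
  IsLevy P B μ S 0

/-! ### Subordinators -/

/-- A subordinator: a Lévy process whose components are almost surely nondecreasing. -/
structure IsSubordinatorProcess (P : Measure Ω) (T : ℝ≥0 → Ω → E n) : Prop where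
  isLevyProcess : IsLevyProcess P T
  monotone : ∀ᵐ ω ∂P, ∀ k, Monotone fun t => T t ω k

/-- `T` is a subordinator with drift `d` and Lévy measure `𝒯`. -/
structure IsSubordinator (P : Measure Ω) (T : ℝ≥0 → Ω → E n) (d : E n) (𝒯 : Measure (E n)) :
    Prop where
  isSubordinatorProcess : IsSubordinatorProcess P T
  drift_nonneg : ∀ k, 0 ≤ d k
  support : 𝒯 {t | ∃ k, t k < 0} = 0
  finite_variation : ∫⁻ t in Metric.closedBall 0 1, ‖t‖ₑ ∂𝒯 < ∞
  isLevy : IsLevy P T (d + ∫ t in Metric.closedBall 0 1, t ∂𝒯) 0 𝒯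

/-- A gamma subordinator with shape `a` and rate `b`: `G t` has the law `Γ(a t, b)`. -/
structure IsGammaSubordinator (P : Measure Ω) (G : ℝ≥0 → Ω → E 1) (a b : ℝ) : Prop where
  isSubordinatorProcess : IsSubordinatorProcess P G
  law : ∀ t : ℝ≥0, 0 < t → P.map (fun ω => G t ω 0) = gammaMeasure (a * t) b

/-- An `n`-dimensional Thorin measure, as a measure on the whole space that is concentrated on
`[0, ∞)ⁿ` without the origin. -/
structure IsThorinMeasure (U : Measure (E n)) : Prop where
  support : U {u | (∃ k, u k < 0) ∨ u = 0} = 0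
  lintegral_lt_top :
    ∫⁻ u, ENNReal.ofReal (min (1 + max (-Real.log ‖u‖) 0) (1 / ‖u‖)) ∂U < ∞

/-- A Thorin subordinator with drift `d` and Thorin measure `U`. -/
structure IsThorinSubordinator (P : Measure Ω) (T : ℝ≥0 → Ω → E n) (d : E n) (U : Measure (E n)) :
    Prop where
  isSubordinatorProcess : IsSubordinatorProcess P T
  drift_nonneg : ∀ k, 0 ≤ d k
  isThorinMeasure : IsThorinMeasure U
  laplace : ∀ (t : ℝ≥0) (l : E n), (∀ k, 0 ≤ l k) →
    ∫ ω, Real.exp (-⟪l, T t ω⟫) ∂P =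
      Real.exp (-(t * ⟪d, l⟫ + t * ∫ u, Real.log ((‖u‖ ^ 2 + ⟪l, u⟫) / ‖u‖ ^ 2) ∂U))

/-! ### Strong and weak subordination -/

/-- The value `(B₁(t₁), …, Bₙ(tₙ))` of a process at a multivariate time `t ∈ [0, ∞)ⁿ`. -/
def evalAt (B : ℝ≥0 → Ω → E n) (t : E n) (ω : Ω) : E n :=
  toLp 2 fun k => B (t k).toNNReal ω k

/-- The strong subordination `B ∘ T`, that is `t ↦ (B₁(T₁(t)), …, Bₙ(Tₙ(t)))`. -/
def strongSubord (B T : ℝ≥0 → Ω → E n) : ℝ≥0 → Ω → E n :=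
  fun t ω => evalAt B (T t ω) ω

/-- The process `G e = (G, …, G)` for a univariate process `G`. -/
def broadcast (n : ℕ) (G : ℝ≥0 → Ω → E 1) : ℝ≥0 → Ω → E n :=
  fun t ω => toLp 2 fun _ => G t ω 0

/-- `X` is, in law, the weak subordination `B ⊙ T` of the Brownian motion `B` (with drift `μ` and
covariance `Σ`) by the subordinator `T` (with drift `d` and Lévy measure `𝒯`): `X` is a Lévy
process with Lévy measure `𝒳(dx) = ∫ ℙ(B(t) ∈ dx) 𝒯(dt)` off the origin, Gaussian covariance
`d ⋄ Σ` and location `d ⋄ μ + ∫ 𝔼[B(t); ‖B(t)‖ ≤ 1] 𝒯(dt)`. The last integral is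
`∫_{‖x‖ ≤ 1} x 𝒳(dx)`, evaluated in the order in which it always converges. -/
def IsWeakSubord (P : Measure Ω) (X : ℝ≥0 → Ω → E n) (Q : Measure Ω') (B T : ℝ≥0 → Ω' → E n)
    (μ : E n) (S : Matrix (Fin n) (Fin n) ℝ) (d : E n) : Prop :=
  IsBM Q B μ S ∧ ∃ 𝒯 𝒳 : Measure (E n), IsSubordinator Q T d 𝒯 ∧
    (∀ A, MeasurableSet A → 0 ∉ A → 𝒳 A = ∫⁻ t, Q {ω | evalAt B t ω ∈ A} ∂𝒯) ∧
    IsLevy P X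
      (diamondVec d μ +
        ∫ t, (∫ ω, (Metric.closedBall (0 : E n) 1).indicator id (evalAt B t ω) ∂Q) ∂𝒯)
      (diamondMat d S) 𝒳

/-! ### The process classes, with their parameters -/

/-- `X` is a variance gamma process `VGⁿ(b, μ, Σ)`: in law it is `B ∘ (G e)`, for a Brownian motion
`B` and an independent gamma subordinator `G` with shape and rate `b`. -/
def IsVGWith (P : Measure Ω) (X : ℝ≥0 → Ω → E n) (b : ℝ) (μ : E n)
    (S : Matrix (Fin n) (Fin n) ℝ) : Prop :=
  0 < b ∧ IsLevyProcess P X ∧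
  ∃ (Ω' : Type) (_ : MeasurableSpace Ω') (Q : Measure Ω') (_ : IsProbabilityMeasure Q)
    (B : ℝ≥0 → Ω' → E n) (G : ℝ≥0 → Ω' → E 1),
    IsBM Q B μ S ∧ IsGammaSubordinator Q G b b ∧
    IndepFun (fun ω t => B t ω) (fun ω t => G t ω) Q ∧
    EqInLaw P X Q (strongSubord B (broadcast n G))

/-- `X` is a strong variance univariate generalised gamma convolution `VGGⁿ'¹(d, μ, Σ, U)`: in law
it is `B ∘ (T e)`, for a Brownian motion `B` and an independent univariate Thorin subordinator
`T`. -/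
def IsVGGOneWith (P : Measure Ω) (X : ℝ≥0 → Ω → E n) (d : E 1) (μ : E n)
    (S : Matrix (Fin n) (Fin n) ℝ) (U : Measure (E 1)) : Prop :=
  IsLevyProcess P X ∧
  ∃ (Ω' : Type) (_ : MeasurableSpace Ω') (Q : Measure Ω') (_ : IsProbabilityMeasure Q)
    (B : ℝ≥0 → Ω' → E n) (T : ℝ≥0 → Ω' → E 1),
    IsBM Q B μ S ∧ IsThorinSubordinator Q T d U ∧
    IndepFun (fun ω t => B t ω) (fun ω t => T t ω) Q ∧
    EqInLaw P X Q (strongSubord B (broadcast n T))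

/-- `X` is a weak variance generalised gamma convolution `WVGGⁿ(d, μ, Σ, U)`: in law it is `B ⊙ T`,
for a Brownian motion `B` and a Thorin subordinator `T`. -/
def IsWVGGWith (P : Measure Ω) (X : ℝ≥0 → Ω → E n) (d μ : E n)
    (S : Matrix (Fin n) (Fin n) ℝ) (U : Measure (E n)) : Prop :=
  ∃ (Ω' : Type) (_ : MeasurableSpace Ω') (Q : Measure Ω') (_ : IsProbabilityMeasure Q)
    (B T : ℝ≥0 → Ω' → E n),
    IsBM Q B μ S ∧ IsThorinSubordinator Q T d U ∧ IsWeakSubord P X Q B T μ S d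

/-! ### The process classes -/

/-- The class `VGⁿ`. -/
def IsVG (P : Measure Ω) (X : ℝ≥0 → Ω → E n) : Prop := ∃ b μ S, IsVGWith P X b μ S

/-- The class `VGGⁿ'¹`. -/
def IsVGGOne (P : Measure Ω) (X : ℝ≥0 → Ω → E n) : Prop := ∃ d μ S U, IsVGGOneWith P X d μ S U

/-- The class `WVGGⁿ`. -/
def IsWVGG (P : Measure Ω) (X : ℝ≥0 → Ω → E n) : Prop := ∃ d μ S U, IsWVGGWith P X d μ S U

/-- The class `WVGGⁿ₀`, in which the Brownian motion is driftless. -/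
def IsWVGGZero (P : Measure Ω) (X : ℝ≥0 → Ω → E n) : Prop := ∃ d S U, IsWVGGWith P X d 0 S U

/-- A distribution `ρ` is self-decomposable if for all `0 < b < 1` there is a distribution `ζ` such
that `ρ` is the law of `b Y + Z` for independent `Y ∼ ρ` and `Z ∼ ζ`. -/
def IsSelfDecomposable (ρ : Measure (E n)) : Prop :=
  ∀ b : ℝ, 0 < b → b < 1 →
    ∃ ζ : Measure (E n), IsProbabilityMeasure ζ ∧ ρ = (ρ.map fun x => b • x).conv ζ

/-- The class `SDⁿ` of self-decomposable Lévy processes. -/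
def IsSD (P : Measure Ω) (X : ℝ≥0 → Ω → E n) : Prop :=
  IsLevyProcess P X ∧ IsSelfDecomposable (P.map (X 1))

/-- The distribution at time one of a `VGⁿ(b, μ, Σ)` process (see `IsVGWith.map_one`): the normal
mean-variance mixture `g μ + √g Z` with independent `g ∼ Γ(b, b)` and `Z ∼ N(0, Σ)`. -/
def vgDistribution (b : ℝ) (μ : E n) (S : Matrix (Fin n) (Fin n) ℝ) : Measure (E n) :=
  ((gammaMeasure b b).prod (multivariateGaussian 0 S)).map
    fun p : ℝ × E n => p.1 • μ + √p.1 • p.2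

/-- The smallest class of distributions that contains `𝒮` and is closed under convolution and under
convergence in distribution. -/
inductive ConvLimitClosure (𝒮 : Set (ProbabilityMeasure (E n))) : ProbabilityMeasure (E n) → Prop
  | base (ρ : ProbabilityMeasure (E n)) : ρ ∈ 𝒮 → ConvLimitClosure 𝒮 ρ
  | conv (ρ₁ ρ₂ ρ : ProbabilityMeasure (E n)) :
      ConvLimitClosure 𝒮 ρ₁ → ConvLimitClosure 𝒮 ρ₂ →
      (ρ : Measure (E n)) = (ρ₁ : Measure (E n)).conv (ρ₂ : Measure (E n)) → ConvLimitClosure 𝒮 ρ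
  | limit (ρs : ℕ → ProbabilityMeasure (E n)) (ρ : ProbabilityMeasure (E n)) :
      (∀ k, ConvLimitClosure 𝒮 (ρs k)) → Tendsto ρs atTop (𝓝 ρ) → ConvLimitClosure 𝒮 ρ

/-- The distributions (at time one) of the class `GVGCⁿ₀`: the closure under convolution and
convergence in distribution of the driftless variance gamma distributions `VGⁿ(b, 0, Σ)`. -/
def IsGVGCZeroDistribution (ρ : ProbabilityMeasure (E n)) : Prop :=
  ConvLimitClosure {σ | ∃ (b : ℝ) (S : Matrix (Fin n) (Fin n) ℝ),
    0 < b ∧ S.PosSemidef ∧ (σ : Measure (E n)) = vgDistribution b 0 S} ρ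

/-- The class `BMⁿ + GVGCⁿ₀`: Lévy processes equal in law to `B + Y` with a Brownian motion `B` with
drift `m` and covariance matrix `C`, and an independent `GVGCⁿ₀` process `Y`. As the law of a Lévy
process is determined by its distribution at time one, this is expressed by a convolution. -/
def IsBMAddGVGCZero (P : Measure Ω) (X : ℝ≥0 → Ω → E n) : Prop :=
  IsLevyProcess P X ∧
  ∃ (m : E n) (C : Matrix (Fin n) (Fin n) ℝ) (ρ : ProbabilityMeasure (E n)),
    C.PosSemidef ∧ IsGVGCZeroDistribution ρ ∧
    P.map (X 1) = (multivariateGaussian m C).conv (ρ : Measure (E n))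

/-! ### The distribution of a variance gamma process at time one -/

lemma charFun_vgDistribution {b : ℝ} (hb : 0 < b) (μ : E n) {S : Matrix (Fin n) (Fin n) ℝ}
    (hS : S.PosSemidef) (θ : E n) :
    charFun (vgDistribution b μ S) θ =
      ∫ g, cexp (g * levyKhintchine μ S 0 θ) ∂(gammaMeasure b b) := by
  have := isProbabilityMeasure_gammaMeasure hb hb
  have hmeas : Measurable (fun p : ℝ × E n => p.1 • μ + √p.1 • p.2) := by fun_prop
  rw [charFun_apply, vgDistribution, integral_map hmeas.aemeasurable
    (Measurable.aestronglyMeasurable (by fun_prop)), integral_prod]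
  · have hnn : ∀ᵐ g ∂(gammaMeasure b b), 0 ≤ g := by
      rw [gammaMeasure, ae_withDensity_iff (by unfold gammaPDF; fun_prop)]
      refine ae_of_all _ fun g hg => ?_
      by_contra h
      exact hg (gammaPDF_of_neg (not_le.mp h))
    refine integral_congr_ae ?_
    filter_upwards [hnn] with g hg
    have h1 : ∀ z : E n, cexp ((⟪g • μ + √g • z, θ⟫ : ℝ) * I) =
        cexp (g * (⟪μ, θ⟫ : ℝ) * I) * cexp ((⟪z, √g • θ⟫ : ℝ) * I) := by
      intro z
      rw [← Complex.exp_add]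
      congr 1
      rw [inner_add_left, real_inner_smul_left, real_inner_smul_left, real_inner_smul_right]
      push_cast
      ring
    simp only [h1]
    rw [integral_const_mul, ← charFun_apply, charFun_multivariateGaussian hS, ← Complex.exp_add]
    congr 1
    simp only [levyKhintchine, integral_zero_measure, inner_zero_right, ofLp_smul,
      Matrix.mulVec_smul, smul_dotProduct, dotProduct_smul, smul_eq_mul]
    have h2 : √g * (√g * (θ ⬝ᵥ S *ᵥ θ)) = g * (θ ⬝ᵥ S *ᵥ θ) := by
      rw [← mul_assoc, Real.mul_self_sqrt hg]
    rw [h2]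
    push_cast
    ring
  · refine Integrable.of_bound (Measurable.aestronglyMeasurable (by fun_prop)) 1
      (ae_of_all _ fun p => ?_)
    rw [Complex.norm_exp_ofReal_mul_I]

lemma exists_countable_approx : ∃ (a : ℕ → ℕ → ℝ≥0) (φ : ℕ → ℝ≥0 → ℕ),
    (∀ k, Measurable (φ k)) ∧ (∀ k x, x < a k (φ k x)) ∧
    ∀ x, Tendsto (fun k => a k (φ k x)) atTop (𝓝 x) := by
  have hgt : ∀ (k : ℕ) (x : ℝ≥0), x < ((⌊((k : ℝ≥0) + 1) * x⌋₊ : ℝ≥0) + 1) / ((k : ℝ≥0) + 1) := by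
    intro k x
    rw [lt_div_iff₀ (by positivity), mul_comm]
    exact Nat.lt_floor_add_one _
  refine ⟨fun k j => ((j : ℝ≥0) + 1) / ((k : ℝ≥0) + 1), fun k x => ⌊((k : ℝ≥0) + 1) * x⌋₊,
    fun k => Nat.measurable_floor.comp (measurable_id.const_mul _), hgt, fun x => ?_⟩
  refine tendsto_of_tendsto_of_tendsto_of_le_of_le (h := fun k : ℕ => x + 1 / ((k : ℝ≥0) + 1))
    tendsto_const_nhds ?_ (fun k => (hgt k x).le) fun k => ?_
  · simpa using (tendsto_one_div_add_atTop_nhds_zero_nat (𝕜 := ℝ≥0)).const_add x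
  · have hk : ((k : ℝ≥0) + 1) ≠ 0 := by positivity
    have h1 : (x + 1 / ((k : ℝ≥0) + 1)) * (k + 1) = (k + 1) * x + 1 := by
      field_simp
    rw [div_le_iff₀ (by positivity), h1]
    gcongr
    exact Nat.floor_le (by positivity)

/-- Conditioning on an independent random time. -/
lemma integral_exp_at_indep_time {Q : Measure Ω} [IsProbabilityMeasure Q] {B : ℝ≥0 → Ω → E n}
    {τ : Ω → ℝ≥0} (hB : IsLevyProcess Q B) (hτ : Measurable τ)
    (hind : IndepFun (fun ω t => B t ω) τ Q) {Ψ : E n → ℂ} (hΨ : HasExponent Q B Ψ) (θ : E n) :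
    ∫ ω, cexp ((⟪B (τ ω) ω, θ⟫ : ℝ) * I) ∂Q = ∫ ω, cexp (τ ω * Ψ θ) ∂Q := by
  have hBm : Measurable (fun ω t => B t ω) := measurable_pi_lambda _ hB.measurable
  have hnorm : ∀ t : ℝ≥0, ‖cexp (t * Ψ θ)‖ ≤ 1 := by
    intro t
    rw [← hΨ t θ]
    have := Measure.isProbabilityMeasure_map (μ := Q) (hB.measurable t).aemeasurable
    exact norm_charFun_le_one θ
  obtain ⟨a, φ, hφ, hgt, hlim⟩ := exists_countable_approx
  let τk : ℕ → Ω → ℝ≥0 := fun k ω => a k (φ k (τ ω))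
  have hτk_gt : ∀ k ω, τ ω < τk k ω := fun k ω => hgt k (τ ω)
  have hτk_tendsto : ∀ ω, Tendsto (fun k => τk k ω) atTop (𝓝 (τ ω)) := fun ω => hlim (τ ω)
  have hτk_meas : ∀ k, Measurable (τk k) := by
    intro k
    exact (measurable_from_top (f := a k)).comp ((hφ k).comp hτ)
  have hstep : ∀ k, ∫ ω, cexp ((⟪B (τk k ω) ω, θ⟫ : ℝ) * I) ∂Q =
      ∫ ω, cexp (τk k ω * Ψ θ) ∂Q := by
    intro k
    let N : Ω → ℕ := fun ω => φ k (τ ω)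
    have hN : Measurable N := (hφ k).comp hτ
    have hindN : IndepFun N (fun ω t => B t ω) Q :=
      hind.symm.comp (φ := φ k) (ψ := id) (hφ k) measurable_id
    let F : ℕ × (ℝ≥0 → E n) → ℂ := fun p => cexp ((⟪p.2 (a k p.1), θ⟫ : ℝ) * I)
    have hF : Measurable F := by
      refine measurable_from_prod_countable_right fun j => ?_
      have : Measurable fun β : ℝ≥0 → E n => β (a k j) := measurable_pi_apply _
      change Measurable fun β : ℝ≥0 → E n => cexp ((⟪β (a k j), θ⟫ : ℝ) * I)
      fun_prop
    have hlaw := (indepFun_iff_map_prod_eq_prod_map_map hN.aemeasurable hBm.aemeasurable).1 hindN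
    have := Measure.isProbabilityMeasure_map (μ := Q) hN.aemeasurable
    have := Measure.isProbabilityMeasure_map (μ := Q) hBm.aemeasurable
    calc ∫ ω, cexp ((⟪B (τk k ω) ω, θ⟫ : ℝ) * I) ∂Q
        = ∫ p, F p ∂(Q.map fun ω => (N ω, fun t => B t ω)) := by
          rw [integral_map (hN.prodMk hBm).aemeasurable hF.aestronglyMeasurable]
      _ = ∫ j, ∫ β, F (j, β) ∂(Q.map fun ω t => B t ω) ∂(Q.map N) := by
          rw [hlaw, integral_prod]
          refine Integrable.of_bound hF.aestronglyMeasurable 1 (ae_of_all _ fun p => ?_)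
          change ‖cexp ((⟪p.2 (a k p.1), θ⟫ : ℝ) * I)‖ ≤ 1
          rw [Complex.norm_exp_ofReal_mul_I]
      _ = ∫ j, cexp (a k j * Ψ θ) ∂(Q.map N) := by
          congr 1
          ext j
          have hFj : Measurable fun β => F (j, β) := hF.comp measurable_prodMk_left
          rw [integral_map hBm.aemeasurable hFj.aestronglyMeasurable, ← hΨ (a k j) θ,
            charFun_apply, integral_map (hB.measurable _).aemeasurable
            (Measurable.aestronglyMeasurable (by fun_prop))]
      _ = ∫ ω, cexp (τk k ω * Ψ θ) ∂Q := by
          have hm : Measurable fun j : ℕ => cexp (a k j * Ψ θ) := measurable_from_top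
          exact integral_map hN.aemeasurable hm.aestronglyMeasurable
  have hlim1 : Tendsto (fun k => ∫ ω, cexp ((⟪B (τk k ω) ω, θ⟫ : ℝ) * I) ∂Q) atTop
      (𝓝 (∫ ω, cexp ((⟪B (τ ω) ω, θ⟫ : ℝ) * I) ∂Q)) := by
    refine tendsto_integral_of_dominated_convergence (fun _ => 1) (fun k => ?_)
      (integrable_const _) (fun k => ae_of_all _ fun ω => ?_) ?_
    · have hm : Measurable fun ω => B (τk k ω) ω := by
        have h1 : Measurable fun p : ℕ × Ω => B (a k p.1) p.2 :=
          measurable_from_prod_countable_right fun j => hB.measurable (a k j)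
        have h2 : Measurable fun ω => (φ k (τ ω), ω) := ((hφ k).comp hτ).prodMk measurable_id
        exact h1.comp h2
      have h3 : Continuous fun x : E n => cexp ((⟪x, θ⟫ : ℝ) * I) := by fun_prop
      exact (h3.measurable.comp hm).aestronglyMeasurable
    · rw [Complex.norm_exp_ofReal_mul_I]
    · filter_upwards [hB.cadlag] with ω hω
      have h1 : Tendsto (fun k => τk k ω) atTop (𝓝[>] (τ ω)) :=
        tendsto_nhdsWithin_iff.2 ⟨hτk_tendsto ω, Eventually.of_forall fun k => hτk_gt k ω⟩
      have h2 : Tendsto (fun k => B (τk k ω) ω) atTop (𝓝 (B (τ ω) ω)) :=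
        Tendsto.comp (hω (τ ω)).1 h1
      have h3 : Continuous fun x : E n => cexp ((⟪x, θ⟫ : ℝ) * I) := by fun_prop
      exact (h3.tendsto (B (τ ω) ω)).comp h2
  have hlim2 : Tendsto (fun k => ∫ ω, cexp (τk k ω * Ψ θ) ∂Q) atTop
      (𝓝 (∫ ω, cexp (τ ω * Ψ θ) ∂Q)) := by
    refine tendsto_integral_of_dominated_convergence (fun _ => 1) (fun k => ?_)
      (integrable_const _) (fun k => ae_of_all _ fun ω => hnorm _) (ae_of_all _ fun ω => ?_)
    · have := hτk_meas k
      exact Measurable.aestronglyMeasurable (by fun_prop)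
    · have h3 : Continuous fun x : ℝ≥0 => cexp (x * Ψ θ) := by fun_prop
      exact (h3.tendsto (τ ω)).comp (hτk_tendsto ω)
  simp only [hstep] at hlim1
  exact tendsto_nhds_unique hlim1 hlim2

/-- A variance gamma process has the distribution `vgDistribution` at time one. -/
theorem IsVGWith.map_one {P : Measure Ω} [IsProbabilityMeasure P] {X : ℝ≥0 → Ω → E n} {b : ℝ}
    {μ : E n} {S : Matrix (Fin n) (Fin n) ℝ} (h : IsVGWith P X b μ S) :
    P.map (X 1) = vgDistribution b μ S := by
  obtain ⟨hb, hX, Ω', mΩ', Q, hQ, B, G, hB, hG, hind, Ψ, hΨX, hΨY⟩ := h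
  have := isProbabilityMeasure_gammaMeasure hb hb
  have := Measure.isProbabilityMeasure_map (μ := P) (hX.measurable 1).aemeasurable
  have : IsProbabilityMeasure (vgDistribution b μ S) :=
    Measure.isProbabilityMeasure_map (Measurable.aemeasurable (by fun_prop))
  refine Measure.ext_of_charFun (funext fun θ => ?_)
  rw [charFun_vgDistribution hb μ hB.posSemidef, hΨX 1 θ, ← hΨY 1 θ]
  have hae : AEMeasurable (strongSubord B (broadcast n G) 1) Q := by
    by_contra hne
    have h1 := hΨY 1 θ
    rw [Measure.map_of_not_aemeasurable hne, charFun_zero_measure] at h1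
    exact (Complex.exp_ne_zero _) h1.symm
  have hG1 : Measurable fun ω => G 1 ω 0 := by
    have := hG.isSubordinatorProcess.isLevyProcess.measurable 1
    fun_prop
  have hmono : ∀ᵐ ω ∂Q, 0 ≤ G 1 ω 0 := by
    filter_upwards [hG.isSubordinatorProcess.monotone,
      hG.isSubordinatorProcess.isLevyProcess.zero] with ω h1 h2
    have := h1 0 (zero_le_one : (0 : ℝ≥0) ≤ 1)
    simpa [h2] using this
  let τ : Ω' → ℝ≥0 := fun ω => (G 1 ω 0).toNNReal
  have hτ : Measurable τ := hG1.real_toNNReal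
  have hindτ : IndepFun (fun ω t => B t ω) τ Q := by
    refine hind.comp (φ := id) (ψ := fun γ : ℝ≥0 → E 1 => (γ 1 0).toNNReal) measurable_id ?_
    have : Measurable fun γ : ℝ≥0 → E 1 => γ 1 := measurable_pi_apply _
    exact Measurable.real_toNNReal (by fun_prop)
  have hlaw : Q.map (fun ω => G 1 ω 0) = gammaMeasure b b := by
    simpa using hG.law 1 one_pos
  have key := integral_exp_at_indep_time hB.isLevyProcess hτ hindτ hB.hasExponent θ
  rw [charFun_apply, integral_map hae (Measurable.aestronglyMeasurable (by fun_prop)), ← hlaw,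
    integral_map hG1.aemeasurable (Measurable.aestronglyMeasurable (by fun_prop))]
  refine Eq.trans ?_ (key.trans ?_)
  · rfl
  · refine integral_congr_ae ?_
    filter_upwards [hmono] with ω hω
    have h1 : ((τ ω : ℝ≥0) : ℝ) = G 1 ω 0 := Real.coe_toNNReal _ hω
    have h2 : ((τ ω : ℝ≥0) : ℂ) = (G 1 ω 0 : ℝ) := by rw [← h1]
    rw [h2]

end VarianceGamma

end

/-!
Both halves of the theorem are read off from the characteristic exponent of a weak variance
generalised gamma convolution `X`. Write `A(t) = i ⟪t ⋄ μ, θ⟫ - ⟪θ, (t ⋄ Σ) θ⟫ / 2`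
(`timeExponent`), which is homogeneous of degree one in `t`. A Brownian motion is a Gaussian
process, so `exp A(t)` is the characteristic function of `B(t) = (B₁(t₁), …, Bₙ(tₙ))`
(`IsBM.charFun_evalAt`), and the exponent of `B ⊙ T` is `A(d) + ∫ (exp A(t) - 1) 𝒯(dt)`
(`IsBM.levyKhintchine_weakSubord`). The Lévy measure `𝒯` of a Thorin subordinator is the image of
`e⁻ʳ / r dr ⊗ U` under `(r, u) ↦ r u / ‖u‖²`: Lévy measures on the orthant are determined by their
Laplace exponents (`levyMeasure_ext_of_laplaceExponent`). With Frullani's integral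
`∫ (1 - e⁻ᶻʳ) e⁻ʳ / r dr = log (1 + z)` for `0 ≤ Re z`, the exponent of `X` becomes
`A(d) - ∫ log (1 - A(u) / ‖u‖²) U(du)` (`IsWVGGWith.isLevyProcess_and_hasExponent`).

Each `-c log (1 - A(u) / ‖u‖²)` is the exponent of a variance gamma distribution, and the integral
against `U` is a limit of finite sums, because the integrand is continuous and bounded by the weight
that Thorin measures integrate. Hence `X 1` belongs to every class that is closed under convolution
and convergence in distribution and contains the Gaussian part and the summands
(`ConvLimitClosure.of_thorinExponent`). Two classes are used. For `μ = 0` the summands are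
`VG(c, 0, S)`, and the centred Gaussian part is itself a limit of such distributions; this gives
`WVGGⁿ₀ ⊆ BMⁿ + GVGCⁿ₀`. For `n = 1` and arbitrary `μ` the summands are self-decomposable, since
`1 - (iαθ - βθ²)` is a product of two linear factors and thus belongs to a difference of gamma
variables; this gives `WVGG¹ ⊆ SD¹`.

The self-decomposable distributions do form such a class: under a limit the residuals stay tight
(`isSelfDecomposable_of_tendsto`). They contain the distributions `VG(b, 0, S)`, because the gamma
distribution is self-decomposable with an explicit residual (`exists_gamma_residual`). This gives
`BMⁿ + GVGCⁿ₀ ⊆ SDⁿ`.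

For `n = 1` one has `A(t) = t Ψ(θ)` with the exponent `Ψ` of `B`, so that the Laplace transform of
`T` at the complex frequency `-Ψ(θ)` shows that strong and weak subordination yield the same
exponent (`hasExponent_strongSubord_one`); this is `VGG¹'¹ = WVGG¹`. The complex Laplace transform
is obtained from the one on the positive reals by the identity theorem. Finally `VG ⊆ VGG`, because
a gamma subordinator is a Thorin subordinator whose Thorin measure is a point mass.
-/

noncomputable section

namespace VarianceGamma

variable {n : ℕ}

/-! ### Laplace transforms on the right half-plane -/

lemma norm_exp_sub_one_le_min {w : ℂ} (hw : w.re ≤ 0) : ‖cexp w - 1‖ ≤ 2 * min 1 ‖w‖ := by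
  rcases le_total ‖w‖ 1 with h | h
  · rw [min_eq_right h]
    exact Complex.norm_exp_sub_one_le h
  · rw [min_eq_left h]
    calc ‖cexp w - 1‖ ≤ ‖cexp w‖ + ‖(1 : ℂ)‖ := norm_sub_le _ _
      _ ≤ 1 + 1 := by
        gcongr
        · rw [Complex.norm_exp]
          exact Real.exp_le_one_iff.2 hw
        · simp
      _ = 2 * 1 := by norm_num

lemma min_one_mul_le {c x : ℝ} (hc : 0 ≤ c) (hx : 0 ≤ x) :
    min 1 (c * x) ≤ (1 + c) * min 1 x := by
  rcases le_total x 1 with h | h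
  · rw [min_eq_right h]
    exact (min_le_right _ _).trans (by nlinarith)
  · rw [min_eq_left h]
    exact (min_le_left _ _).trans (by linarith)

lemma norm_one_sub_exp_neg_mul_le {z : ℂ} (hz : 0 ≤ z.re) {x : ℝ} (hx : 0 ≤ x) :
    ‖1 - cexp (-(z * x))‖ ≤ 2 * (1 + ‖z‖) * min 1 x := by
  have h1 : (-(z * x)).re ≤ 0 := by
    simp only [neg_re, re_mul_ofReal]
    nlinarith
  have h2 := norm_exp_sub_one_le_min h1
  rw [norm_neg, norm_mul, Complex.norm_real, Real.norm_of_nonneg hx] at h2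
  rw [norm_sub_rev]
  have h3 := min_one_mul_le (norm_nonneg z) hx
  linarith

section LaplaceExponent

variable {τ : Measure ℝ}

/-- The hypothesis on `τ` is that it is a Lévy measure of finite variation on `[0, ∞)`. -/
lemma integrable_one_sub_exp_neg_mul (hτ : ∀ᵐ x ∂τ, 0 ≤ x)
    (hint : Integrable (fun x : ℝ => min 1 x) τ) {z : ℂ} (hz : 0 ≤ z.re) :
    Integrable (fun x : ℝ => 1 - cexp (-(z * x))) τ := by
  refine Integrable.mono' (hint.const_mul (2 * (1 + ‖z‖)))
    (Measurable.aestronglyMeasurable (by fun_prop)) ?_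
  filter_upwards [hτ] with x hx using norm_one_sub_exp_neg_mul_le hz hx

/-- The Laplace exponent of a Lévy measure of finite variation on `[0, ∞)` is holomorphic on the
open right half-plane and continuous on the closed one. -/
lemma diffContOnCl_integral_one_sub_exp_neg_mul (hτ : ∀ᵐ x ∂τ, 0 ≤ x)
    (hint : Integrable (fun x : ℝ => min 1 x) τ) :
    DiffContOnCl ℂ (fun z : ℂ => ∫ x, (1 - cexp (-(z * x))) ∂τ) {z | 0 < z.re} := by
  refine ⟨fun z hz => ?_, ?_⟩
  · have hz : 0 < z.re := hz
    set ε := z.re / 2 with hε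
    have hε0 : 0 < ε := by positivity
    have hball : ∀ w ∈ Metric.ball z ε, ε ≤ w.re := by
      intro w hw
      have h1 : |(w - z).re| ≤ ‖w - z‖ := Complex.abs_re_le_norm _
      rw [Metric.mem_ball, dist_eq_norm] at hw
      have := (abs_le.1 h1).1
      simp only [sub_re] at this
      linarith
    have key := hasDerivAt_integral_of_dominated_loc_of_deriv_le (μ := τ) (𝕜 := ℂ)
      (F := fun (w : ℂ) (x : ℝ) => 1 - cexp (-(w * x)))
      (F' := fun (w : ℂ) (x : ℝ) => x * cexp (-(w * x)))
      (bound := fun x => (1 + ε⁻¹) * min 1 x) (x₀ := z) (s := Metric.ball z ε)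
      (Metric.ball_mem_nhds z hε0)
      (Eventually.of_forall fun w => Measurable.aestronglyMeasurable (by fun_prop))
      (integrable_one_sub_exp_neg_mul hτ hint hz.le)
      (Measurable.aestronglyMeasurable (by fun_prop)) ?_ (hint.const_mul _) ?_
    · exact key.2.differentiableAt.differentiableWithinAt
    -- on the ball `Re w ≥ ε`, so that `x e^{-(Re w) x}` is bounded by both `x` and `1 / ε`
    · filter_upwards [hτ] with x hx w hw
      have hw' := hball w hw
      rw [norm_mul, Complex.norm_real, Real.norm_of_nonneg hx, Complex.norm_exp, neg_re,
        re_mul_ofReal]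
      have h1 : Real.exp (-(w.re * x)) ≤ Real.exp (-(ε * x)) :=
        Real.exp_le_exp.2 (by nlinarith)
      have h2 : x * Real.exp (-(ε * x)) ≤ ε⁻¹ := by
        rw [Real.exp_neg, ← div_eq_mul_inv, div_le_iff₀ (Real.exp_pos _)]
        have := Real.add_one_le_exp (ε * x)
        have h3 : ε * x ≤ Real.exp (ε * x) := by linarith
        calc x = ε⁻¹ * (ε * x) := by field_simp
          _ ≤ ε⁻¹ * Real.exp (ε * x) := by gcongr
      have h3 : x * Real.exp (-(ε * x)) ≤ x := by
        have : Real.exp (-(ε * x)) ≤ 1 := Real.exp_le_one_iff.2 (by nlinarith)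
        nlinarith
      have h4 : x * Real.exp (-(w.re * x)) ≤ x * Real.exp (-(ε * x)) := by gcongr
      have hε1 : 0 < ε⁻¹ := by positivity
      rcases le_total x 1 with h | h
      · rw [min_eq_right h]; nlinarith
      · rw [min_eq_left h]; linarith
    · filter_upwards with x w hw
      have h1 : HasDerivAt (fun w : ℂ => -(w * x)) (-(1 * x)) w :=
        ((hasDerivAt_id w).mul_const (x : ℂ)).neg
      have h2 := (h1.cexp).const_sub 1
      convert h2 using 1
      ring
  · have hcl : closure {z : ℂ | 0 < z.re} ⊆ {z | 0 ≤ z.re} :=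
      closure_minimal (fun z (hz : 0 < z.re) => hz.le) (isClosed_le continuous_const continuous_re)
    intro z hz
    have hz0 : 0 ≤ z.re := hcl hz
    refine tendsto_integral_filter_of_dominated_convergence
      (fun x => 2 * (1 + (‖z‖ + 1)) * min 1 x)
      (Eventually.of_forall fun w => Measurable.aestronglyMeasurable (by fun_prop)) ?_
      (hint.const_mul _) ?_
    · have h1 : ∀ᶠ w in 𝓝[closure {z : ℂ | 0 < z.re}] z, ‖w‖ < ‖z‖ + 1 :=
        nhdsWithin_le_nhds (continuous_norm.continuousAt.eventually_lt continuousAt_const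
          (by simp))
      filter_upwards [h1, self_mem_nhdsWithin] with w hw hw2
      filter_upwards [hτ] with x hx
      refine (norm_one_sub_exp_neg_mul_le (hcl hw2) hx).trans ?_
      have : 0 ≤ min 1 x := le_min zero_le_one hx
      gcongr
    · filter_upwards with x
      have h : Continuous fun w : ℂ => 1 - cexp (-(w * x)) := by fun_prop
      exact h.continuousWithinAt

end LaplaceExponent

lemma closure_re_pos : closure {z : ℂ | 0 < z.re} = {z | 0 ≤ z.re} :=
  Complex.closure_setOfPred_lt_re 0

/-- The Laplace transform of a distribution on `[0, ∞)` is holomorphic on the open right half-plane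
and continuous on the closed one. -/
lemma diffContOnCl_laplace {ν : Measure ℝ} [IsFiniteMeasure ν] (hν : ∀ᵐ x ∂ν, 0 ≤ x) :
    DiffContOnCl ℂ (fun z : ℂ => ∫ x, cexp (-(z * x)) ∂ν) {z | 0 < z.re} := by
  have hint : Integrable (fun x : ℝ => min 1 x) ν := by
    refine Integrable.of_bound (Measurable.aestronglyMeasurable (by fun_prop)) 1 ?_
    filter_upwards [hν] with x hx
    rw [Real.norm_of_nonneg (le_min zero_le_one hx)]
    exact min_le_left _ _
  have h1 := diffContOnCl_integral_one_sub_exp_neg_mul hν hint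
  have h2 : DiffContOnCl ℂ (fun _ : ℂ => ∫ _, (1 : ℂ) ∂ν) {z : ℂ | 0 < z.re} :=
    diffContOnCl_const
  have heq : Set.EqOn (fun z : ℂ => ∫ x, cexp (-(z * x)) ∂ν)
      ((fun _ : ℂ => ∫ _, (1 : ℂ) ∂ν) - fun z : ℂ => ∫ x, (1 - cexp (-(z * x))) ∂ν)
      {z | 0 ≤ z.re} := by
    intro z hz
    simp only [Pi.sub_apply]
    rw [← integral_sub (integrable_const _) (integrable_one_sub_exp_neg_mul hν hint hz)]
    simp
  refine ⟨(h2.sub h1).differentiableOn.congr fun z (hz : 0 < z.re) => heq hz.le, ?_⟩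
  refine (h2.sub h1).continuousOn.congr fun z hz => heq ?_
  rwa [closure_re_pos] at hz

/-- Identity theorem: functions that are holomorphic on the open right half-plane, continuous on
the closed one, and agree on the positive reals, are equal. -/
lemma eq_of_diffContOnCl_of_eq_ofReal {f g : ℂ → ℂ} (hf : DiffContOnCl ℂ f {z | 0 < z.re})
    (hg : DiffContOnCl ℂ g {z | 0 < z.re}) (h : ∀ x : ℝ, 0 < x → f x = g x) {z : ℂ}
    (hz : 0 ≤ z.re) : f z = g z := by
  have hopen : IsOpen {z : ℂ | 0 < z.re} := isOpen_lt continuous_const continuous_re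
  have hpre : IsPreconnected {z : ℂ | 0 < z.re} := (convex_halfSpace_re_gt 0).isPreconnected
  have h1 : Set.EqOn f g {z | 0 < z.re} := by
    refine (hf.differentiableOn.analyticOnNhd hopen).eqOn_of_preconnected_of_frequently_eq
      (hg.differentiableOn.analyticOnNhd hopen) hpre (z₀ := 1) (by simp) ?_
    have h2 : Tendsto (fun k : ℕ => ((1 + 1 / ((k : ℝ) + 1) : ℝ) : ℂ)) atTop (𝓝[≠] 1) := by
      refine tendsto_nhdsWithin_iff.2 ⟨?_, Eventually.of_forall fun k => ?_⟩
      · have h3 := (tendsto_one_div_add_atTop_nhds_zero_nat (𝕜 := ℝ)).const_add 1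
        rw [add_zero] at h3
        simpa [Function.comp_def] using (Complex.continuous_ofReal.tendsto 1).comp h3
      · have : (0 : ℝ) < 1 / ((k : ℝ) + 1) := by positivity
        simp only [Set.mem_compl_iff, Set.mem_singleton_iff]
        norm_cast
        simp only [add_eq_left]
        positivity
    refine h2.frequently (Frequently.of_forall fun k => h _ (by positivity))
  have h4 : z ∈ closure {z : ℂ | 0 < z.re} := by rwa [closure_re_pos]
  exact h1.of_subset_closure hf.continuousOn hg.continuousOn subset_closure subset_rfl h4

/-! ### Gamma distributions -/

lemma ae_nonneg_gammaMeasure (a r : ℝ) : ∀ᵐ x ∂(gammaMeasure a r), 0 ≤ x := by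
  rw [gammaMeasure, ae_withDensity_iff (by unfold gammaPDF; fun_prop)]
  refine ae_of_all _ fun g hg => ?_
  by_contra h
  exact hg (gammaPDF_of_neg (not_le.mp h))

lemma one_add_mem_slitPlane {z : ℂ} (hz : 0 ≤ z.re) : 1 + z ∈ slitPlane :=
  Or.inl (by simp only [add_re, one_re]; linarith)

lemma one_add_ne_zero' {z : ℂ} (hz : 0 ≤ z.re) : 1 + z ≠ 0 :=
  slitPlane_ne_zero (one_add_mem_slitPlane hz)

/-- On the positive reals the Laplace transform of the gamma distribution is a Gamma integral. -/
lemma laplace_gammaMeasure_ofReal {a r : ℝ} (ha : 0 < a) (hr : 0 < r) {x : ℝ} (hx : 0 < x) :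
    ∫ g, cexp (-((x : ℂ) * g)) ∂(gammaMeasure a r) = cexp (-(a * Complex.log (1 + x / r))) := by
  have hm : Measurable (gammaPDF a r) := by unfold gammaPDF; fun_prop
  rw [gammaMeasure, integral_withDensity_eq_integral_toReal_smul hm
    (ae_of_all _ fun _ => ENNReal.ofReal_lt_top)]
  have hpos : 0 < 1 + x / r := by positivity
  have h1 : ∀ g : ℝ, (gammaPDF a r g).toReal • cexp (-((x : ℂ) * g)) =
      (Set.Ici (0 : ℝ)).indicator (fun g : ℝ => ((r ^ a / Real.Gamma a *
        (g ^ (a - 1) * Real.exp (-((r + x) * g))) : ℝ) : ℂ)) g := by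
    intro g
    rw [gammaPDF, ENNReal.toReal_ofReal (gammaPDFReal_nonneg ha hr g), gammaPDFReal]
    by_cases hg : 0 ≤ g
    · rw [if_pos hg, Set.indicator_of_mem (by simpa using hg), real_smul]
      have h2 : cexp (-((x : ℂ) * g)) = (Real.exp (-(x * g)) : ℝ) := by push_cast; rfl
      rw [h2, ← ofReal_mul]
      congr 1
      have h3 : -((r + x) * g) = -(r * g) + -(x * g) := by ring
      rw [h3, Real.exp_add]
      ring
    · rw [if_neg hg, Set.indicator_of_notMem (by simpa using hg), zero_smul]
  simp only [h1]
  rw [integral_indicator measurableSet_Ici, integral_Ici_eq_integral_Ioi, integral_complex_ofReal,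
    integral_const_mul, Real.integral_rpow_mul_exp_neg_mul_Ioi ha (by positivity)]
  have h4 : (1 : ℂ) + x / r = ((1 + x / r : ℝ) : ℂ) := by push_cast; rfl
  rw [h4, ← ofReal_log hpos.le]
  have h5 : cexp (-((a : ℂ) * (Real.log (1 + x / r) : ℝ))) =
      ((Real.exp (-(a * Real.log (1 + x / r))) : ℝ) : ℂ) := by push_cast; rfl
  rw [h5]
  congr 1
  have hG : Real.Gamma a ≠ 0 := (Real.Gamma_pos_of_pos ha).ne'
  have h6 : Real.exp (-(a * Real.log (1 + x / r))) = (1 + x / r) ^ (-a) := by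
    rw [Real.rpow_def_of_pos hpos]; ring_nf
  rw [h6, Real.rpow_neg hpos.le]
  have h7 : 1 + x / r = (r + x) / r := by field_simp
  rw [h7, Real.div_rpow (by positivity) hr.le, Real.div_rpow (by norm_num) (by positivity),
    Real.one_rpow]
  have := (Real.rpow_pos_of_pos hr a).ne'
  have := (Real.rpow_pos_of_pos (by positivity : 0 < r + x) a).ne'
  field_simp

lemma diffContOnCl_log_one_add_div {r : ℝ} (hr : 0 < r) :
    DiffContOnCl ℂ (fun z : ℂ => Complex.log (1 + z / r)) {z | 0 < z.re} := by
  refine DifferentiableOn.diffContOnCl fun z hz => ?_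
  rw [closure_re_pos] at hz
  have h1 : 1 + z / r ∈ slitPlane := one_add_mem_slitPlane (by
    rw [div_ofReal_re]; exact div_nonneg hz hr.le)
  have h2 : DifferentiableAt ℂ (fun z : ℂ => 1 + z / r) z := by fun_prop
  exact (h2.clog h1).differentiableWithinAt

/-- The Laplace transform of the gamma distribution, on the closed right half-plane. -/
lemma laplace_gammaMeasure {a r : ℝ} (ha : 0 < a) (hr : 0 < r) {z : ℂ} (hz : 0 ≤ z.re) :
    ∫ g, cexp (-(z * g)) ∂(gammaMeasure a r) = cexp (-(a * Complex.log (1 + z / r))) := by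
  have := isProbabilityMeasure_gammaMeasure ha hr
  refine eq_of_diffContOnCl_of_eq_ofReal
    (f := fun z => ∫ g, cexp (-(z * g)) ∂(gammaMeasure a r))
    (g := fun z => cexp (-(a * Complex.log (1 + z / r))))
    (diffContOnCl_laplace (ae_nonneg_gammaMeasure a r)) ?_
    (fun x hx => laplace_gammaMeasure_ofReal ha hr hx) hz
  have h := (diffContOnCl_log_one_add_div hr).const_smul (-(a : ℂ))
  refine ⟨fun z hz => ?_, ?_⟩
  · have := (h.differentiableOn z hz).cexp
    simpa using this
  · have := h.continuousOn.cexp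
    simpa using this

/-- The Lévy measure `e⁻ʳ / r dr` of the standard gamma process. -/
def gammaLevyMeasure : Measure ℝ :=
  (volume.restrict (Set.Ioi 0)).withDensity fun r => ENNReal.ofReal (Real.exp (-r) / r)

instance : SFinite gammaLevyMeasure := by unfold gammaLevyMeasure; infer_instance

lemma ae_pos_gammaLevyMeasure : ∀ᵐ r ∂gammaLevyMeasure, 0 < r :=
  (withDensity_absolutelyContinuous _ _).ae_le (ae_restrict_mem measurableSet_Ioi)

/-- The complex Frullani integral `∫ (1 - e⁻ᶻʳ) e⁻ʳ / r dr = log (1 + z)`: the Laplace exponent of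
the gamma process. -/
lemma frullani_gammaLevyMeasure {z : ℂ} (hz : 0 ≤ z.re) :
    Integrable (fun r : ℝ => 1 - cexp (-(z * r))) gammaLevyMeasure ∧
      ∫ r, (1 - cexp (-(z * r))) ∂gammaLevyMeasure = Complex.log (1 + z) := by
  have hm : Measurable fun r : ℝ => ENNReal.ofReal (Real.exp (-r) / r) := by fun_prop
  have hfin : ∀ᵐ r ∂(volume.restrict (Set.Ioi (0 : ℝ))), ENNReal.ofReal (Real.exp (-r) / r) < ∞ :=
    ae_of_all _ fun _ => ENNReal.ofReal_lt_top
  -- the integrand is `∫₀¹ z e^{-(1 + z s) r} ds`, and the order of integration is exchanged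
  let K : ℝ → ℝ → ℂ := fun r s => z * cexp (-(1 + z * s) * r)
  have hre : ∀ s ∈ Set.Ioc (0 : ℝ) 1, 1 ≤ (1 + z * s).re := by
    intro s hs
    simp only [add_re, one_re, re_mul_ofReal]
    nlinarith [hs.1]
  have hK : ∀ r ∈ Set.Ioi (0 : ℝ), ∫ s in Set.Ioc (0 : ℝ) 1, K r s =
      (Real.exp (-r) / r) • (1 - cexp (-(z * r))) := by
    intro r hr
    have hr : 0 < r := hr
    have hrc : (r : ℂ) ≠ 0 := by exact_mod_cast hr.ne'
    rw [← intervalIntegral.integral_of_le zero_le_one]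
    have hd : ∀ s ∈ Set.uIcc (0 : ℝ) 1, HasDerivAt (fun s : ℝ => -(cexp (-(1 + z * s) * r) / r))
        (K r s) s := by
      intro s _
      have h1 : HasDerivAt (fun s : ℝ => -(1 + z * s) * (r : ℂ)) (-(z * 1) * r) s :=
        (((ofRealCLM.hasDerivAt (x := s)).const_mul z).const_add 1).neg.mul_const _
      have h2 := (h1.cexp.div_const (r : ℂ)).neg
      refine h2.congr_deriv ?_
      simp only [K]
      field_simp
    rw [intervalIntegral.integral_eq_sub_of_hasDerivAt hd
      (Continuous.intervalIntegrable (by fun_prop) _ _)]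
    have h3 : cexp (-(1 + z * (1 : ℝ)) * r) = cexp (-r) * cexp (-(z * r)) := by
      rw [← Complex.exp_add]; congr 1; push_cast; ring
    rw [h3, real_smul]
    push_cast
    simp only [mul_zero, add_zero]
    field_simp
    ring_nf
  have hint : Integrable (Function.uncurry K)
      ((volume.restrict (Set.Ioi (0 : ℝ))).prod (volume.restrict (Set.Ioc (0 : ℝ) 1))) := by
    have h1 : Integrable (fun p : ℝ × ℝ => ‖z‖ * Real.exp (-p.1) * 1)
        ((volume.restrict (Set.Ioi (0 : ℝ))).prod (volume.restrict (Set.Ioc (0 : ℝ) 1))) := by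
      have h2 : Integrable (fun r : ℝ => ‖z‖ * Real.exp (-r)) (volume.restrict (Set.Ioi (0 : ℝ))) :=
        (integrableOn_exp_neg_Ioi 0).const_mul _
      exact h2.mul_prod (integrable_const (1 : ℝ))
    have hKm : Measurable (Function.uncurry K) := by
      have : Continuous (Function.uncurry K) := by
        change Continuous fun p : ℝ × ℝ => z * cexp (-(1 + z * p.2) * p.1)
        fun_prop
      exact this.measurable
    refine h1.mono' hKm.aestronglyMeasurable ?_
    rw [Measure.prod_restrict]
    filter_upwards [ae_restrict_mem (measurableSet_Ioi.prod measurableSet_Ioc)] with p hp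
    have hp1 : 0 < p.1 := hp.1
    have hp2 := hre p.2 hp.2
    change ‖z * cexp (-(1 + z * p.2) * p.1)‖ ≤ _
    rw [norm_mul, Complex.norm_exp, mul_one, re_mul_ofReal, neg_re]
    gcongr
    nlinarith
  have hI1 : Integrable (fun r : ℝ => ∫ s in Set.Ioc (0 : ℝ) 1, K r s)
      (volume.restrict (Set.Ioi (0 : ℝ))) := hint.integral_prod_left
  have hcongr : (fun r : ℝ => ∫ s in Set.Ioc (0 : ℝ) 1, K r s)
      =ᵐ[volume.restrict (Set.Ioi (0 : ℝ))]
      fun r => (ENNReal.ofReal (Real.exp (-r) / r)).toReal • (1 - cexp (-(z * r))) := by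
    filter_upwards [ae_restrict_mem measurableSet_Ioi] with r hr
    have hr' : 0 < r := hr
    rw [hK r hr, ENNReal.toReal_ofReal (by positivity)]
  refine ⟨?_, ?_⟩
  · rw [gammaLevyMeasure, integrable_withDensity_iff_integrable_smul' hm hfin]
    exact hI1.congr hcongr
  · rw [gammaLevyMeasure, integral_withDensity_eq_integral_toReal_smul hm hfin,
      ← integral_congr_ae hcongr, integral_integral_swap hint]
    have h1 : ∀ s ∈ Set.Ioc (0 : ℝ) 1, ∫ r in Set.Ioi (0 : ℝ), K r s = z / (1 + z * s) := by
      intro s hs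
      have h2 := hre s hs
      simp only [K]
      rw [integral_const_mul, integral_exp_mul_complex_Ioi (by rw [neg_re]; linarith)]
      simp only [ofReal_zero, mul_zero, Complex.exp_zero]
      rw [neg_div_neg_eq, mul_one_div]
    rw [setIntegral_congr_fun measurableSet_Ioc h1,
      ← intervalIntegral.integral_of_le zero_le_one]
    have hd : ∀ s ∈ Set.uIcc (0 : ℝ) 1, HasDerivAt (fun s : ℝ => Complex.log (1 + z * s))
        (z / (1 + z * s)) s := by
      intro s hs
      rw [Set.uIcc_of_le zero_le_one] at hs
      have h2 : HasDerivAt (fun s : ℝ => 1 + z * s) (z * 1) s :=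
        ((ofRealCLM.hasDerivAt (x := s)).const_mul z).const_add 1
      have h3 : 1 + z * s ∈ slitPlane := one_add_mem_slitPlane (by
        rw [re_mul_ofReal]; exact mul_nonneg hz hs.1)
      simpa using h2.clog_real h3
    rw [intervalIntegral.integral_eq_sub_of_hasDerivAt hd]
    · simp
    · refine ContinuousOn.intervalIntegrable fun s hs => ?_
      rw [Set.uIcc_of_le zero_le_one] at hs
      have h3 : 1 + z * s ≠ 0 := one_add_ne_zero' (by
        rw [re_mul_ofReal]; exact mul_nonneg hz hs.1)
      have h4 : ContinuousAt (fun s : ℝ => z / (1 + z * s)) s := by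
        refine ContinuousAt.div (by fun_prop) (by fun_prop) h3
      exact h4.continuousWithinAt

lemma log_mul_of_re_pos {z w : ℂ} (hz : 0 < z.re) (hw : 0 < w.re) :
    Complex.log (z * w) = Complex.log z + Complex.log w := by
  have h1 := abs_lt.1 (abs_arg_lt_pi_div_two_iff.2 (Or.inl hz))
  have h2 := abs_lt.1 (abs_arg_lt_pi_div_two_iff.2 (Or.inl hw))
  refine Complex.log_mul (by rintro rfl; simp at hz) (by rintro rfl; simp at hw) ⟨?_, ?_⟩ <;>
    linarith [h1.1, h1.2, h2.1, h2.2]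

lemma log_div_of_re_pos {z w : ℂ} (hz : 0 < z.re) (hw : 0 < w.re) :
    Complex.log (z / w) = Complex.log z - Complex.log w := by
  have h : 0 < (w⁻¹).re := by
    rw [inv_re]
    exact div_pos hw (normSq_pos.2 (by rintro rfl; simp at hw))
  have h2 := abs_lt.1 (abs_arg_lt_pi_div_two_iff.2 (Or.inl hw))
  rw [div_eq_mul_inv, log_mul_of_re_pos hz h, Complex.log_inv _ (by linarith [h2.2, Real.pi_pos] :
    w.arg < Real.pi).ne, sub_eq_add_neg]

/-- The residual in the self-decomposition `g = c g' + κ` of the gamma distribution with shape `a`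
and rate one. It is a negative binomial mixture of gamma distributions, because
`((1 + c z) / (1 + z)) ^ a = c ^ a (1 - (1 - c) / (1 + c z)) ^ (-a)`. -/
lemma exists_gamma_residual {a c : ℝ} (ha : 0 < a) (hc : 0 < c) (hc1 : c < 1) :
    ∃ κ : Measure ℝ, IsProbabilityMeasure κ ∧ (∀ᵐ x ∂κ, 0 ≤ x) ∧
      ∀ z : ℂ, 0 ≤ z.re → ∫ x, cexp (-(z * x)) ∂κ =
        cexp (a * (Complex.log (1 + c * z) - Complex.log (1 + z))) := by
  -- the weights of the negative binomial distribution
  let w : ℕ → ℝ := fun k => c ^ a * (Ring.choose (a + k - 1) k * (1 - c) ^ k)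
  have hw : ∀ k, 0 ≤ w k := by
    intro k
    have h1 : 0 ≤ Ring.choose (a + k - 1) k := by
      rw [← Ring.multichoose_eq]
      have h2 := Ring.factorial_nsmul_multichoose_eq_ascPochhammer a k
      rw [Polynomial.ascPochhammer_smeval_eq_eval, nsmul_eq_mul] at h2
      have h3 := ascPochhammer_pos k a ha
      rw [← h2] at h3
      exact (pos_of_mul_pos_right h3 (by positivity)).le
    have : 0 ≤ 1 - c := by linarith
    positivity
  -- `gammaMeasure 0` is not a point mass at the origin, so the term `k = 0` is treated separately
  let ν : ℕ → Measure ℝ := fun k => if k = 0 then Measure.dirac 0 else gammaMeasure k (1 / c)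
  have hνp : ∀ k, IsProbabilityMeasure (ν k) := by
    intro k
    simp only [ν]
    split_ifs with h
    · infer_instance
    · exact isProbabilityMeasure_gammaMeasure (by positivity) (by positivity)
  have hν0 : ∀ k, ∀ᵐ x ∂(ν k), 0 ≤ x := by
    intro k
    simp only [ν]
    split_ifs with h
    · rw [ae_dirac_iff measurableSet_Ici]
    · exact ae_nonneg_gammaMeasure _ _
  have hνL : ∀ k (z : ℂ), 0 ≤ z.re → ∫ x, cexp (-(z * x)) ∂(ν k) = (1 / (1 + c * z)) ^ k := by
    intro k z hz
    simp only [ν]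
    split_ifs with h
    · simp [h]
    · have hne : 1 + c * z ≠ 0 := one_add_ne_zero' (by
        rw [re_ofReal_mul]; exact mul_nonneg hc.le hz)
      have h2 : (1 : ℂ) + z / ((1 / c : ℝ) : ℂ) = 1 + c * z := by
        push_cast; field_simp
      rw [laplace_gammaMeasure (by positivity) (by positivity) hz, h2, Complex.exp_neg]
      push_cast
      rw [Complex.exp_nat_mul, Complex.exp_log hne, one_div, inv_pow]
  have hsum : ∀ z : ℂ, 0 ≤ z.re → HasSum (fun k => (w k : ℂ) * (1 / (1 + c * z)) ^ k)
      (cexp (a * (Complex.log (1 + c * z) - Complex.log (1 + z)))) := by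
    intro z hz
    have hcz : 0 ≤ ((c : ℂ) * z).re := by rw [re_ofReal_mul]; exact mul_nonneg hc.le hz
    have hne : 1 + c * z ≠ 0 := one_add_ne_zero' hcz
    have hne1 : 1 + z ≠ 0 := one_add_ne_zero' hz
    have hcc : (c : ℂ) ≠ 0 := by exact_mod_cast hc.ne'
    set y : ℂ := (1 - c) / (1 + c * z) with hy
    have hnorm : ‖y‖ < 1 := by
      have h1 : 1 ≤ ‖1 + c * z‖ := by
        have := Complex.re_le_norm (1 + c * z)
        simp only [add_re, one_re] at this
        linarith
      have h2 : ‖(1 : ℂ) - c‖ = 1 - c := by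
        rw [← ofReal_one, ← ofReal_sub, Complex.norm_real, Real.norm_of_nonneg (by linarith)]
      rw [hy, norm_div, h2, div_lt_one (by linarith)]
      linarith
    -- the binomial series of `(1 - y) ^ (-a)`
    have h1 := (Complex.one_div_one_sub_cpow_hasFPowerSeriesOnBall_zero a).hasSum (y := y)
      (by
        rw [Metric.mem_eball, edist_zero_right, ← ofReal_norm, ENNReal.ofReal_lt_one]
        exact hnorm)
    simp only [FormalMultilinearSeries.ofScalars_apply_eq, zero_add, smul_eq_mul] at h1
    have h2 := h1.mul_left ((c : ℂ) ^ (a : ℂ))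
    have h3 : (1 : ℂ) - y = c * ((1 + z) / (1 + c * z)) := by
      rw [hy]; field_simp; ring
    have hq : (1 + z) / (1 + c * z) ≠ 0 := div_ne_zero hne1 hne
    have h5 : (c : ℂ) ^ (a : ℂ) * (1 / (1 - y) ^ (a : ℂ)) =
        cexp (a * (Complex.log (1 + c * z) - Complex.log (1 + z))) := by
      rw [h3, cpow_def_of_ne_zero hcc, cpow_def_of_ne_zero (mul_ne_zero hcc hq),
        Complex.log_ofReal_mul hc hq, one_div, ← Complex.exp_neg, ← Complex.exp_add,
        log_div_of_re_pos (by rw [add_re, one_re]; linarith) (by rw [add_re, one_re]; linarith),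
        ← ofReal_log hc.le]
      congr 1
      ring
    rw [h5] at h2
    convert! h2 using 2 with k
    simp only [w, hy]
    push_cast
    rw [Complex.ofReal_cpow hc.le, div_pow, div_pow, one_pow]
    ring
  have hprob : IsProbabilityMeasure (Measure.sum fun k => ENNReal.ofReal (w k) • ν k) := by
    refine ⟨?_⟩
    have h0 := hsum 0 (by simp)
    have h1 : HasSum w 1 := by
      have : HasSum (fun k => (w k : ℂ)) ((1 : ℝ) : ℂ) := by simpa using h0
      exact_mod_cast this
    rw [Measure.sum_apply _ MeasurableSet.univ]
    simp only [Measure.smul_apply, measure_univ, smul_eq_mul, mul_one]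
    rw [← ENNReal.ofReal_tsum_of_nonneg hw h1.summable, h1.tsum_eq, ENNReal.ofReal_one]
  have hnn : ∀ᵐ x ∂(Measure.sum fun k => ENNReal.ofReal (w k) • ν k), 0 ≤ x := by
    rw [Measure.ae_sum_iff' measurableSet_Ici]
    exact fun k => Measure.ae_smul_measure (hν0 k) _
  refine ⟨Measure.sum fun k => ENNReal.ofReal (w k) • ν k, hprob, hnn, fun z hz => ?_⟩
  have hint : Integrable (fun x : ℝ => cexp (-(z * x)))
      (Measure.sum fun k => ENNReal.ofReal (w k) • ν k) := by
    refine Integrable.of_bound (Measurable.aestronglyMeasurable (by fun_prop)) 1 ?_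
    filter_upwards [hnn] with x hx
    rw [Complex.norm_exp, neg_re, re_mul_ofReal]
    exact Real.exp_le_one_iff.2 (by nlinarith)
  refine (hasSum_integral_measure hint).unique ?_
  have h := hsum z hz
  simp only [integral_smul_measure, hνL _ z hz, ENNReal.toReal_ofReal (hw _), real_smul]
  exact h

/-! ### Self-decomposable distributions -/

/-- By Lévy's uniqueness theorem the defining convolution identity may be tested on characteristic
functions. -/
lemma isSelfDecomposable_iff_charFun {ρ : Measure (E n)} [IsProbabilityMeasure ρ] :
    IsSelfDecomposable ρ ↔ ∀ b : ℝ, 0 < b → b < 1 → ∃ ζ : Measure (E n), IsProbabilityMeasure ζ ∧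
      ∀ θ, charFun ρ θ = charFun ρ (b • θ) * charFun ζ θ := by
  have hp : ∀ b : ℝ, IsProbabilityMeasure (ρ.map fun x => b • x) := fun b =>
    Measure.isProbabilityMeasure_map (Measurable.aemeasurable (by fun_prop))
  refine forall_congr' fun b => forall_congr' fun _ => forall_congr' fun _ =>
    exists_congr fun ζ => and_congr_right fun hζ => ?_
  have := hp b
  constructor
  · intro h θ
    conv_lhs => rw [h]
    rw [charFun_conv, charFun_map_smul]
  · intro h
    refine Measure.ext_of_charFun (funext fun θ => ?_)
    rw [charFun_conv, charFun_map_smul, h θ]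

lemma IsSelfDecomposable.conv {ρ₁ ρ₂ : Measure (E n)} [IsProbabilityMeasure ρ₁]
    [IsProbabilityMeasure ρ₂] (h₁ : IsSelfDecomposable ρ₁) (h₂ : IsSelfDecomposable ρ₂) :
    IsSelfDecomposable (ρ₁.conv ρ₂) := by
  rw [isSelfDecomposable_iff_charFun] at h₁ h₂ ⊢
  intro b hb hb1
  obtain ⟨ζ₁, hζ₁, h₁⟩ := h₁ b hb hb1
  obtain ⟨ζ₂, hζ₂, h₂⟩ := h₂ b hb hb1
  refine ⟨ζ₁.conv ζ₂, inferInstance, fun θ => ?_⟩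
  rw [charFun_conv, charFun_conv, charFun_conv, h₁, h₂]
  ring

/-- A factor `ζ` of `ρ` whose complementary factor is a contraction of `ρ` has tails controlled
by those of `ρ`. -/
lemma measure_norm_gt_le_of_eq_conv {ρ ζ : Measure (E n)} [IsProbabilityMeasure ρ]
    [IsProbabilityMeasure ζ] {b : ℝ} (hb : 0 < b) (hb1 : b < 1)
    (h : ρ = (ρ.map fun x => b • x).conv ζ) (r : ℝ) :
    ζ {x | r < ‖x‖} ≤ 2 * ρ {x | r / 2 < ‖x‖} := by
  have hmeas : ∀ s : ℝ, MeasurableSet {x : E n | s < ‖x‖} := fun s =>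
    measurableSet_lt measurable_const measurable_norm
  have hm : Measurable fun x : E n => b • x := by fun_prop
  have h1 : ρ {x | r / 2 < ‖x‖} = (ρ.prod ζ) {p | r / 2 < ‖b • p.1 + p.2‖} := by
    conv_lhs => rw [h]
    rw [Measure.conv, ← Measure.map_id (μ := ζ), Measure.map_prod_map _ _ hm measurable_id,
      Measure.map_id, Measure.map_map (by fun_prop) (by fun_prop),
      Measure.map_apply (by fun_prop) (hmeas _)]
    rfl
  have h2 : ρ {x | r / 2 < ‖x‖} = (ρ.prod ζ) {p | r / 2 < ‖p.1‖} := by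
    have : {p : E n × E n | r / 2 < ‖p.1‖} = {x | r / 2 < ‖x‖} ×ˢ Set.univ := by ext; simp
    rw [this, Measure.prod_prod]; simp
  have h3 : ζ {x | r < ‖x‖} = (ρ.prod ζ) {p | r < ‖p.2‖} := by
    have : {p : E n × E n | r < ‖p.2‖} = Set.univ ×ˢ {x | r < ‖x‖} := by ext; simp
    rw [this, Measure.prod_prod]; simp
  rw [two_mul]
  nth_rewrite 1 [h1]
  rw [h2, h3]
  refine (measure_mono ?_).trans (measure_union_le _ _)
  intro p hp
  have hp : r < ‖p.2‖ := hp
  by_contra hcon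
  simp only [Set.mem_union, Set.mem_ofPred_eq, not_or, not_lt] at hcon
  have h4 : ‖p.2‖ ≤ ‖b • p.1 + p.2‖ + ‖b • p.1‖ := by
    have := norm_sub_le (b • p.1 + p.2) (b • p.1)
    simpa using this
  have h5 : ‖b • p.1‖ ≤ ‖p.1‖ := by
    rw [norm_smul, Real.norm_of_nonneg hb.le]
    nlinarith [norm_nonneg p.1]
  linarith [hcon.1, hcon.2]

lemma tendsto_charFun_of_tendsto {ι : Type*} {l : Filter ι} {ρs : ι → ProbabilityMeasure (E n)}
    {ρ : ProbabilityMeasure (E n)} (h : Tendsto ρs l (𝓝 ρ)) (θ : E n) :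
    Tendsto (fun k => charFun (ρs k : Measure (E n)) θ) l (𝓝 (charFun (ρ : Measure (E n)) θ)) := by
  rw [ProbabilityMeasure.tendsto_iff_forall_integral_rclike_tendsto ℂ] at h
  simp_rw [charFun_eq_integral_innerProbChar]
  exact h (BoundedContinuousFunction.innerProbChar θ)

/-- Self-decomposability is preserved by convergence in distribution: the residuals of a convergent
sequence are tight, and any limit point of them is a residual of the limit. -/
lemma isSelfDecomposable_of_tendsto {ρs : ℕ → ProbabilityMeasure (E n)}
    {ρ : ProbabilityMeasure (E n)} (hs : ∀ k, IsSelfDecomposable (ρs k : Measure (E n)))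
    (h : Tendsto ρs atTop (𝓝 ρ)) : IsSelfDecomposable (ρ : Measure (E n)) := by
  rw [isSelfDecomposable_iff_charFun]
  intro b hb hb1
  choose ζ hζp hζ using fun k => hs k b hb hb1
  -- the tails of the residuals are controlled by those of the convergent sequence `ρs`
  have hρt : IsTightMeasureSet (Set.range fun k => (ρs k : Measure (E n))) :=
    isTightMeasureSet_of_tendsto_charFun (f := charFun (ρ : Measure (E n))) (by fun_prop)
      (tendsto_charFun_of_tendsto h)
  have hζt : IsTightMeasureSet (Set.range ζ) := by
    rw [isTightMeasureSet_iff_tendsto_measure_norm_gt] at hρt ⊢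
    have h1 : Tendsto (fun r : ℝ => 2 * ⨆ μ ∈ Set.range fun k => (ρs k : Measure (E n)),
        μ {x | r / 2 < ‖x‖}) atTop (𝓝 0) := by
      have h2 := hρt.comp (tendsto_id.atTop_div_const (two_pos : (0 : ℝ) < 2))
      have h3 := ENNReal.Tendsto.const_mul (a := 2) h2 (Or.inr (by simp))
      rw [mul_zero] at h3
      exact h3
    refine tendsto_of_tendsto_of_tendsto_of_le_of_le tendsto_const_nhds h1 (fun _ => zero_le)
      fun r => ?_
    refine iSup₂_le ?_
    rintro _ ⟨k, rfl⟩
    refine (measure_norm_gt_le_of_eq_conv hb hb1 (hζ k) r).trans ?_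
    gcongr
    exact le_iSup₂ (f := fun (μ : Measure (E n)) (_ : μ ∈ Set.range fun k => (ρs k : Measure (E n)))
      => μ {x | r / 2 < ‖x‖}) (ρs k : Measure (E n)) ⟨k, rfl⟩
  let ζ' : ℕ → ProbabilityMeasure (E n) := fun k => ⟨ζ k, hζp k⟩
  have hcomp : IsCompact (closure (Set.range ζ')) := by
    refine isCompact_closure_of_isTightMeasureSet ?_
    convert! hζt using 1
    ext μ
    constructor
    · rintro ⟨_, ⟨k, rfl⟩, rfl⟩
      exact ⟨k, rfl⟩
    · rintro ⟨k, rfl⟩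
      exact ⟨ζ' k, ⟨k, rfl⟩, rfl⟩
  -- an ultrafilter replaces the choice of a convergent subsequence of the residuals
  let U : Ultrafilter ℕ := hyperfilter ℕ
  have hU : (U : Filter ℕ) ≤ atTop := by
    rw [← Nat.cofinite_eq_atTop]
    exact hyperfilter_le_cofinite
  obtain ⟨ζ₀, -, hζ₀⟩ := hcomp.ultrafilter_le_nhds (U.map ζ') (by
    rw [le_principal_iff, Ultrafilter.coe_map, mem_map]
    exact Filter.Eventually.of_forall fun k => subset_closure ⟨k, rfl⟩)
  have hζ₀ : Tendsto ζ' U (𝓝 ζ₀) := hζ₀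
  refine ⟨ζ₀, inferInstance, fun θ => ?_⟩
  have h1 := tendsto_charFun_of_tendsto (h.mono_left hU) θ
  have h2 := (tendsto_charFun_of_tendsto (h.mono_left hU) (b • θ)).mul
    (tendsto_charFun_of_tendsto hζ₀ θ)
  refine tendsto_nhds_unique h1 (h2.congr fun k => ?_)
  have hpk : IsProbabilityMeasure ((ρs k : Measure (E n)).map fun x => b • x) :=
    Measure.isProbabilityMeasure_map (Measurable.aemeasurable (by fun_prop))
  have := hζp k
  conv_rhs => rw [hζ k]
  rw [charFun_conv, charFun_map_smul]
  rfl

lemma ConvLimitClosure.isSelfDecomposable {𝒮 : Set (ProbabilityMeasure (E n))}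
    (h𝒮 : ∀ ρ ∈ 𝒮, IsSelfDecomposable (ρ : Measure (E n))) {ρ : ProbabilityMeasure (E n)}
    (h : ConvLimitClosure 𝒮 ρ) : IsSelfDecomposable (ρ : Measure (E n)) := by
  induction h with
  | base ρ hρ => exact h𝒮 ρ hρ
  | conv ρ₁ ρ₂ ρ _ _ heq ih₁ ih₂ =>
    rw [heq]
    exact ih₁.conv ih₂
  | limit ρs ρ _ hlim ih => exact isSelfDecomposable_of_tendsto ih hlim

/-! ### Gaussian and gamma distributions are self-decomposable -/

/-- The quadratic form of a covariance matrix, halved: the Gaussian exponent is its negative. -/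
def halfQuad (S : Matrix (Fin n) (Fin n) ℝ) (θ : E n) : ℝ := (θ ⬝ᵥ S *ᵥ θ) / 2

lemma halfQuad_nonneg {S : Matrix (Fin n) (Fin n) ℝ} (hS : S.PosSemidef) (θ : E n) :
    0 ≤ halfQuad S θ := by
  have := hS.dotProduct_mulVec_nonneg (ofLp θ)
  simp only [star_trivial] at this
  unfold halfQuad
  positivity

lemma halfQuad_smul (S : Matrix (Fin n) (Fin n) ℝ) (c : ℝ) (θ : E n) :
    halfQuad S (c • θ) = c ^ 2 * halfQuad S θ := by
  simp only [halfQuad, ofLp_smul, Matrix.mulVec_smul, smul_dotProduct, dotProduct_smul, smul_eq_mul]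
  ring

lemma halfQuad_matrix_smul (S : Matrix (Fin n) (Fin n) ℝ) (c : ℝ) (θ : E n) :
    halfQuad (c • S) θ = c * halfQuad S θ := by
  simp only [halfQuad, Matrix.smul_mulVec, dotProduct_smul, smul_eq_mul]
  ring

lemma charFun_multivariateGaussian' (m : E n) {S : Matrix (Fin n) (Fin n) ℝ} (hS : S.PosSemidef)
    (θ : E n) : charFun (multivariateGaussian m S) θ =
      cexp (I * (⟪m, θ⟫ : ℝ) - (halfQuad S θ : ℝ)) := by
  rw [charFun_multivariateGaussian hS, halfQuad, real_inner_comm]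
  push_cast
  congr 1
  ring

lemma isSelfDecomposable_multivariateGaussian (m : E n) {S : Matrix (Fin n) (Fin n) ℝ}
    (hS : S.PosSemidef) : IsSelfDecomposable (multivariateGaussian m S) := by
  rw [isSelfDecomposable_iff_charFun]
  intro b hb hb1
  have hb2 : 0 ≤ 1 - b ^ 2 := by nlinarith
  refine ⟨multivariateGaussian ((1 - b) • m) ((1 - b ^ 2) • S), inferInstance, fun θ => ?_⟩
  rw [charFun_multivariateGaussian' _ hS, charFun_multivariateGaussian' _ hS,
    charFun_multivariateGaussian' _ (hS.smul hb2), ← Complex.exp_add, halfQuad_smul,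
    halfQuad_matrix_smul, real_inner_smul_right, real_inner_smul_left]
  congr 1
  push_cast
  ring

/-- The characteristic function of a distribution carried by a ray. -/
lemma charFun_map_smul_const (κ : Measure ℝ) (e θ : E n) :
    charFun (κ.map fun x : ℝ => x • e) θ = ∫ x, cexp (-(-(I * (⟪e, θ⟫ : ℝ)) * x)) ∂κ := by
  rw [charFun_apply, integral_map (by fun_prop) (Measurable.aestronglyMeasurable (by fun_prop))]
  congr 1
  funext x
  rw [real_inner_smul_left]
  congr 1
  push_cast
  ring

lemma charFun_map_smul_gammaMeasure {a : ℝ} (ha : 0 < a) (e θ : E n) :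
    charFun ((gammaMeasure a 1).map fun x : ℝ => x • e) θ =
      cexp (-(a * Complex.log (1 - I * (⟪e, θ⟫ : ℝ)))) := by
  rw [charFun_map_smul_const, laplace_gammaMeasure ha one_pos (by simp)]
  simp [sub_eq_add_neg]

/-- Gamma distributions on a ray are self-decomposable. -/
lemma isSelfDecomposable_map_smul_gammaMeasure {a : ℝ} (ha : 0 < a) (e : E n) :
    IsSelfDecomposable ((gammaMeasure a 1).map fun x : ℝ => x • e) := by
  have := isProbabilityMeasure_gammaMeasure ha one_pos
  have : IsProbabilityMeasure ((gammaMeasure a 1).map fun x : ℝ => x • e) :=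
    Measure.isProbabilityMeasure_map (by fun_prop)
  rw [isSelfDecomposable_iff_charFun]
  intro b hb hb1
  obtain ⟨κ, hκ, -, hκL⟩ := exists_gamma_residual ha hb hb1
  refine ⟨κ.map fun x : ℝ => x • e, Measure.isProbabilityMeasure_map (by fun_prop), fun θ => ?_⟩
  rw [charFun_map_smul_gammaMeasure ha, charFun_map_smul_gammaMeasure ha, charFun_map_smul_const,
    hκL _ (by simp), ← Complex.exp_add, real_inner_smul_right]
  congr 1
  push_cast
  rw [show (1 : ℂ) - I * (b * (⟪e, θ⟫ : ℝ)) = 1 + b * -(I * (⟪e, θ⟫ : ℝ)) by ring,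
    show (1 : ℂ) - I * (⟪e, θ⟫ : ℝ) = 1 + -(I * (⟪e, θ⟫ : ℝ)) by ring]
  ring

/-- The characteristic function of a driftless Gaussian variance mixture. -/
lemma charFun_variance_mixture {κ : Measure ℝ} [IsProbabilityMeasure κ] (hκ : ∀ᵐ x ∂κ, 0 ≤ x)
    {S : Matrix (Fin n) (Fin n) ℝ} (hS : S.PosSemidef) (θ : E n) :
    charFun ((κ.prod (multivariateGaussian 0 S)).map fun p : ℝ × E n => √p.1 • p.2) θ =
      ∫ x, cexp (-((halfQuad S θ : ℝ) * x)) ∂κ := by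
  have hm : Measurable fun p : ℝ × E n => √p.1 • p.2 := by fun_prop
  rw [charFun_apply, integral_map hm.aemeasurable (Measurable.aestronglyMeasurable (by fun_prop)),
    integral_prod]
  · refine integral_congr_ae ?_
    filter_upwards [hκ] with x hx
    have h1 : ∀ y : E n, (⟪√x • y, θ⟫ : ℝ) = ⟪y, √x • θ⟫ := fun y => by
      rw [real_inner_smul_left, real_inner_smul_right]
    simp only [h1]
    rw [← charFun_apply, charFun_multivariateGaussian' _ hS, halfQuad_smul, Real.sq_sqrt hx]
    congr 1
    rw [inner_zero_left]
    push_cast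
    ring
  · refine Integrable.of_bound (Measurable.aestronglyMeasurable (by fun_prop)) 1
      (ae_of_all _ fun p => ?_)
    rw [Complex.norm_exp_ofReal_mul_I]

instance isProbabilityMeasure_variance_mixture (κ : Measure ℝ) [IsProbabilityMeasure κ]
    (S : Matrix (Fin n) (Fin n) ℝ) : IsProbabilityMeasure
      ((κ.prod (multivariateGaussian 0 S)).map fun p : ℝ × E n => √p.1 • p.2) :=
  Measure.isProbabilityMeasure_map (Measurable.aemeasurable (by fun_prop))

lemma isProbabilityMeasure_vgDistribution {b : ℝ} (hb : 0 < b) (μ : E n)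
    (S : Matrix (Fin n) (Fin n) ℝ) : IsProbabilityMeasure (vgDistribution b μ S) := by
  have := isProbabilityMeasure_gammaMeasure hb hb
  exact Measure.isProbabilityMeasure_map (Measurable.aemeasurable (by fun_prop))

lemma charFun_vgDistribution_zero {b : ℝ} (hb : 0 < b) {S : Matrix (Fin n) (Fin n) ℝ}
    (hS : S.PosSemidef) (θ : E n) : charFun (vgDistribution b 0 S) θ =
      cexp (-(b * Complex.log (1 + (halfQuad S θ : ℝ) / b))) := by
  rw [charFun_vgDistribution hb 0 hS, ← laplace_gammaMeasure hb hb
    (by simpa using halfQuad_nonneg hS θ)]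
  congr 1
  funext g
  congr 1
  simp only [levyKhintchine, inner_zero_left, integral_zero_measure, halfQuad]
  push_cast
  ring

/-- Driftless variance gamma distributions inherit self-decomposability from the gamma distribution:
scaling by `c` multiplies the variance by `c²`, and the residual is the Gaussian variance mixture
over the residual of the gamma distribution for `c²`. -/
lemma isSelfDecomposable_vgDistribution_zero {b : ℝ} (hb : 0 < b) {S : Matrix (Fin n) (Fin n) ℝ}
    (hS : S.PosSemidef) : IsSelfDecomposable (vgDistribution b 0 S) := by
  have := isProbabilityMeasure_vgDistribution hb 0 S
  rw [isSelfDecomposable_iff_charFun]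
  intro c hc hc1
  obtain ⟨κ, hκ, hκ0, hκL⟩ := exists_gamma_residual hb (c := c ^ 2) (by positivity) (by nlinarith)
  have hS' : (b⁻¹ • S).PosSemidef := hS.smul (by positivity)
  refine ⟨(κ.prod (multivariateGaussian 0 (b⁻¹ • S))).map fun p : ℝ × E n => √p.1 • p.2,
    inferInstance, fun θ => ?_⟩
  rw [charFun_vgDistribution_zero hb hS, charFun_vgDistribution_zero hb hS,
    charFun_variance_mixture hκ0 hS', hκL _ (by simpa using halfQuad_nonneg hS' θ),
    ← Complex.exp_add, halfQuad_smul, halfQuad_matrix_smul]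
  congr 1
  push_cast
  rw [show (b : ℂ)⁻¹ * (halfQuad S θ : ℝ) = (halfQuad S θ : ℝ) / b by ring,
    show (c : ℂ) ^ 2 * (halfQuad S θ : ℝ) / b = c ^ 2 * ((halfQuad S θ : ℝ) / b) by ring]
  ring

/-- A univariate variance gamma distribution with drift is self-decomposable, being the
convolution of two gamma distributions on opposite half-lines:
`1 - (i p θ - q θ²) = (1 - i α θ) (1 + i β θ)` with real `α` and `β`. -/
lemma exists_isSelfDecomposable_charFun_eq (e : E n) (p : ℝ) {a q : ℝ} (ha : 0 < a) (hq : 0 ≤ q) :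
    ∃ ρ : ProbabilityMeasure (E n), IsSelfDecomposable (ρ : Measure (E n)) ∧
      ∀ θ, charFun (ρ : Measure (E n)) θ = cexp (-(a * Complex.log
        (1 - (I * (p * ⟪e, θ⟫ : ℝ) - (q * ⟪e, θ⟫ ^ 2 : ℝ))))) := by
  have := isProbabilityMeasure_gammaMeasure ha one_pos
  set D := √(p ^ 2 + 4 * q) with hD
  have hDsq : D ^ 2 = p ^ 2 + 4 * q := Real.sq_sqrt (by positivity)
  set α := (D + p) / 2 with hα
  set β := (D - p) / 2 with hβ
  have hαβ : α - β = p := by rw [hα, hβ]; ring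
  have hαβ' : α * β = q := by rw [hα, hβ]; linear_combination hDsq / 4
  have h1 : IsProbabilityMeasure ((gammaMeasure a 1).map fun x : ℝ => x • (α • e)) :=
    Measure.isProbabilityMeasure_map (by fun_prop)
  have h2 : IsProbabilityMeasure ((gammaMeasure a 1).map fun x : ℝ => x • (-β • e)) :=
    Measure.isProbabilityMeasure_map (by fun_prop)
  refine ⟨⟨((gammaMeasure a 1).map fun x : ℝ => x • (α • e)).conv
    ((gammaMeasure a 1).map fun x : ℝ => x • (-β • e)), inferInstance⟩, ?_, fun θ => ?_⟩
  · exact (isSelfDecomposable_map_smul_gammaMeasure ha _).conv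
      (isSelfDecomposable_map_smul_gammaMeasure ha _)
  · have h3 : ∀ x : ℝ, 0 < (1 - I * (x : ℂ)).re := fun x => by simp
    have h4 : (1 : ℂ) - (I * (p * ⟪e, θ⟫ : ℝ) - (q * ⟪e, θ⟫ ^ 2 : ℝ)) =
        (1 - I * (⟪α • e, θ⟫ : ℝ)) * (1 - I * (⟪-β • e, θ⟫ : ℝ)) := by
      rw [real_inner_smul_left, real_inner_smul_left, ← hαβ, ← hαβ']
      push_cast
      linear_combination (α * β * (⟪e, θ⟫ : ℝ) ^ 2 : ℂ) * I_sq
    rw [h4, log_mul_of_re_pos (h3 _) (h3 _)]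
    change charFun (((gammaMeasure a 1).map fun x : ℝ => x • (α • e)).conv
      ((gammaMeasure a 1).map fun x : ℝ => x • (-β • e))) θ = _
    rw [charFun_conv, charFun_map_smul_gammaMeasure ha, charFun_map_smul_gammaMeasure ha,
      ← Complex.exp_add]
    congr 1
    ring

/-- The self-decomposable distributions contain the Gaussian and the driftless variance gamma
distributions, and are closed under convolution and limits. -/
theorem IsBMAddGVGCZero.isSD {Ω : Type*} [MeasurableSpace Ω] {P : Measure Ω}
    {X : ℝ≥0 → Ω → E n} (h : IsBMAddGVGCZero P X) : IsSD P X := by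
  obtain ⟨hX, m, C, ρ, hC, hρ, heq⟩ := h
  refine ⟨hX, ?_⟩
  rw [heq]
  refine (isSelfDecomposable_multivariateGaussian m hC).conv
    (ConvLimitClosure.isSelfDecomposable ?_ hρ)
  rintro σ ⟨b, S, hb, hS, hσ⟩
  rw [hσ]
  exact isSelfDecomposable_vgDistribution_zero hb hS

/-! ### Generation of mixed distributions by convolution and limits -/

/-- The case of a measure of finite support of `ConvLimitClosure.of_charFun_eq_integral`. -/
lemma ConvLimitClosure.exists_finset_sum {𝒮 : Set (ProbabilityMeasure (E n))} {s : Set (E n)}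
    {f : E n → E n → ℂ}
    (h𝒮 : ∀ u ∈ s, ∀ c : ℝ, 0 < c → ∃ ρ : ProbabilityMeasure (E n), ConvLimitClosure 𝒮 ρ ∧
      ∀ θ, charFun (ρ : Measure (E n)) θ = cexp (c * f u θ))
    {ρ₀ : ProbabilityMeasure (E n)} (hρ₀ : ConvLimitClosure 𝒮 ρ₀) (F : Finset (E n))
    (hF : ∀ u ∈ F, u ∈ s) {v : E n → ℝ} (hv : ∀ u, 0 ≤ v u) :
    ∃ ρ : ProbabilityMeasure (E n), ConvLimitClosure 𝒮 ρ ∧ ∀ θ, charFun (ρ : Measure (E n)) θ =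
      charFun (ρ₀ : Measure (E n)) θ * cexp (∑ u ∈ F, v u * f u θ) := by
  classical
  induction F using Finset.induction_on with
  | empty => exact ⟨ρ₀, hρ₀, fun θ => by simp⟩
  | insert u F hu ih =>
    obtain ⟨ρ₁, hρ₁, h₁⟩ := ih fun y hy => hF y (Finset.mem_insert_of_mem hy)
    rcases (hv u).eq_or_lt with h0 | h0
    · refine ⟨ρ₁, hρ₁, fun θ => ?_⟩
      rw [h₁, Finset.sum_insert hu, ← h0]
      simp
    · obtain ⟨ρ₂, hρ₂, h₂⟩ := h𝒮 u (hF u (Finset.mem_insert_self _ _)) (v u) h0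
      refine ⟨⟨(ρ₁ : Measure (E n)).conv (ρ₂ : Measure (E n)), inferInstance⟩,
        .conv ρ₁ ρ₂ _ hρ₁ hρ₂ rfl, fun θ => ?_⟩
      change charFun ((ρ₁ : Measure (E n)).conv (ρ₂ : Measure (E n))) θ = _
      rw [charFun_conv, h₁, h₂, Finset.sum_insert hu, Complex.exp_add]
      ring

/-- A distribution with the characteristic function `charFun ρ₀ * exp (∫ f u dU)` is generated by
`ρ₀` and the distributions with characteristic functions `exp (c f u)`: after normalisation by the
weight `w`, the measure `U` becomes finite, and it is then the limit of measures of finite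
support. -/
theorem ConvLimitClosure.of_charFun_eq_integral {𝒮 : Set (ProbabilityMeasure (E n))}
    {s : Set (E n)} (hne : s.Nonempty) {f : E n → E n → ℂ}
    (h𝒮 : ∀ u ∈ s, ∀ c : ℝ, 0 < c → ∃ ρ : ProbabilityMeasure (E n), ConvLimitClosure 𝒮 ρ ∧
      ∀ θ, charFun (ρ : Measure (E n)) θ = cexp (c * f u θ))
    {U : Measure (E n)} (hUs : ∀ᵐ u ∂U, u ∈ s) {w : E n → ℝ} (hwm : Measurable w)
    (hw : ∀ u ∈ s, 0 < w u) (hwc : ContinuousOn w s) (hwU : ∫⁻ u, ENNReal.ofReal (w u) ∂U < ∞)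
    (hfc : ∀ θ, ContinuousOn (fun u => f u θ) s)
    (hfw : ∀ θ, ∃ C : ℝ, ∀ u ∈ s, ‖f u θ‖ ≤ C * w u)
    {ρ₀ : ProbabilityMeasure (E n)} (hρ₀ : ConvLimitClosure 𝒮 ρ₀) {ρ : ProbabilityMeasure (E n)}
    (hρ : ∀ θ, charFun (ρ : Measure (E n)) θ =
      charFun (ρ₀ : Measure (E n)) θ * cexp (∫ u, f u θ ∂U)) :
    ConvLimitClosure 𝒮 ρ := by
  classical
  obtain ⟨y₀, hy₀⟩ := hne
  have hwm' : Measurable fun u => ENNReal.ofReal (w u) := hwm.ennreal_ofReal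
  -- the finite measure `V = w U` and the bounded continuous integrand `h = f / w`
  set V := U.withDensity fun u => ENNReal.ofReal (w u) with hV
  have : IsFiniteMeasure V := isFiniteMeasure_withDensity hwU.ne
  have hVs : ∀ᵐ u ∂V, u ∈ s := (withDensity_absolutelyContinuous _ _).ae_le hUs
  let h : E n → E n → ℂ := fun θ u => f u θ / w u
  have hhc : ∀ θ, ContinuousOn (h θ) s := fun θ =>
    (hfc θ).div (continuous_ofReal.comp_continuousOn hwc) fun u hu => by
      exact_mod_cast (hw u hu).ne'
  have hhV : ∀ θ, ∫ u, f u θ ∂U = ∫ u, h θ u ∂V := by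
    intro θ
    rw [hV, integral_withDensity_eq_integral_toReal_smul hwm'
      (ae_of_all _ fun _ => ENNReal.ofReal_lt_top)]
    refine integral_congr_ae ?_
    filter_upwards [hUs] with u hu
    have h1 : (w u : ℂ) ≠ 0 := by exact_mod_cast (hw u hu).ne'
    rw [ENNReal.toReal_ofReal (hw u hu).le, real_smul]
    simp only [h]
    field_simp
  -- the simple functions `a k` take values in `s` and converge to the identity on `s`
  let a : ℕ → SimpleFunc (E n) (E n) := SimpleFunc.approxOn id measurable_id s y₀ hy₀
  have ha : ∀ k u, a k u ∈ s := fun k u => SimpleFunc.approxOn_mem measurable_id hy₀ k u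
  have hsum : ∀ k θ, ∫ u, h θ (a k u) ∂V =
      ∑ y ∈ (a k).range, ((V.real (a k ⁻¹' {y}) / w y : ℝ) : ℂ) * f y θ := by
    intro k θ
    have h1 : ∀ u, h θ (a k u) =
        ∑ y ∈ (a k).range, (a k ⁻¹' {y}).indicator (fun _ => h θ y) u := by
      intro u
      rw [Finset.sum_eq_single (a k u)]
      · rw [Set.indicator_of_mem (by simp)]
      · intro y _ hy
        rw [Set.indicator_of_notMem]
        simpa using hy.symm
      · intro hu
        exact absurd (SimpleFunc.mem_range_self _ _) hu
    simp_rw [h1]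
    rw [integral_finsetSum]
    · refine Finset.sum_congr rfl fun y _ => ?_
      rw [integral_indicator_const _ (SimpleFunc.measurableSet_fiber _ _), real_smul]
      simp only [h]
      push_cast
      ring
    · intro y _
      exact (integrable_const _).indicator (SimpleFunc.measurableSet_fiber _ _)
  have hex : ∀ k, ∃ ρ : ProbabilityMeasure (E n), ConvLimitClosure 𝒮 ρ ∧
      ∀ θ, charFun (ρ : Measure (E n)) θ =
        charFun (ρ₀ : Measure (E n)) θ * cexp (∫ u, h θ (a k u) ∂V) := by
    intro k
    -- the absolute value makes the masses nonnegative off `s`, where the sign of `w` is unknown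
    obtain ⟨ρ₁, hρ₁, h₁⟩ := ConvLimitClosure.exists_finset_sum h𝒮 hρ₀ (a k).range
      (fun y hy => by
        obtain ⟨u, rfl⟩ := SimpleFunc.mem_range.1 hy
        exact ha k u)
      (v := fun y => V.real (a k ⁻¹' {y}) / |w y|) (fun y => by positivity)
    refine ⟨ρ₁, hρ₁, fun θ => ?_⟩
    rw [h₁, hsum]
    congr 2
    refine Finset.sum_congr rfl fun y hy => ?_
    obtain ⟨u, rfl⟩ := SimpleFunc.mem_range.1 hy
    rw [abs_of_pos (hw _ (ha k u))]
  choose ρs hρs hρsc using hex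
  refine .limit ρs ρ hρs (ProbabilityMeasure.tendsto_of_tendsto_charFun fun θ => ?_)
  simp only [hρsc, hρ, hhV]
  refine Tendsto.const_mul _ ((Complex.continuous_exp.tendsto _).comp ?_)
  obtain ⟨C, hC⟩ := hfw θ
  refine tendsto_integral_of_dominated_convergence (fun _ => C) (fun k => ?_)
    (integrable_const _) (fun k => ae_of_all _ fun u => ?_) ?_
  · exact ((a k).map (h θ)).measurable.aestronglyMeasurable
  · have h1 := hw _ (ha k u)
    simp only [h]
    rw [norm_div, Complex.norm_real, Real.norm_of_nonneg h1.le, div_le_iff₀ h1]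
    exact hC _ (ha k u)
  · filter_upwards [hVs] with u hu
    have h1 : Tendsto (fun k => a k u) atTop (𝓝 u) :=
      SimpleFunc.tendsto_approxOn measurable_id hy₀ (subset_closure hu)
    exact (hhc θ u hu).tendsto.comp
      (tendsto_nhdsWithin_iff.2 ⟨h1, Eventually.of_forall fun k => ha k u⟩)

/-- The driftless variance gamma distributions. -/
def vgZeroSet (n : ℕ) : Set (ProbabilityMeasure (E n)) :=
  {σ | ∃ (b : ℝ) (S : Matrix (Fin n) (Fin n) ℝ),
    0 < b ∧ S.PosSemidef ∧ (σ : Measure (E n)) = vgDistribution b 0 S}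

/-- A centred Gaussian distribution is the limit of the distributions `VG(b, 0, S)` as `b → ∞`. -/
lemma convLimitClosure_multivariateGaussian_zero {S : Matrix (Fin n) (Fin n) ℝ}
    (hS : S.PosSemidef) :
    ConvLimitClosure (vgZeroSet n) ⟨multivariateGaussian 0 S, inferInstance⟩ := by
  have hpos : ∀ k : ℕ, (0 : ℝ) < (k : ℝ) + 1 := fun k => by positivity
  refine .limit (fun k => ⟨vgDistribution ((k : ℝ) + 1) 0 S,
    isProbabilityMeasure_vgDistribution (hpos k) 0 S⟩) _
    (fun k => .base _ ⟨(k : ℝ) + 1, S, hpos k, hS, rfl⟩)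
    (ProbabilityMeasure.tendsto_of_tendsto_charFun fun θ => ?_)
  simp only [ProbabilityMeasure.coe_mk]
  rw [charFun_multivariateGaussian' _ hS]
  simp only [charFun_vgDistribution_zero (hpos _) hS]
  refine (Complex.continuous_exp.tendsto _).comp ?_
  have h1 : Tendsto (fun k : ℕ => ((k : ℝ) + 1) * Real.log (1 + halfQuad S θ / ((k : ℝ) + 1)))
      atTop (𝓝 (halfQuad S θ)) :=
    (Real.tendsto_mul_log_one_add_div_atTop _).comp
      (tendsto_atTop_add_const_right _ _ tendsto_natCast_atTop_atTop)
  have h2 := (Complex.continuous_ofReal.tendsto _).comp h1.neg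
  have h3 : I * ((⟪(0 : E n), θ⟫ : ℝ) : ℂ) - (halfQuad S θ : ℝ) = ((-halfQuad S θ : ℝ) : ℂ) := by
    simp
  rw [h3]
  refine h2.congr fun k => ?_
  have h4 : 0 ≤ 1 + halfQuad S θ / ((k : ℝ) + 1) := by
    have := halfQuad_nonneg hS θ
    positivity
  rw [Function.comp_apply]
  push_cast
  rw [Complex.ofReal_log h4]
  push_cast
  rfl

/-! ### The exponent of a Brownian motion at a multivariate time -/

/-- The exponent of `(B₁(t₁), …, Bₙ(tₙ))` for a Brownian motion `B` with drift `μ` and covariance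
`S`: it is `i ⟪t ⋄ μ, θ⟫ - ⟪θ, (t ⋄ S) θ⟫ / 2`. -/
def timeExponent (μ : E n) (S : Matrix (Fin n) (Fin n) ℝ) (θ t : E n) : ℂ :=
  I * (⟪diamondVec t μ, θ⟫ : ℝ) - (halfQuad (diamondMat t S) θ : ℝ)

lemma continuous_timeExponent (μ : E n) (S : Matrix (Fin n) (Fin n) ℝ) (θ : E n) :
    Continuous (timeExponent μ S θ) := by
  change Continuous fun t => timeExponent μ S θ t
  simp only [timeExponent, diamondVec, diamondMat, halfQuad, PiLp.inner_apply, dotProduct,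
    Matrix.mulVec, Matrix.of_apply]
  fun_prop

lemma diamondVec_smul (c : ℝ) (t μ : E n) : diamondVec (c • t) μ = c • diamondVec t μ := by
  ext k
  simp [diamondVec, mul_assoc]

lemma diamondMat_smul {c : ℝ} (hc : 0 ≤ c) (t : E n) (S : Matrix (Fin n) (Fin n) ℝ) :
    diamondMat (c • t) S = c • diamondMat t S := by
  ext k l
  simp [diamondMat, ← mul_min_of_nonneg _ _ hc, mul_assoc]

lemma timeExponent_smul (μ : E n) (S : Matrix (Fin n) (Fin n) ℝ) (θ : E n) {c : ℝ} (hc : 0 ≤ c)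
    (t : E n) : timeExponent μ S θ (c • t) = c * timeExponent μ S θ t := by
  simp only [timeExponent, diamondVec_smul, diamondMat_smul hc, halfQuad_matrix_smul,
    real_inner_smul_left]
  push_cast
  ring

lemma timeExponent_zero_right (μ : E n) (S : Matrix (Fin n) (Fin n) ℝ) (θ : E n) :
    timeExponent μ S θ 0 = 0 := by
  simpa using timeExponent_smul μ S θ le_rfl 0

/-- By homogeneity the exponent grows at most linearly in time. -/
lemma exists_norm_timeExponent_le (μ : E n) (S : Matrix (Fin n) (Fin n) ℝ) (θ : E n) :
    ∃ K : ℝ, 0 ≤ K ∧ ∀ t, ‖timeExponent μ S θ t‖ ≤ K * ‖t‖ := by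
  obtain ⟨K, hK⟩ := (isCompact_closedBall (0 : E n) 1).exists_bound_of_continuousOn
    (continuous_timeExponent μ S θ).continuousOn
  refine ⟨max K 0, le_max_right _ _, fun t => ?_⟩
  rcases eq_or_ne t 0 with rfl | ht
  · simp [timeExponent_zero_right]
  · have ht' : 0 < ‖t‖ := norm_pos_iff.2 ht
    have h1 : t = ‖t‖ • (‖t‖⁻¹ • t) := by rw [smul_smul, mul_inv_cancel₀ ht'.ne', one_smul]
    have h2 := hK (‖t‖⁻¹ • t) (by simp [norm_smul, ht'.ne'])
    have h3 : ‖timeExponent μ S θ t‖ = ‖t‖ * ‖timeExponent μ S θ (‖t‖⁻¹ • t)‖ := by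
      conv_lhs => rw [h1, timeExponent_smul μ S θ ht'.le]
      rw [norm_mul, Complex.norm_real, norm_norm]
    rw [h3, mul_comm]
    gcongr
    exact h2.trans (le_max_left _ _)

lemma re_timeExponent (μ : E n) (S : Matrix (Fin n) (Fin n) ℝ) (θ t : E n) :
    (timeExponent μ S θ t).re = -halfQuad (diamondMat t S) θ := by
  simp [timeExponent]

lemma charFun_multivariateGaussian_diamond (μ : E n) {S : Matrix (Fin n) (Fin n) ℝ} {t : E n}
    (h : (diamondMat t S).PosSemidef) (θ : E n) :
    charFun (multivariateGaussian (diamondVec t μ) (diamondMat t S)) θ =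
      cexp (timeExponent μ S θ t) :=
  charFun_multivariateGaussian' _ h θ

/-! ### The weight of a Thorin measure -/

/-- The weight `(1 + ln⁻ ‖u‖) ∧ (1 / ‖u‖)` that a Thorin measure integrates. -/
def thorinWeight (u : E n) : ℝ := min (1 + max (-Real.log ‖u‖) 0) (1 / ‖u‖)

lemma thorinWeight_pos {u : E n} (hu : u ≠ 0) : 0 < thorinWeight u := by
  have h1 : 0 < ‖u‖ := norm_pos_iff.2 hu
  refine lt_min ?_ (by positivity)
  have := le_max_right (-Real.log ‖u‖) 0
  linarith

lemma measurable_thorinWeight : Measurable (thorinWeight : E n → ℝ) := by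
  unfold thorinWeight
  fun_prop

lemma continuousOn_thorinWeight : ContinuousOn (thorinWeight : E n → ℝ) {u | u ≠ 0} := by
  intro u hu
  have h1 : ‖u‖ ≠ 0 := norm_ne_zero_iff.2 hu
  have h2 : ContinuousAt (thorinWeight : E n → ℝ) u := by
    unfold thorinWeight
    have h3 : ContinuousAt (fun u : E n => -Real.log ‖u‖) u :=
      (ContinuousAt.log (by fun_prop) h1).neg
    have h4 : ContinuousAt (fun u : E n => 1 / ‖u‖) u :=
      ContinuousAt.div (by fun_prop) (by fun_prop) h1
    exact Tendsto.min (tendsto_const_nhds.add (Tendsto.max h3 tendsto_const_nhds)) h4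
  exact h2.continuousWithinAt

/-- The weight of a Thorin measure dominates `log (1 + 1 / ‖u‖)`, which is of the order of both the
Thorin exponent and the integral of `1 ∧ ‖t‖` over the Lévy measure attached to `u`. -/
lemma log_one_add_inv_norm_le {u : E n} (hu : u ≠ 0) :
    Real.log (1 + 1 / ‖u‖) ≤ thorinWeight u := by
  have h1 : 0 < ‖u‖ := norm_pos_iff.2 hu
  refine le_min ?_ ?_
  · have h2 : 1 + 1 / ‖u‖ = (1 + ‖u‖) / ‖u‖ := by field_simp; ring
    have hl2 : Real.log 2 ≤ 1 := (Real.log_le_sub_one_of_pos two_pos).trans (by norm_num)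
    rcases le_total ‖u‖ 1 with h | h
    · rw [h2, Real.log_div (by positivity) h1.ne']
      have h3 : Real.log (1 + ‖u‖) ≤ Real.log 2 := Real.log_le_log (by positivity) (by linarith)
      have := le_max_left (-Real.log ‖u‖) 0
      linarith
    · have h3 : Real.log (1 + 1 / ‖u‖) ≤ Real.log 2 := by
        refine Real.log_le_log (by positivity) ?_
        have : 1 / ‖u‖ ≤ 1 := by rw [div_le_one h1]; exact h
        linarith
      have := le_max_right (-Real.log ‖u‖) 0
      linarith
  · have := Real.log_le_sub_one_of_pos (show 0 < 1 + 1 / ‖u‖ by positivity)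
    linarith

lemma min_one_le_two_mul_one_sub_exp {x : ℝ} (hx : 0 ≤ x) :
    min 1 x ≤ 2 * (1 - Real.exp (-x)) := by
  have h1 : Real.exp (-x) ≤ (1 + x)⁻¹ := by
    rw [Real.exp_neg]
    exact inv_anti₀ (by positivity) (by linarith [Real.add_one_le_exp x])
  have h2 : min 1 x ≤ 2 * (1 - (1 + x)⁻¹) := by
    have h3 : 1 - (1 + x)⁻¹ = x / (1 + x) := by field_simp; ring
    rw [h3, mul_div_assoc', le_div_iff₀ (by positivity)]
    rcases le_total x 1 with h | h
    · rw [min_eq_right h]; nlinarith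
    · rw [min_eq_left h]; linarith
  linarith

lemma frullani_gammaLevyMeasure_ofReal {x : ℝ} (hx : 0 ≤ x) :
    Integrable (fun r : ℝ => 1 - Real.exp (-(x * r))) gammaLevyMeasure ∧
      ∫ r, (1 - Real.exp (-(x * r))) ∂gammaLevyMeasure = Real.log (1 + x) := by
  obtain ⟨h1, h2⟩ := frullani_gammaLevyMeasure (z := (x : ℂ)) (by simpa using hx)
  have h3 : ∀ r : ℝ, 1 - cexp (-((x : ℂ) * r)) = ((1 - Real.exp (-(x * r)) : ℝ) : ℂ) := fun r => by
    push_cast; rfl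
  simp only [h3] at h1 h2
  refine ⟨by simpa only [RCLike.re_to_complex, ofReal_re] using h1.re, ?_⟩
  rw [integral_complex_ofReal] at h2
  rw [← ofReal_inj, h2, ofReal_log (by positivity)]
  push_cast
  rfl

lemma integral_min_one_gammaLevyMeasure_le {x : ℝ} (hx : 0 ≤ x) :
    Integrable (fun r : ℝ => min 1 (x * r)) gammaLevyMeasure ∧
      ∫ r, min 1 (x * r) ∂gammaLevyMeasure ≤ 2 * Real.log (1 + x) := by
  obtain ⟨h1, h2⟩ := frullani_gammaLevyMeasure_ofReal hx
  have hle : ∀ᵐ r ∂gammaLevyMeasure, min 1 (x * r) ≤ 2 * (1 - Real.exp (-(x * r))) := by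
    filter_upwards [ae_pos_gammaLevyMeasure] with r hr
    exact min_one_le_two_mul_one_sub_exp (by positivity)
  have hint : Integrable (fun r : ℝ => min 1 (x * r)) gammaLevyMeasure := by
    refine (h1.const_mul 2).mono' (Measurable.aestronglyMeasurable (by fun_prop)) ?_
    filter_upwards [hle, ae_pos_gammaLevyMeasure] with r hr hr0
    rwa [Real.norm_of_nonneg (le_min zero_le_one (by positivity))]
  refine ⟨hint, ?_⟩
  rw [← h2, ← integral_const_mul]
  exact integral_mono_ae hint (h1.const_mul 2) hle

/-- A bound for the complex logarithm near one and near infinity at once, by Frullani's integral. -/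
lemma norm_log_one_add_le {z : ℂ} (hz : 0 ≤ z.re) {K x : ℝ} (hK : 0 ≤ K) (hx : 0 ≤ x)
    (hzK : ‖z‖ ≤ K * x) : ‖Complex.log (1 + z)‖ ≤ 4 * (1 + K) * Real.log (1 + x) := by
  obtain ⟨h1, h2⟩ := frullani_gammaLevyMeasure hz
  obtain ⟨h3, h4⟩ := integral_min_one_gammaLevyMeasure_le hx
  rw [← h2]
  refine (norm_integral_le_integral_norm _).trans ?_
  calc ∫ r : ℝ, ‖1 - cexp (-(z * r))‖ ∂gammaLevyMeasure
      ≤ ∫ r, 2 * (1 + K) * min 1 (x * r) ∂gammaLevyMeasure := by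
        refine integral_mono_ae h1.norm (h3.const_mul _) ?_
        filter_upwards [ae_pos_gammaLevyMeasure] with r hr
        have h5 : (-(z * r)).re ≤ 0 := by
          simp only [neg_re, re_mul_ofReal]
          nlinarith
        have h6 := norm_exp_sub_one_le_min h5
        rw [norm_neg, norm_mul, Complex.norm_real, Real.norm_of_nonneg hr.le] at h6
        rw [norm_sub_rev]
        have h7 : min 1 (‖z‖ * r) ≤ min 1 (K * (x * r)) := by
          refine min_le_min le_rfl ?_
          rw [← mul_assoc]
          gcongr
        have h8 := min_one_mul_le hK (show 0 ≤ x * r by positivity)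
        linarith
    _ ≤ 4 * (1 + K) * Real.log (1 + x) := by
        rw [integral_const_mul]
        nlinarith

/-! ### The exponent of a Thorin subordinated Brownian motion -/

/-- The exponent `-log (1 - A(u) / ‖u‖²)` of the variance gamma distribution that corresponds to a
point `u` of the support of a Thorin measure, where `A` is the exponent of the Brownian motion. -/
def thorinExponent (μ : E n) (S : Matrix (Fin n) (Fin n) ℝ) (θ u : E n) : ℂ :=
  -Complex.log (1 - timeExponent μ S θ u / ‖u‖ ^ 2)

/-- The nonnegative orthant without the origin. -/
def orthant (n : ℕ) : Set (E n) := {u | (∀ k, 0 ≤ u k) ∧ u ≠ 0}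

lemma re_neg_timeExponent_div_nonneg {μ : E n} {S : Matrix (Fin n) (Fin n) ℝ} {u : E n}
    (h : (diamondMat u S).PosSemidef) (θ : E n) :
    0 ≤ (-(timeExponent μ S θ u / ‖u‖ ^ 2)).re := by
  have h1 : timeExponent μ S θ u / (‖u‖ : ℂ) ^ 2 =
      timeExponent μ S θ u / ((‖u‖ ^ 2 : ℝ) : ℂ) := by push_cast; rfl
  rw [h1, neg_re, div_ofReal_re, re_timeExponent]
  have := halfQuad_nonneg h θ
  rw [neg_div, neg_neg]
  positivity

/-- Thorin measures integrate the Thorin exponent. -/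
lemma exists_norm_thorinExponent_le (μ : E n) {S : Matrix (Fin n) (Fin n) ℝ}
    (hS : ∀ t : E n, (∀ k, 0 ≤ t k) → (diamondMat t S).PosSemidef) (θ : E n) :
    ∃ C : ℝ, ∀ u ∈ orthant n, ‖thorinExponent μ S θ u‖ ≤ C * thorinWeight u := by
  obtain ⟨K, hK, hKle⟩ := exists_norm_timeExponent_le μ S θ
  refine ⟨4 * (1 + K), fun u hu => ?_⟩
  have hu' : 0 < ‖u‖ := norm_pos_iff.2 hu.2
  rw [thorinExponent, norm_neg, sub_eq_add_neg]
  refine (norm_log_one_add_le (re_neg_timeExponent_div_nonneg (hS u hu.1) θ) hK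
    (x := 1 / ‖u‖) (by positivity) ?_).trans ?_
  · rw [norm_neg, norm_div, norm_pow, Complex.norm_real, norm_norm, div_le_iff₀ (by positivity)]
    refine (hKle u).trans (le_of_eq ?_)
    field_simp
  · gcongr
    exact log_one_add_inv_norm_le hu.2

lemma continuousOn_thorinExponent (μ : E n) {S : Matrix (Fin n) (Fin n) ℝ}
    (hS : ∀ t : E n, (∀ k, 0 ≤ t k) → (diamondMat t S).PosSemidef) (θ : E n) :
    ContinuousOn (thorinExponent μ S θ) (orthant n) := by
  intro u hu
  have hu' : ‖u‖ ≠ 0 := norm_ne_zero_iff.2 hu.2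
  have h1 : ContinuousAt (fun u : E n => 1 - timeExponent μ S θ u / ‖u‖ ^ 2) u := by
    refine continuousAt_const.sub (ContinuousAt.div (continuous_timeExponent μ S θ).continuousAt
      (by fun_prop) ?_)
    exact pow_ne_zero 2 (by exact_mod_cast hu')
  have h2 : 1 - timeExponent μ S θ u / ‖u‖ ^ 2 ∈ slitPlane := by
    rw [sub_eq_add_neg]
    exact one_add_mem_slitPlane (re_neg_timeExponent_div_nonneg (hS u hu.1) θ)
  exact ((h1.clog h2).neg).continuousWithinAt

lemma IsThorinMeasure.ae_mem_orthant {U : Measure (E n)} (hU : IsThorinMeasure U) :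
    ∀ᵐ u ∂U, u ∈ orthant n := by
  refine measure_mono_null (fun u hu => ?_) hU.support
  by_contra h
  simp only [Set.mem_ofPred_eq, not_or, not_exists, not_lt] at h
  exact hu ⟨h.1, h.2⟩

lemma orthant_nonempty (hn : 0 < n) : (orthant n).Nonempty := by
  refine ⟨toLp 2 fun _ => 1, fun k => by simp, fun h => ?_⟩
  have := congrArg (fun x : E n => x ⟨0, hn⟩) h
  simp at this

/-- A distribution with Thorin exponent belongs to every class that is closed under convolution and
limits and contains the Gaussian part and the distributions of the points of the support. -/
theorem ConvLimitClosure.of_thorinExponent {𝒮 : Set (ProbabilityMeasure (E n))} (hn : 0 < n)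
    {μ : E n} {S : Matrix (Fin n) (Fin n) ℝ}
    (hS : ∀ t : E n, (∀ k, 0 ≤ t k) → (diamondMat t S).PosSemidef) {U : Measure (E n)}
    (hU : IsThorinMeasure U)
    (h𝒮 : ∀ u ∈ orthant n, ∀ c : ℝ, 0 < c → ∃ ρ : ProbabilityMeasure (E n), ConvLimitClosure 𝒮 ρ ∧
      ∀ θ, charFun (ρ : Measure (E n)) θ = cexp (c * thorinExponent μ S θ u))
    {ρ₀ : ProbabilityMeasure (E n)} (hρ₀ : ConvLimitClosure 𝒮 ρ₀) {ρ : ProbabilityMeasure (E n)}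
    (hρ : ∀ θ, charFun (ρ : Measure (E n)) θ =
      charFun (ρ₀ : Measure (E n)) θ * cexp (∫ u, thorinExponent μ S θ u ∂U)) :
    ConvLimitClosure 𝒮 ρ :=
  .of_charFun_eq_integral (f := fun u θ => thorinExponent μ S θ u) (orthant_nonempty hn) h𝒮
    hU.ae_mem_orthant measurable_thorinWeight (fun _ hu => thorinWeight_pos hu.2)
    (continuousOn_thorinWeight.mono fun _ hu => hu.2) hU.lintegral_lt_top
    (continuousOn_thorinExponent μ hS) (exists_norm_thorinExponent_le μ hS) hρ₀ hρ

/-- Without drift, the distributions of the points of the support are variance gamma. -/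
lemma exists_vgZero_charFun_eq_thorinExponent {S : Matrix (Fin n) (Fin n) ℝ}
    (hS : ∀ t : E n, (∀ k, 0 ≤ t k) → (diamondMat t S).PosSemidef) {u : E n} (hu : u ∈ orthant n)
    {c : ℝ} (hc : 0 < c) : ∃ ρ : ProbabilityMeasure (E n), ConvLimitClosure (vgZeroSet n) ρ ∧
      ∀ θ, charFun (ρ : Measure (E n)) θ = cexp (c * thorinExponent 0 S θ u) := by
  have hS' : ((c / ‖u‖ ^ 2) • diamondMat u S).PosSemidef := (hS u hu.1).smul (by positivity)
  refine ⟨⟨vgDistribution c 0 ((c / ‖u‖ ^ 2) • diamondMat u S),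
    isProbabilityMeasure_vgDistribution hc _ _⟩, .base _ ⟨c, _, hc, hS', rfl⟩, fun θ => ?_⟩
  rw [ProbabilityMeasure.coe_mk, charFun_vgDistribution_zero hc hS', halfQuad_matrix_smul,
    thorinExponent]
  have hcc : (c : ℂ) ≠ 0 := by exact_mod_cast hc.ne'
  have h1 : diamondVec u (0 : E n) = 0 := by ext k; simp [diamondVec]
  have h2 : (1 : ℂ) + ((c / ‖u‖ ^ 2 * halfQuad (diamondMat u S) θ : ℝ) : ℂ) / c =
      1 - timeExponent 0 S θ u / ‖u‖ ^ 2 := by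
    rw [timeExponent, h1]
    push_cast
    rw [inner_zero_left]
    field_simp
    push_cast
    ring
  rw [h2, mul_neg]

/-! ### Laplace transforms of subordinators -/

section LaplaceOfSubordinator

variable {ν τ : Measure ℝ} {t d : ℝ}

lemma diffContOnCl_exp_neg_laplaceExponent (hτ : ∀ᵐ x ∂τ, 0 ≤ x)
    (hint : Integrable (fun x : ℝ => min 1 x) τ) (t d : ℝ) :
    DiffContOnCl ℂ (fun z : ℂ => cexp (-(t * (z * d + ∫ x, (1 - cexp (-(z * x))) ∂τ))))
      {z | 0 < z.re} := by
  have h1 : DiffContOnCl ℂ (fun z : ℂ => z * (d : ℂ)) {z | 0 < z.re} :=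
    (differentiable_id.mul_const _).diffContOnCl
  have h2 := (h1.add (diffContOnCl_integral_one_sub_exp_neg_mul hτ hint)).const_smul (-(t : ℂ))
  have h3 := Complex.differentiable_exp.comp_diffContOnCl h2
  convert! h3 using 2 with z
  simp [mul_add, add_comm]

/-- A distribution on `[0, ∞)` whose Laplace transform has the Lévy-Khintchine form on the positive
reals has it on the closed right half-plane. -/
lemma laplace_eq_of_laplace_ofReal_eq [IsProbabilityMeasure ν] (hν : ∀ᵐ x ∂ν, 0 ≤ x)
    (hτ : ∀ᵐ x ∂τ, 0 ≤ x) (hint : Integrable (fun x : ℝ => min 1 x) τ)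
    (h : ∀ y : ℝ, 0 < y → ∫ x, cexp (-((y : ℂ) * x)) ∂ν =
      cexp (-(t * ((y : ℂ) * d + ∫ x, (1 - cexp (-((y : ℂ) * x))) ∂τ)))) {z : ℂ} (hz : 0 ≤ z.re) :
    ∫ x, cexp (-(z * x)) ∂ν = cexp (-(t * (z * d + ∫ x, (1 - cexp (-(z * x))) ∂τ))) :=
  eq_of_diffContOnCl_of_eq_ofReal (diffContOnCl_laplace hν)
    (diffContOnCl_exp_neg_laplaceExponent hτ hint t d) h hz

/-- A distribution on `[0, ∞)` whose characteristic function has the Lévy-Khintchine form has a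
Laplace transform of that form on the closed right half-plane: the difference of the two bounded
holomorphic functions vanishes on the imaginary axis, hence vanishes by the Phragmén-Lindelöf
principle. -/
lemma laplace_eq_of_charFun_eq [IsProbabilityMeasure ν] (hν : ∀ᵐ x ∂ν, 0 ≤ x)
    (hτ : ∀ᵐ x ∂τ, 0 ≤ x) (hint : Integrable (fun x : ℝ => min 1 x) τ) (ht : 0 ≤ t) (hd : 0 ≤ d)
    (h : ∀ y : ℝ, ∫ x, cexp (-((y * I) * x)) ∂ν =
      cexp (-(t * ((y * I) * d + ∫ x, (1 - cexp (-((y * I) * x))) ∂τ)))) {z : ℂ} (hz : 0 ≤ z.re) :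
    ∫ x, cexp (-(z * x)) ∂ν = cexp (-(t * (z * d + ∫ x, (1 - cexp (-(z * x))) ∂τ))) := by
  set F : ℂ → ℂ := fun z => ∫ x, cexp (-(z * x)) ∂ν with hF
  set G : ℂ → ℂ := fun z => cexp (-(t * (z * d + ∫ x, (1 - cexp (-(z * x))) ∂τ))) with hG
  have hFle : ∀ z : ℂ, 0 ≤ z.re → ‖F z‖ ≤ 1 := by
    intro z hz
    have h1 : ‖F z‖ ≤ 1 * ν.real Set.univ := by
      refine norm_integral_le_of_norm_le_const ?_
      filter_upwards [hν] with x hx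
      rw [Complex.norm_exp, neg_re, re_mul_ofReal]
      exact Real.exp_le_one_iff.2 (by nlinarith)
    simpa using h1
  have hGle : ∀ z : ℂ, 0 ≤ z.re → ‖G z‖ ≤ 1 := by
    intro z hz
    simp only [hG]
    rw [Complex.norm_exp]
    refine Real.exp_le_one_iff.2 ?_
    have h1 : 0 ≤ (∫ x, (1 - cexp (-(z * x))) ∂τ).re := by
      have h2 := integral_re (integrable_one_sub_exp_neg_mul hτ hint hz)
      simp only [RCLike.re_to_complex] at h2
      rw [← h2]
      refine integral_nonneg_of_ae ?_
      filter_upwards [hτ] with x hx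
      have h3 : (cexp (-(z * x))).re ≤ ‖cexp (-(z * x))‖ := Complex.re_le_norm _
      have h4 : ‖cexp (-(z * x))‖ ≤ 1 := by
        rw [Complex.norm_exp, neg_re, re_mul_ofReal]
        exact Real.exp_le_one_iff.2 (by nlinarith)
      simp only [Pi.zero_apply, sub_re, one_re]
      linarith
    rw [neg_re, re_ofReal_mul, add_re, re_mul_ofReal]
    have : 0 ≤ t * (z.re * d + (∫ x, (1 - cexp (-(z * x))) ∂τ).re) := by positivity
    linarith
  have hFG : ∀ z : ℂ, 0 ≤ z.re → ‖F z - G z‖ ≤ 2 := fun z hz =>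
    (norm_sub_le _ _).trans (by linarith [hFle z hz, hGle z hz])
  have hdc : DiffContOnCl ℂ (fun z => F z - G z) {z | 0 < z.re} :=
    (diffContOnCl_laplace hν).sub (diffContOnCl_exp_neg_laplaceExponent hτ hint t d)
  have key := PhragmenLindelof.right_half_plane_of_bounded_on_real (C := 0) hdc
    ⟨0, by norm_num, 0, ?_⟩ ?_ ?_ hz
  · exact sub_eq_zero.1 (norm_le_zero_iff.1 key)
  · refine Asymptotics.IsBigO.of_bound 2 ?_
    filter_upwards [mem_inf_of_right (mem_principal_self _)] with w hw
    have hw : 0 < w.re := hw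
    simpa using hFG w hw.le
  · refine isBoundedUnder_of_eventually_le (a := 2) ?_
    filter_upwards [eventually_ge_atTop 0] with x hx
    exact hFG x (by simpa using hx)
  · intro x
    have := h x
    simp only [hF, hG, this, sub_self, norm_zero, le_refl]

end LaplaceOfSubordinator

/-! ### Lévy measures of finite variation -/

lemma IsLevyMeasure.integrable_min_one_norm_sq {𝒳 : Measure (E n)} (h : IsLevyMeasure 𝒳) :
    Integrable (fun x : E n => min 1 (‖x‖ ^ 2)) 𝒳 := by
  refine ⟨Measurable.aestronglyMeasurable (by fun_prop), ?_⟩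
  rw [hasFiniteIntegral_iff_ofReal (ae_of_all _ fun x => by positivity)]
  exact h.lintegral_lt_top

/-- A Lévy measure of finite variation integrates `1 ∧ ‖t‖`. -/
lemma IsLevyMeasure.integrable_min_one_norm {𝒯 : Measure (E n)} (h : IsLevyMeasure 𝒯)
    (hfv : ∫⁻ t in Metric.closedBall 0 1, ‖t‖ₑ ∂𝒯 < ∞) :
    Integrable (fun t : E n => min 1 ‖t‖) 𝒯 := by
  have h1 := h.integrable_min_one_norm_sq
  have h2 : Integrable ((Metric.closedBall (0 : E n) 1).indicator fun t => ‖t‖) 𝒯 := by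
    rw [integrable_indicator_iff Metric.isClosed_closedBall.measurableSet]
    refine ⟨Measurable.aestronglyMeasurable (by fun_prop), ?_⟩
    simpa [HasFiniteIntegral] using hfv
  refine (h1.add h2).mono' (Measurable.aestronglyMeasurable (by fun_prop))
    (ae_of_all _ fun t => ?_)
  rw [Real.norm_of_nonneg (by positivity)]
  simp only [Pi.add_apply]
  by_cases ht : ‖t‖ ≤ 1
  · rw [Set.indicator_of_mem (by simpa using ht), min_eq_right ht]
    have : 0 ≤ min 1 (‖t‖ ^ 2) := by positivity
    linarith
  · rw [Set.indicator_of_notMem (by simpa using ht)]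
    have ht' : 1 ≤ ‖t‖ := (not_le.1 ht).le
    rw [min_eq_left ht', min_eq_left (by nlinarith)]
    simp

lemma norm_exp_I_mul_inner_sub_one_le (θ x : E n) :
    ‖cexp (I * (⟪θ, x⟫ : ℝ)) - 1‖ ≤ 2 * (1 + ‖θ‖) * min 1 ‖x‖ := by
  have h1 := norm_exp_sub_one_le_min (w := I * (⟪θ, x⟫ : ℝ)) (by simp)
  have h2 : ‖I * ((⟪θ, x⟫ : ℝ) : ℂ)‖ ≤ ‖θ‖ * ‖x‖ := by
    rw [norm_mul, norm_I, one_mul, Complex.norm_real]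
    exact norm_inner_le_norm θ x
  have h3 := min_one_mul_le (norm_nonneg θ) (norm_nonneg x)
  have h4 : min 1 ‖I * ((⟪θ, x⟫ : ℝ) : ℂ)‖ ≤ min 1 (‖θ‖ * ‖x‖) := min_le_min le_rfl h2
  linarith

lemma integrable_exp_I_mul_inner_sub_one {𝒯 : Measure (E n)}
    (hint : Integrable (fun t : E n => min 1 ‖t‖) 𝒯) (θ : E n) :
    Integrable (fun x : E n => cexp (I * (⟪θ, x⟫ : ℝ)) - 1) 𝒯 :=
  (hint.const_mul (2 * (1 + ‖θ‖))).mono' (Measurable.aestronglyMeasurable (by fun_prop))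
    (ae_of_all _ (norm_exp_I_mul_inner_sub_one_le θ))

lemma integrable_indicator_closedBall_id {𝒯 : Measure (E n)}
    (hint : Integrable (fun t : E n => min 1 ‖t‖) 𝒯) :
    Integrable ((Metric.closedBall (0 : E n) 1).indicator id) 𝒯 := by
  have hm : MeasurableSet (Metric.closedBall (0 : E n) 1) :=
    Metric.isClosed_closedBall.measurableSet
  refine hint.mono' (measurable_id.indicator hm).aestronglyMeasurable (ae_of_all _ fun t => ?_)
  by_cases ht : ‖t‖ ≤ 1
  · rw [Set.indicator_of_mem (by simpa using ht), min_eq_right ht, id]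
  · rw [Set.indicator_of_notMem (by simpa using ht), norm_zero]
    positivity

lemma indicator_closedBall_inner (θ x : E n) :
    (Metric.closedBall (0 : E n) 1).indicator (fun y => I * ((⟪θ, y⟫ : ℝ) : ℂ)) x =
      I * ((⟪θ, (Metric.closedBall (0 : E n) 1).indicator id x⟫ : ℝ) : ℂ) := by
  by_cases hx : x ∈ Metric.closedBall (0 : E n) 1
  · rw [Set.indicator_of_mem hx, Set.indicator_of_mem hx, id]
  · rw [Set.indicator_of_notMem hx, Set.indicator_of_notMem hx, inner_zero_right]
    simp

/-- The Lévy-Khintchine exponent of finite variation, in terms of the drift. -/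
lemma levyKhintchine_of_finite_variation {𝒯 : Measure (E n)}
    (hint : Integrable (fun t : E n => min 1 ‖t‖) 𝒯) (d θ : E n) :
    levyKhintchine (d + ∫ t in Metric.closedBall 0 1, t ∂𝒯) 0 𝒯 θ =
      I * (⟪d, θ⟫ : ℝ) + ∫ x, (cexp (I * (⟪θ, x⟫ : ℝ)) - 1) ∂𝒯 := by
  have hm : MeasurableSet (Metric.closedBall (0 : E n) 1) :=
    Metric.isClosed_closedBall.measurableSet
  have h1 := integrable_indicator_closedBall_id hint
  have h3 : Integrable (fun x => ⟪θ, (Metric.closedBall (0 : E n) 1).indicator id x⟫) 𝒯 :=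
    h1.const_inner θ
  have h5 : Integrable (fun x => I *
      ((⟪θ, (Metric.closedBall (0 : E n) 1).indicator id x⟫ : ℝ) : ℂ)) 𝒯 := h3.ofReal.const_mul I
  have h4 : ∫ t in Metric.closedBall 0 1, t ∂𝒯 =
      ∫ t, (Metric.closedBall (0 : E n) 1).indicator id t ∂𝒯 := by
    rw [integral_indicator hm]
    rfl
  simp only [levyKhintchine, indicator_closedBall_inner]
  rw [integral_sub (integrable_exp_I_mul_inner_sub_one hint θ) h5,
    integral_const_mul, integral_complex_ofReal, integral_inner h1, h4, inner_add_left,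
    real_inner_comm θ (∫ t, (Metric.closedBall (0 : E n) 1).indicator id t ∂𝒯)]
  simp only [Matrix.zero_mulVec, dotProduct_zero]
  push_cast
  ring

/-! ### The Laplace transform of a multivariate subordinator -/

lemma IsSubordinatorProcess.ae_nonneg {Ω : Type*} [MeasurableSpace Ω] {Q : Measure Ω}
    {T : ℝ≥0 → Ω → E n} (hT : IsSubordinatorProcess Q T) : ∀ᵐ ω ∂Q, ∀ t k, 0 ≤ T t ω k := by
  filter_upwards [hT.monotone, hT.isLevyProcess.zero] with ω h1 h2 t k
  have := h1 k (zero_le : 0 ≤ t)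
  simpa [h2] using this

lemma inner_nonneg_of_nonneg {l t : E n} (hl : ∀ k, 0 ≤ l k) (ht : ∀ k, 0 ≤ t k) :
    0 ≤ (⟪l, t⟫ : ℝ) := by
  rw [PiLp.inner_apply]
  exact Finset.sum_nonneg fun k _ => by simpa using mul_nonneg (ht k) (hl k)

lemma integrable_min_one_inner {𝒯 : Measure (E n)} (h0 : ∀ᵐ t ∂𝒯, ∀ k, 0 ≤ t k)
    (hint : Integrable (fun t : E n => min 1 ‖t‖) 𝒯) {l : E n} (hl : ∀ k, 0 ≤ l k) :
    Integrable (fun x : ℝ => min 1 x) (𝒯.map fun t => ⟪l, t⟫) := by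
  rw [integrable_map_measure (Measurable.aestronglyMeasurable (by fun_prop)) (by fun_prop)]
  refine (hint.const_mul (1 + ‖l‖)).mono' (Measurable.aestronglyMeasurable (by fun_prop)) ?_
  filter_upwards [h0] with t ht
  have h1 := inner_nonneg_of_nonneg hl ht
  simp only [Function.comp_apply]
  rw [Real.norm_of_nonneg (le_min zero_le_one h1)]
  exact (min_le_min le_rfl (real_inner_le_norm l t)).trans
    (min_one_mul_le (norm_nonneg l) (norm_nonneg t))

section Subordinator

variable {Ω : Type*} [MeasurableSpace Ω] {Q : Measure Ω} [IsProbabilityMeasure Q]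
  {T : ℝ≥0 → Ω → E n}

/-- The Laplace transform of a subordinator in terms of its drift and Lévy measure, on a complex
half-line of frequencies. -/
lemma IsSubordinator.laplace {d : E n} {𝒯 : Measure (E n)} (hT : IsSubordinator Q T d 𝒯)
    (t : ℝ≥0) {l : E n} (hl : ∀ k, 0 ≤ l k) {z : ℂ} (hz : 0 ≤ z.re) :
    ∫ ω, cexp (-(z * (⟪l, T t ω⟫ : ℝ))) ∂Q = cexp (-(((t : ℝ) : ℂ) * (z * (⟪l, d⟫ : ℝ) +
      ∫ x, (1 - cexp (-(z * (⟪l, x⟫ : ℝ)))) ∂𝒯))) := by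
  have hint := hT.isLevy.isLevyMeasure.integrable_min_one_norm hT.finite_variation
  have h0 : ∀ᵐ x ∂𝒯, ∀ k, 0 ≤ x k := by
    refine measure_mono_null (fun x hx => ?_) hT.support
    simpa using hx
  have hTm := hT.isSubordinatorProcess.isLevyProcess.measurable t
  have hm : Measurable fun ω => (⟪l, T t ω⟫ : ℝ) := by fun_prop
  have hm2 : Measurable fun x : E n => (⟪l, x⟫ : ℝ) := by fun_prop
  have := Measure.isProbabilityMeasure_map (μ := Q) hm.aemeasurable
  have hν : ∀ᵐ x ∂(Q.map fun ω => (⟪l, T t ω⟫ : ℝ)), 0 ≤ x := by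
    rw [ae_map_iff hm.aemeasurable measurableSet_Ici]
    filter_upwards [hT.isSubordinatorProcess.ae_nonneg] with ω hω
      using inner_nonneg_of_nonneg hl (hω t)
  have hτ : ∀ᵐ x ∂(𝒯.map fun x => (⟪l, x⟫ : ℝ)), 0 ≤ x := by
    rw [ae_map_iff hm2.aemeasurable measurableSet_Ici]
    filter_upwards [h0] with x hx using inner_nonneg_of_nonneg hl hx
  have key := laplace_eq_of_charFun_eq (t := t) (d := ⟪l, d⟫) hν hτ
    (integrable_min_one_inner h0 hint hl) t.2 (inner_nonneg_of_nonneg hl hT.drift_nonneg) ?_ hz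
  · rwa [integral_map hm.aemeasurable (Measurable.aestronglyMeasurable (by fun_prop)),
      integral_map hm2.aemeasurable (Measurable.aestronglyMeasurable (by fun_prop))] at key
  · intro y
    rw [integral_map hm.aemeasurable (Measurable.aestronglyMeasurable (by fun_prop)),
      integral_map hm2.aemeasurable (Measurable.aestronglyMeasurable (by fun_prop))]
    have h1 := hT.isLevy.hasExponent t (-(y • l))
    rw [levyKhintchine_of_finite_variation hint, charFun_apply, integral_map hTm.aemeasurable
      (Measurable.aestronglyMeasurable (by fun_prop))] at h1
    have h2 : ∀ x : E n, -((y * I) * ((⟪l, x⟫ : ℝ) : ℂ)) = ((⟪x, -(y • l)⟫ : ℝ) : ℂ) * I := by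
      intro x
      rw [inner_neg_right, real_inner_smul_right, real_inner_comm]
      push_cast
      ring
    simp only [h2, h1]
    congr 1
    have h3 : ∀ x : E n, (1 : ℂ) - cexp (((⟪x, -(y • l)⟫ : ℝ) : ℂ) * I) =
        -(cexp (I * ((⟪-(y • l), x⟫ : ℝ) : ℂ)) - 1) := by
      intro x
      rw [real_inner_comm, mul_comm I]
      ring
    simp only [h3]
    rw [integral_neg]
    rw [inner_neg_right, real_inner_smul_right, real_inner_comm]
    push_cast
    ring

end Subordinator

/-! ### Uniqueness of Lévy measures on the orthant -/

/-- Finite measures on the orthant with the same Laplace transform at all integer frequencies are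
equal: the exponentials span an algebra of bounded continuous functions that separates points. -/
lemma ext_of_laplace_pi_nnreal {ν₁ ν₂ : Measure (Fin n → ℝ≥0)} [IsFiniteMeasure ν₁]
    [IsFiniteMeasure ν₂] (h : ∀ l : Fin n → ℕ, ∫ x, Real.exp (-∑ k, (l k : ℝ) * x k) ∂ν₁ =
      ∫ x, Real.exp (-∑ k, (l k : ℝ) * x k) ∂ν₂) : ν₁ = ν₂ := by
  let M : (Fin n → ℕ) → BoundedContinuousFunction (Fin n → ℝ≥0) ℝ := fun l =>
    BoundedContinuousFunction.ofNormedAddCommGroup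
      (fun x => Real.exp (-∑ k, (l k : ℝ) * x k)) (by fun_prop) 1 fun x => by
        rw [Real.norm_of_nonneg (Real.exp_pos _).le]
        exact Real.exp_le_one_iff.2 (neg_nonpos.2 (Finset.sum_nonneg fun k _ => by positivity))
  have hM : ∀ l x, M l x = Real.exp (-∑ k, (l k : ℝ) * x k) := fun _ _ => rfl
  let 𝓜 : Submonoid (BoundedContinuousFunction (Fin n → ℝ≥0) ℝ) :=
    { carrier := Set.range M
      one_mem' := ⟨0, by ext x; simp [hM]⟩
      mul_mem' := by
        rintro _ _ ⟨l, rfl⟩ ⟨l', rfl⟩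
        refine ⟨l + l', ?_⟩
        ext x
        simp only [BoundedContinuousFunction.coe_mul, Pi.mul_apply, hM, ← Real.exp_add,
          Pi.add_apply, Nat.cast_add, add_mul, Finset.sum_add_distrib]
        congr 1
        ring }
  let A : StarSubalgebra ℝ (BoundedContinuousFunction (Fin n → ℝ≥0) ℝ) :=
    { Algebra.adjoin ℝ (𝓜 : Set _) with
      star_mem' := fun {f} hf => by
        have : star f = f := by ext x; simp
        rw [this]
        exact hf }
  have hA : ∀ f, f ∈ A ↔ f ∈ Submodule.span ℝ (𝓜 : Set _) := by
    intro f
    have h1 : f ∈ A ↔ f ∈ Algebra.adjoin ℝ (𝓜 : Set _) := Iff.rfl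
    rw [h1, ← Subalgebra.mem_toSubmodule, Algebra.adjoin_eq_span, Submonoid.closure_eq]
  refine ext_of_forall_mem_subalgebra_integral_eq_of_pseudoEMetric_complete_countable (𝕜 := ℝ)
    (A := A) ?_ fun f hf => ?_
  · intro x y hxy
    obtain ⟨k, hk⟩ := Function.ne_iff.1 hxy
    refine ⟨_, ⟨_, ⟨M (Pi.single k 1), (hA _).2 (Submodule.subset_span ⟨_, rfl⟩), rfl⟩, rfl⟩, ?_⟩
    change M (Pi.single k 1) x ≠ M (Pi.single k 1) y
    have h1 : ∀ x : Fin n → ℝ≥0,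
        ∑ j, ((Pi.single k 1 : Fin n → ℕ) j : ℝ) * (x j : ℝ) = x k := by
      intro x
      rw [Finset.sum_eq_single k]
      · simp
      · intro j _ hj
        simp [Pi.single_eq_of_ne hj]
      · simp
    rw [hM, hM, h1, h1]
    intro h2
    have h3 := Real.exp_injective h2
    exact hk (by exact_mod_cast neg_injective h3)
  · rw [hA] at hf
    induction hf using Submodule.span_induction with
    | mem f hf =>
      obtain ⟨l, rfl⟩ := hf
      exact h l
    | zero => simp
    | add f g _ _ ihf ihg =>
      simp only [BoundedContinuousFunction.coe_add, Pi.add_apply]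
      rw [integral_add (f.integrable _) (g.integrable _),
        integral_add (f.integrable _) (g.integrable _), ihf, ihg]
    | smul c f _ ih =>
      simp only [BoundedContinuousFunction.coe_smul]
      rw [integral_smul, integral_smul, ih]

/-- Uniqueness of the Laplace transform of finite measures on the orthant. -/
lemma ext_of_laplace {ν₁ ν₂ : Measure (E n)} [IsFiniteMeasure ν₁] [IsFiniteMeasure ν₂]
    (h₁ : ∀ᵐ t ∂ν₁, ∀ k, 0 ≤ t k) (h₂ : ∀ᵐ t ∂ν₂, ∀ k, 0 ≤ t k)
    (h : ∀ l : E n, (∀ k, 0 ≤ l k) → ∫ t, Real.exp (-⟪l, t⟫) ∂ν₁ = ∫ t, Real.exp (-⟪l, t⟫) ∂ν₂) :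
    ν₁ = ν₂ := by
  let p : E n → Fin n → ℝ≥0 := fun t k => (t k).toNNReal
  let i : (Fin n → ℝ≥0) → E n := fun x => toLp 2 fun k => (x k : ℝ)
  have hp : Measurable p := by
    refine measurable_pi_lambda _ fun k => ?_
    exact Measurable.real_toNNReal (by fun_prop)
  have hi : Measurable i := by
    have : Continuous i := by fun_prop
    exact this.measurable
  have hpi : ∀ t : E n, (∀ k, 0 ≤ t k) → i (p t) = t := by
    intro t ht
    ext k
    simp [i, p, ht k]
  have hback : ∀ ν : Measure (E n), (∀ᵐ t ∂ν, ∀ k, 0 ≤ t k) → (ν.map p).map i = ν := by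
    intro ν hν
    rw [Measure.map_map hi hp]
    conv_rhs => rw [← Measure.map_id (μ := ν)]
    refine Measure.map_congr ?_
    filter_upwards [hν] with t ht using hpi t ht
  have hint : ∀ ν : Measure (E n), (∀ᵐ t ∂ν, ∀ k, 0 ≤ t k) → ∀ l : Fin n → ℕ,
      ∫ x, Real.exp (-∑ k, (l k : ℝ) * x k) ∂(ν.map p) =
        ∫ t, Real.exp (-⟪(toLp 2 fun k => (l k : ℝ) : E n), t⟫) ∂ν := by
    intro ν hν l
    rw [integral_map hp.aemeasurable (Measurable.aestronglyMeasurable (by fun_prop))]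
    refine integral_congr_ae ?_
    filter_upwards [hν] with t ht
    simp only [PiLp.inner_apply, p, Real.coe_toNNReal _ (ht _)]
    simp [mul_comm]
  have : ν₁.map p = ν₂.map p := by
    refine ext_of_laplace_pi_nnreal fun l => ?_
    rw [hint ν₁ h₁, hint ν₂ h₂]
    exact h _ fun k => by simp
  rw [← hback ν₁ h₁, ← hback ν₂ h₂, this]

lemma integrable_one_sub_exp_neg_inner {𝒯 : Measure (E n)} (h0 : ∀ᵐ t ∂𝒯, ∀ k, 0 ≤ t k)
    (hint : Integrable (fun t : E n => min 1 ‖t‖) 𝒯) {l : E n} (hl : ∀ k, 0 ≤ l k) {z : ℂ}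
    (hz : 0 ≤ z.re) : Integrable (fun t : E n => 1 - cexp (-(z * (⟪l, t⟫ : ℝ)))) 𝒯 := by
  have hm : Measurable fun x : E n => (⟪l, x⟫ : ℝ) := by fun_prop
  have hτ : ∀ᵐ x ∂(𝒯.map fun x => (⟪l, x⟫ : ℝ)), 0 ≤ x := by
    rw [ae_map_iff hm.aemeasurable measurableSet_Ici]
    filter_upwards [h0] with x hx using inner_nonneg_of_nonneg hl hx
  have h1 := integrable_one_sub_exp_neg_mul hτ (integrable_min_one_inner h0 hint hl) hz
  rwa [integrable_map_measure (Measurable.aestronglyMeasurable (by fun_prop)) (by fun_prop)] at h1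

lemma integrable_one_sub_real_exp_neg_inner {𝒯 : Measure (E n)} (h0 : ∀ᵐ t ∂𝒯, ∀ k, 0 ≤ t k)
    (hint : Integrable (fun t : E n => min 1 ‖t‖) 𝒯) {l : E n} (hl : ∀ k, 0 ≤ l k) :
    Integrable (fun t : E n => 1 - Real.exp (-⟪l, t⟫)) 𝒯 := by
  have h1 := (integrable_one_sub_exp_neg_inner h0 hint hl (z := 1) (by simp)).re
  refine h1.congr (ae_of_all _ fun t => ?_)
  have : 1 - cexp (-(1 * ((⟪l, t⟫ : ℝ) : ℂ))) = ((1 - Real.exp (-⟪l, t⟫) : ℝ) : ℂ) := by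
    push_cast
    rw [one_mul]
  simp only [this, RCLike.re_to_complex, ofReal_re]

/-- Lévy measures of finite variation on the orthant with the same Laplace exponent are equal: their
densities with respect to `1 - exp (-⟪1, t⟫)` are finite measures with equal Laplace transforms. -/
theorem levyMeasure_ext_of_laplaceExponent {τ₁ τ₂ : Measure (E n)}
    (h₁ : ∀ᵐ t ∂τ₁, t ∈ orthant n) (h₂ : ∀ᵐ t ∂τ₂, t ∈ orthant n)
    (hint₁ : Integrable (fun t : E n => min 1 ‖t‖) τ₁)
    (hint₂ : Integrable (fun t : E n => min 1 ‖t‖) τ₂)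
    (h : ∀ l : E n, (∀ k, 0 ≤ l k) →
      ∫ t, (1 - Real.exp (-⟪l, t⟫)) ∂τ₁ = ∫ t, (1 - Real.exp (-⟪l, t⟫)) ∂τ₂) : τ₁ = τ₂ := by
  let e : E n := toLp 2 fun _ => 1
  have he : ∀ k, 0 ≤ e k := fun k => by simp [e]
  let g : E n → ℝ≥0∞ := fun t => ENNReal.ofReal (1 - Real.exp (-⟪e, t⟫))
  have hg : Measurable g := by fun_prop
  have hepos : ∀ t ∈ orthant n, 0 < (⟪e, t⟫ : ℝ) := by
    intro t ht
    refine lt_of_le_of_ne (inner_nonneg_of_nonneg he ht.1) fun h0 => ht.2 ?_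
    rw [PiLp.inner_apply] at h0
    have h3 : ∀ k ∈ Finset.univ, (0 : ℝ) ≤ ⟪e k, t k⟫ := fun k _ => by simpa [e] using ht.1 k
    ext k
    have h4 := (Finset.sum_eq_zero_iff_of_nonneg h3).1 h0.symm k (Finset.mem_univ k)
    simpa [e] using h4
  have hpos : ∀ t ∈ orthant n, 0 < 1 - Real.exp (-⟪e, t⟫) := by
    intro t ht
    have : Real.exp (-⟪e, t⟫) < 1 := by
      rw [← Real.exp_zero]
      exact Real.exp_lt_exp.2 (by linarith [hepos t ht])
    linarith
  have hnn : ∀ τ : Measure (E n), (∀ᵐ t ∂τ, t ∈ orthant n) → ∀ᵐ t ∂τ, ∀ k, 0 ≤ t k :=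
    fun τ hτ => hτ.mono fun t ht => ht.1
  have hfin : ∀ τ : Measure (E n), (∀ᵐ t ∂τ, t ∈ orthant n) →
      Integrable (fun t : E n => min 1 ‖t‖) τ → IsFiniteMeasure (τ.withDensity g) := by
    intro τ hτ hint
    refine isFiniteMeasure_withDensity ?_
    have h3 := integrable_one_sub_real_exp_neg_inner (hnn τ hτ) hint he
    have h4 := h3.2
    rw [hasFiniteIntegral_iff_ofReal (hτ.mono fun t ht => (hpos t ht).le)] at h4
    exact h4.ne
  -- `exp (-⟪l, t⟫) (1 - exp (-⟪e, t⟫))` is the difference of the integrands at `l + e` and `l`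
  have hlap : ∀ τ : Measure (E n), (∀ᵐ t ∂τ, t ∈ orthant n) →
      Integrable (fun t : E n => min 1 ‖t‖) τ → ∀ l : E n, (∀ k, 0 ≤ l k) →
      ∫ t, Real.exp (-⟪l, t⟫) ∂(τ.withDensity g) =
        ∫ t, (1 - Real.exp (-⟪l + e, t⟫)) ∂τ - ∫ t, (1 - Real.exp (-⟪l, t⟫)) ∂τ := by
    intro τ hτ hint l hl
    have hle : ∀ k, 0 ≤ (l + e) k := fun k => by
      simpa using add_nonneg (hl k) (he k)
    rw [integral_withDensity_eq_integral_toReal_smul hg (ae_of_all _ fun _ =>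
      ENNReal.ofReal_lt_top), ← integral_sub
      (integrable_one_sub_real_exp_neg_inner (hnn τ hτ) hint hle)
      (integrable_one_sub_real_exp_neg_inner (hnn τ hτ) hint hl)]
    refine integral_congr_ae ?_
    filter_upwards [hτ] with t ht
    rw [ENNReal.toReal_ofReal (hpos t ht).le, inner_add_left, neg_add, Real.exp_add, smul_eq_mul]
    ring
  have hinv : ∀ τ : Measure (E n), (∀ᵐ t ∂τ, t ∈ orthant n) →
      (τ.withDensity g).withDensity g⁻¹ = τ := by
    intro τ hτ
    refine withDensity_inv_same hg ?_ (ae_of_all _ fun _ => ENNReal.ofReal_ne_top)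
    filter_upwards [hτ] with t ht
    exact (ENNReal.ofReal_pos.2 (hpos t ht)).ne'
  have := hfin τ₁ h₁ hint₁
  have := hfin τ₂ h₂ hint₂
  have hac : ∀ τ : Measure (E n), (∀ᵐ t ∂τ, t ∈ orthant n) →
      ∀ᵐ t ∂(τ.withDensity g), ∀ k, 0 ≤ t k := fun τ hτ =>
    (withDensity_absolutelyContinuous _ _).ae_le (hnn τ hτ)
  have key : τ₁.withDensity g = τ₂.withDensity g := by
    refine ext_of_laplace (hac τ₁ h₁) (hac τ₂ h₂) fun l hl => ?_
    have hle : ∀ k, 0 ≤ (l + e) k := fun k => by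
      simpa using add_nonneg (hl k) (he k)
    rw [hlap τ₁ h₁ hint₁ l hl, hlap τ₂ h₂ hint₂ l hl, h l hl, h (l + e) hle]
  rw [← hinv τ₁ h₁, ← hinv τ₂ h₂, key]

/-! ### Brownian motion at a multivariate time -/

section BrownianMotion

variable {Ω : Type*} [MeasurableSpace Ω] {Q : Measure Ω} [IsProbabilityMeasure Q]
  {B : ℝ≥0 → Ω → E n} {μ : E n} {S : Matrix (Fin n) (Fin n) ℝ}

lemma levyKhintchine_zero_measure (μ : E n) (S : Matrix (Fin n) (Fin n) ℝ) (θ : E n) :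
    levyKhintchine μ S 0 θ = I * (⟪μ, θ⟫ : ℝ) - (halfQuad S θ : ℝ) := by
  simp [levyKhintchine, halfQuad]

lemma IsBM.map_eq (hB : IsBM Q B μ S) (t : ℝ≥0) :
    Q.map (B t) = multivariateGaussian ((t : ℝ) • μ) ((t : ℝ) • S) := by
  have hm := hB.isLevyProcess.measurable t
  have := Measure.isProbabilityMeasure_map (μ := Q) hm.aemeasurable
  have hS : ((t : ℝ) • S).PosSemidef := hB.posSemidef.smul t.2
  refine Measure.ext_of_charFun (funext fun θ => ?_)
  rw [hB.hasExponent t θ, charFun_multivariateGaussian' _ hS, levyKhintchine_zero_measure,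
    halfQuad_matrix_smul, real_inner_smul_left]
  congr 1
  push_cast
  ring

lemma IsBM.hasGaussianLaw (hB : IsBM Q B μ S) (t : ℝ≥0) : HasGaussianLaw (B t) Q where
  isGaussian_map := by
    rw [hB.map_eq t]
    infer_instance

lemma IsBM.memLp_two (hB : IsBM Q B μ S) (t : ℝ≥0) (k : Fin n) :
    MemLp (fun ω => B t ω k) 2 Q := by
  have h1 := (hB.hasGaussianLaw t).memLp_two
  exact h1.continuousLinearMap_comp (EuclideanSpace.proj k : E n →L[ℝ] ℝ)

lemma IsBM.integral_eval (hB : IsBM Q B μ S) (t : ℝ≥0) (k : Fin n) :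
    ∫ ω, B t ω k ∂Q = t * μ k := by
  have h1 : ∫ ω, B t ω ∂Q = (t : ℝ) • μ := by
    have h2 := integral_map (μ := Q) (hB.isLevyProcess.measurable t).aemeasurable
      (f := fun x : E n => x) (Measurable.aestronglyMeasurable (by fun_prop))
    rw [← h2, hB.map_eq t, integral_id_multivariateGaussian]
  have h3 := (EuclideanSpace.proj k : E n →L[ℝ] ℝ).integral_comp_comm
    (hB.hasGaussianLaw t).integrable
  rw [h1] at h3
  simpa using h3

lemma IsBM.covariance_eval_self (hB : IsBM Q B μ S) (t : ℝ≥0) (k l : Fin n) :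
    cov[fun ω => B t ω k, fun ω => B t ω l; Q] = t * S k l := by
  have h1 := covariance_map (μ := Q) (Z := B t) (X := fun x : E n => x k) (Y := fun x : E n => x l)
    (Measurable.aestronglyMeasurable (by fun_prop)) (Measurable.aestronglyMeasurable (by fun_prop))
    (hB.isLevyProcess.measurable t).aemeasurable
  have hS : ((t : ℝ) • S).PosSemidef := hB.posSemidef.smul t.2
  rw [hB.map_eq t, covariance_eval_multivariateGaussian hS] at h1
  simpa [Function.comp_def] using h1.symm

/-- The covariance of the earlier value with the independent increment vanishes. -/
lemma IsBM.covariance_eval_of_le (hB : IsBM Q B μ S) {s t : ℝ≥0} (hst : s ≤ t) (k l : Fin n) :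
    cov[fun ω => B s ω k, fun ω => B t ω l; Q] = s * S k l := by
  have hind := hB.isLevyProcess.indep.indepFun_eval_sub (zero_le : 0 ≤ s) hst
    hB.isLevyProcess.zero
  have h1 : IndepFun (fun ω => B s ω k) (fun ω => B t ω l - B s ω l) Q := by
    refine hind.comp (φ := fun x : E n => x k) (ψ := fun x : E n => x l) ?_ ?_ <;> fun_prop
  have h2 := h1.covariance_eq_zero (hB.memLp_two s k)
    ((hB.memLp_two t l).sub (hB.memLp_two s l))
  rw [covariance_fun_sub_right (hB.memLp_two s k) (hB.memLp_two t l) (hB.memLp_two s l),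
    hB.covariance_eval_self] at h2
  linarith

lemma IsBM.covariance_eval (hB : IsBM Q B μ S) (s t : ℝ≥0) (k l : Fin n) :
    cov[fun ω => B s ω k, fun ω => B t ω l; Q] = min (s : ℝ) t * S k l := by
  rcases le_total s t with h | h
  · rw [hB.covariance_eval_of_le h, min_eq_left (by exact_mod_cast h)]
  · rw [covariance_comm, hB.covariance_eval_of_le h, min_eq_right (by exact_mod_cast h)]
    congr 1
    simpa using hB.posSemidef.isHermitian.apply k l

lemma measurable_evalAt (hB : ∀ t, Measurable (B t)) (t : E n) : Measurable (evalAt B t) := by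
  unfold evalAt
  have := fun k => hB (t k).toNNReal
  fun_prop

/-- The vector `B(t)` is a linear image of finitely many values of the Gaussian process `B`. -/
lemma IsBM.hasGaussianLaw_evalAt (hB : IsBM Q B μ S) (t : E n) :
    HasGaussianLaw (evalAt B t) Q := by
  have hGP : IsGaussianProcess B Q := hB.isLevyProcess.indep.isGaussianProcess hB.hasGaussianLaw
    hB.isLevyProcess.zero
  have hev : IsGaussianProcess (fun t : E n => evalAt B t) Q := by
    classical
    refine hGP.of_isGaussianProcess fun t => ⟨Finset.univ.image fun k => (t k).toNNReal, ?_⟩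
    let L : ((Finset.univ.image fun k => (t k).toNNReal : Finset ℝ≥0) → E n) →ₗ[ℝ] E n :=
      { toFun x := toLp 2 fun k => x ⟨(t k).toNNReal, by simp⟩ k
        map_add' x y := by ext; simp
        map_smul' c x := by ext; simp }
    exact ⟨L.toContinuousLinearMap, fun ω => by simp [L, evalAt]⟩
  exact hev.hasGaussianLaw_eval t

/-- The vector `B(t)` is Gaussian with mean `t ⋄ μ` and covariance matrix `t ⋄ S`. -/
lemma IsBM.charFun_evalAt (hB : IsBM Q B μ S) {t : E n} (ht : ∀ k, 0 ≤ t k) (θ : E n) :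
    charFun (Q.map (evalAt B t)) θ = cexp (timeExponent μ S θ t) := by
  rw [(hB.hasGaussianLaw_evalAt t).charFun_map_eq θ]
  have h1 : ∀ ω, (⟪θ, evalAt B t ω⟫ : ℝ) = ∑ k, θ k * B (t k).toNNReal ω k := by
    intro ω
    simp [PiLp.inner_apply, evalAt, mul_comm]
  have hL : ∀ k, MemLp (fun ω => θ k * B (t k).toNNReal ω k) 2 Q := fun k =>
    (hB.memLp_two _ k).const_mul _
  have h2 : ∫ ω, (⟪θ, evalAt B t ω⟫ : ℝ) ∂Q = ⟪diamondVec t μ, θ⟫ := by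
    simp only [h1]
    rw [integral_finsetSum _ fun k _ => (hL k).integrable (by norm_num)]
    simp only [integral_const_mul, hB.integral_eval, Real.coe_toNNReal _ (ht _), PiLp.inner_apply,
      diamondVec]
    simp
  have h3 : Var[fun ω => (⟪θ, evalAt B t ω⟫ : ℝ); Q] = 2 * halfQuad (diamondMat t S) θ := by
    simp only [h1]
    rw [variance_fun_sum hL]
    simp only [covariance_const_mul_left, covariance_const_mul_right, hB.covariance_eval,
      Real.coe_toNNReal _ (ht _), halfQuad, dotProduct, Matrix.mulVec, diamondMat, Matrix.of_apply,
      Finset.mul_sum]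
    rw [mul_div_cancel₀ _ two_ne_zero]
    refine Finset.sum_congr rfl fun k _ => Finset.sum_congr rfl fun l _ => ?_
    ring
  rw [h2, h3, timeExponent]
  congr 1
  push_cast
  ring

/-- For times in the orthant the matrix `t ⋄ S` is a covariance matrix: its quadratic form is read
off from the modulus of a characteristic function, which is at most one. -/
lemma IsBM.posSemidef_diamondMat (hB : IsBM Q B μ S) {t : E n} (ht : ∀ k, 0 ≤ t k) :
    (diamondMat t S).PosSemidef := by
  refine Matrix.PosSemidef.of_dotProduct_mulVec_nonneg ?_ fun x => ?_
  · ext k l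
    have := hB.posSemidef.isHermitian.apply k l
    simp only [diamondMat, Matrix.conjTranspose_apply, Matrix.of_apply, star_trivial] at this ⊢
    rw [this, min_comm]
  · have h1 := hB.charFun_evalAt ht (toLp 2 x)
    have := Measure.isProbabilityMeasure_map (μ := Q)
      (measurable_evalAt hB.isLevyProcess.measurable t).aemeasurable
    have h2 := norm_charFun_le_one (μ := Q.map (evalAt B t)) (toLp 2 x)
    rw [h1, Complex.norm_exp, Real.exp_le_one_iff, re_timeExponent] at h2
    simp only [halfQuad] at h2
    simpa using show 0 ≤ x ⬝ᵥ diamondMat t S *ᵥ x by linarith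

lemma IsBM.re_timeExponent_nonpos (hB : IsBM Q B μ S) {t : E n} (ht : ∀ k, 0 ≤ t k) (θ : E n) :
    (timeExponent μ S θ t).re ≤ 0 := by
  rw [re_timeExponent]
  linarith [halfQuad_nonneg (hB.posSemidef_diamondMat ht) θ]

end BrownianMotion

/-! ### The exponent of a weakly subordinated Brownian motion -/

/-- A measure with a positive integrable density is s-finite; this makes Fubini's theorem available
for Lévy measures and Thorin measures. -/
lemma sFinite_of_lintegral_lt_top {α : Type*} [MeasurableSpace α] {τ : Measure α} {g : α → ℝ≥0∞}
    (hg : Measurable g) (h0 : ∀ᵐ x ∂τ, g x ≠ 0) (hfin : ∫⁻ x, g x ∂τ < ∞) : SFinite τ := by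
  have := isFiniteMeasure_withDensity hfin.ne
  rw [← withDensity_inv_same hg h0 ((ae_lt_top hg hfin.ne).mono fun _ h => h.ne)]
  infer_instance

lemma sFinite_of_integrable_min_one_norm {τ : Measure (E n)} (h0 : τ {0} = 0)
    (hint : Integrable (fun t : E n => min 1 ‖t‖) τ) : SFinite τ := by
  refine sFinite_of_lintegral_lt_top (g := fun t => ENNReal.ofReal (min 1 ‖t‖)) (by fun_prop) ?_ ?_
  · refine measure_mono_null (fun t ht => ?_) h0
    simpa using ht
  · have h1 := hint.2
    rwa [hasFiniteIntegral_iff_ofReal (ae_of_all _ fun t => by positivity)] at h1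

section Modification

variable {Ω : Type*} [MeasurableSpace Ω] {Q : Measure Ω} {B : ℝ≥0 → Ω → E n}

/-- A process with right-continuous paths is indistinguishable from a jointly measurable one. -/
lemma IsLevyProcess.exists_measurable_modification (hB : IsLevyProcess Q B) :
    ∃ B' : ℝ≥0 → Ω → E n, Measurable (fun p : ℝ≥0 × Ω => B' p.1 p.2) ∧
      ∀ᵐ ω ∂Q, ∀ t, B' t ω = B t ω := by
  classical
  obtain ⟨N, hN, hNm, hN0⟩ := exists_measurable_superset_of_null (ae_iff.1 hB.cadlag)
  obtain ⟨a, φ, hφ, hgt, hlim⟩ := exists_countable_approx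
  -- outside the null set `N` the value at `t` is the limit of the values at countably many times
  refine ⟨fun t ω => Nᶜ.indicator (B t) ω, ?_, ?_⟩
  · refine measurable_of_tendsto_metrizable
      (f := fun k (p : ℝ≥0 × Ω) => Nᶜ.indicator (B (a k (φ k p.1))) p.2) (fun k => ?_) ?_
    · have h1 : Measurable fun p : ℕ × Ω => Nᶜ.indicator (B (a k p.1)) p.2 :=
        measurable_from_prod_countable_right fun j => (hB.measurable (a k j)).indicator hNm.compl
      exact h1.comp (((hφ k).comp measurable_fst).prodMk measurable_snd)
    · refine tendsto_pi_nhds.2 fun p => ?_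
      by_cases hp : p.2 ∈ N
      · simp only [Set.indicator_of_notMem (Set.notMem_compl_iff.2 hp)]
        exact tendsto_const_nhds
      · simp only [Set.indicator_of_mem (Set.mem_compl hp)]
        have hc : ∀ t, ContinuousWithinAt (fun s => B s p.2) (Set.Ioi t) t := by
          by_contra h
          exact hp (hN fun h2 => h fun t => (h2 t).1)
        exact Tendsto.comp (hc p.1) (tendsto_nhdsWithin_iff.2
          ⟨hlim p.1, Eventually.of_forall fun k => hgt k p.1⟩)
  · have : ∀ᵐ ω ∂Q, ω ∉ N := measure_eq_zero_iff_ae_notMem.1 hN0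
    filter_upwards [this] with ω hω t
    rw [Set.indicator_of_mem (Set.mem_compl hω)]

lemma measurable_evalAt_uncurry {B' : ℝ≥0 → Ω → E n}
    (hB' : Measurable (fun p : ℝ≥0 × Ω => B' p.1 p.2)) :
    Measurable (fun p : E n × Ω => evalAt B' p.1 p.2) := by
  have h1 : ∀ k, Measurable fun p : E n × Ω => B' (p.1 k).toNNReal p.2 := fun k =>
    hB'.comp ((Measurable.real_toNNReal (by fun_prop)).prodMk measurable_snd)
  unfold evalAt
  fun_prop

lemma evalAt_congr {Ω : Type*} {B B' : ℝ≥0 → Ω → E n} {ω : Ω} (h : ∀ t, B' t ω = B t ω) (t : E n) :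
    evalAt B' t ω = evalAt B t ω := by
  simp [evalAt, h]

end Modification

/-- The measure `∫ ℙ(B(t) ∈ ·) 𝒯(dt)` off the origin, for a jointly measurable process. -/
def subordLevyMeasure {Ω : Type*} [MeasurableSpace Ω] (Q : Measure Ω) (B' : ℝ≥0 → Ω → E n)
    (𝒯 : Measure (E n)) : Measure (E n) :=
  ((𝒯.prod Q).map fun p => evalAt B' p.1 p.2).restrict {0}ᶜ

section SubordLevyMeasure

variable {Ω : Type*} [MeasurableSpace Ω] {Q : Measure Ω} {B B' : ℝ≥0 → Ω → E n}
  {𝒯 : Measure (E n)}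

lemma subordLevyMeasure_apply [SFinite Q] (hB' : Measurable (fun p : ℝ≥0 × Ω => B' p.1 p.2))
    (h : ∀ᵐ ω ∂Q, ∀ t, B' t ω = B t ω) {A : Set (E n)} (hA : MeasurableSet A) (h0 : 0 ∉ A) :
    subordLevyMeasure Q B' 𝒯 A = ∫⁻ t, Q {ω | evalAt B t ω ∈ A} ∂𝒯 := by
  have hm := measurable_evalAt_uncurry hB'
  rw [subordLevyMeasure, Measure.restrict_apply hA,
    Set.inter_eq_left.2 fun x hx => by rintro rfl; exact h0 hx, Measure.map_apply hm hA,
    Measure.prod_apply (hm hA)]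
  refine lintegral_congr fun t => measure_congr ?_
  filter_upwards [h] with ω hω
  exact congrArg (· ∈ A) (evalAt_congr hω t)

/-- The values on the sets that avoid the origin determine the Lévy measure of `B ⊙ T`. -/
lemma eq_subordLevyMeasure [SFinite Q] (hB' : Measurable (fun p : ℝ≥0 × Ω => B' p.1 p.2))
    (h : ∀ᵐ ω ∂Q, ∀ t, B' t ω = B t ω) {𝒳 : Measure (E n)} (h0 : 𝒳 {0} = 0)
    (h𝒳 : ∀ A, MeasurableSet A → 0 ∉ A → 𝒳 A = ∫⁻ t, Q {ω | evalAt B t ω ∈ A} ∂𝒯) :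
    𝒳 = subordLevyMeasure Q B' 𝒯 := by
  have h1 : 𝒳 = 𝒳.restrict {0}ᶜ := by
    rw [Measure.restrict_eq_self_of_ae_mem]
    exact measure_eq_zero_iff_ae_notMem.1 h0
  ext A hA
  have h2 : MeasurableSet (A ∩ {0}ᶜ) := hA.inter (measurableSet_singleton 0).compl
  rw [h1, Measure.restrict_apply hA, h𝒳 _ h2 (by simp),
    ← subordLevyMeasure_apply hB' h h2 (by simp), subordLevyMeasure, Measure.restrict_apply h2,
    Measure.restrict_apply hA, Set.inter_assoc,
    Set.inter_self]

lemma integrable_evalAt_of_subordLevyMeasure {F : Type*} [NormedAddCommGroup F]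
    (hB' : Measurable (fun p : ℝ≥0 × Ω => B' p.1 p.2)) {f : E n → F}
    (hf0 : f 0 = 0) (hfi : Integrable f (subordLevyMeasure Q B' 𝒯)) :
    Integrable (fun p : E n × Ω => f (evalAt B' p.1 p.2)) (𝒯.prod Q) := by
  have hm := measurable_evalAt_uncurry hB'
  have h1 : Integrable f ((𝒯.prod Q).map fun p => evalAt B' p.1 p.2) :=
    IntegrableOn.integrable_of_forall_notMem_eq_zero hfi fun x hx => by
      have : x = 0 := by simpa using hx
      rw [this, hf0]
  exact h1.comp_measurable hm

lemma integral_subordLevyMeasure [SFinite Q] [SFinite 𝒯] {F : Type*}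
    [NormedAddCommGroup F] [NormedSpace ℝ F]
    (hB' : Measurable (fun p : ℝ≥0 × Ω => B' p.1 p.2)) {f : E n → F}
    (hf0 : f 0 = 0) (hfi : Integrable f (subordLevyMeasure Q B' 𝒯)) :
    ∫ x, f x ∂(subordLevyMeasure Q B' 𝒯) = ∫ t, ∫ ω, f (evalAt B' t ω) ∂Q ∂𝒯 := by
  have hm := measurable_evalAt_uncurry hB'
  have h1 : Integrable f ((𝒯.prod Q).map fun p => evalAt B' p.1 p.2) :=
    IntegrableOn.integrable_of_forall_notMem_eq_zero hfi fun x hx => by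
      have : x = 0 := by simpa using hx
      rw [this, hf0]
  rw [subordLevyMeasure, setIntegral_eq_integral_of_forall_compl_eq_zero fun x hx => by
      have : x = 0 := by simpa using hx
      rw [this, hf0], integral_map hm.aemeasurable h1.aestronglyMeasurable,
    integral_prod _ (integrable_evalAt_of_subordLevyMeasure hB' hf0 hfi)]

end SubordLevyMeasure

/-- The integrand of the Lévy-Khintchine formula. -/
def levyIntegrand (θ x : E n) : ℂ :=
  cexp (I * (⟪θ, x⟫ : ℝ)) - 1 -
    (Metric.closedBall (0 : E n) 1).indicator (fun y => I * (⟪θ, y⟫ : ℝ)) x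

lemma measurable_indicator_closedBall_id :
    Measurable ((Metric.closedBall (0 : E n) 1).indicator id) :=
  measurable_id.indicator Metric.isClosed_closedBall.measurableSet

lemma norm_indicator_closedBall_id_le (x : E n) :
    ‖(Metric.closedBall (0 : E n) 1).indicator id x‖ ≤ 1 := by
  by_cases hx : x ∈ Metric.closedBall (0 : E n) 1
  · rw [Set.indicator_of_mem hx]
    simpa using hx
  · rw [Set.indicator_of_notMem hx, norm_zero]
    exact zero_le_one

lemma measurable_levyIntegrand (θ : E n) : Measurable (levyIntegrand θ) := by
  have h1 := measurable_indicator_closedBall_id (n := n)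
  change Measurable fun x => levyIntegrand θ x
  simp only [levyIntegrand, indicator_closedBall_inner]
  fun_prop

lemma norm_levyIntegrand_le (θ x : E n) :
    ‖levyIntegrand θ x‖ ≤ (2 + 3 * ‖θ‖ ^ 2) * min 1 (‖x‖ ^ 2) := by
  have hθ : |⟪θ, x⟫| ≤ ‖θ‖ * ‖x‖ := abs_real_inner_le_norm θ x
  have hn : ‖I * ((⟪θ, x⟫ : ℝ) : ℂ)‖ = |⟪θ, x⟫| := by simp
  have hexp : ‖cexp (I * ((⟪θ, x⟫ : ℝ) : ℂ))‖ = 1 := by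
    rw [mul_comm, Complex.norm_exp_ofReal_mul_I]
  have h2 : ‖cexp (I * ((⟪θ, x⟫ : ℝ) : ℂ)) - 1‖ ≤ 2 :=
    (norm_sub_le _ _).trans (by rw [hexp, norm_one]; norm_num)
  rw [levyIntegrand]
  by_cases hx : ‖x‖ ≤ 1
  · rw [Set.indicator_of_mem (by simpa using hx), min_eq_right (by nlinarith [norm_nonneg x])]
    have h3 : ‖cexp (I * ((⟪θ, x⟫ : ℝ) : ℂ)) - 1 - I * ((⟪θ, x⟫ : ℝ) : ℂ)‖ ≤ 3 * |⟪θ, x⟫| ^ 2 := by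
      rcases le_total |⟪θ, x⟫| 1 with h | h
      · have h4 := Complex.norm_exp_sub_one_sub_id_le (hn.le.trans h)
        rw [hn] at h4
        nlinarith [sq_nonneg |⟪θ, x⟫|]
      · have h4 := norm_sub_le (cexp (I * ((⟪θ, x⟫ : ℝ) : ℂ)) - 1) (I * ((⟪θ, x⟫ : ℝ) : ℂ))
        rw [hn] at h4
        nlinarith
    have h5 : |⟪θ, x⟫| ^ 2 ≤ ‖θ‖ ^ 2 * ‖x‖ ^ 2 := by
      rw [← mul_pow]
      gcongr
    nlinarith [sq_nonneg ‖x‖]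
  · rw [Set.indicator_of_notMem (by simpa using hx), sub_zero,
      min_eq_left (by nlinarith [not_le.1 hx])]
    nlinarith [sq_nonneg ‖θ‖]

lemma levyIntegrand_zero_right (θ : E n) : levyIntegrand θ 0 = 0 := by
  simp [levyIntegrand]

lemma IsLevyMeasure.integrable_levyIntegrand {𝒳 : Measure (E n)} (h : IsLevyMeasure 𝒳) (θ : E n) :
    Integrable (levyIntegrand θ) 𝒳 := by
  exact (h.integrable_min_one_norm_sq.const_mul _).mono'
    (measurable_levyIntegrand θ).aestronglyMeasurable
    (ae_of_all _ (norm_levyIntegrand_le θ))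

section WeakSubordination

variable {Ω : Type*} [MeasurableSpace Ω] {Q : Measure Ω} [IsProbabilityMeasure Q]
  {B : ℝ≥0 → Ω → E n} {μ : E n} {S : Matrix (Fin n) (Fin n) ℝ} {𝒯 : Measure (E n)}

lemma IsBM.integrable_exp_timeExponent_sub_one (hB : IsBM Q B μ S)
    (h0 : ∀ᵐ t ∂𝒯, ∀ k, 0 ≤ t k) (hint : Integrable (fun t : E n => min 1 ‖t‖) 𝒯) (θ : E n) :
    Integrable (fun t => cexp (timeExponent μ S θ t) - 1) 𝒯 := by
  obtain ⟨K, hK, hKle⟩ := exists_norm_timeExponent_le μ S θ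
  have hc := continuous_timeExponent μ S θ
  refine (hint.const_mul (2 * (1 + K))).mono' (Continuous.aestronglyMeasurable (by fun_prop)) ?_
  filter_upwards [h0] with t ht
  have h1 := norm_exp_sub_one_le_min (hB.re_timeExponent_nonpos ht θ)
  have h2 : min 1 ‖timeExponent μ S θ t‖ ≤ min 1 (K * ‖t‖) := min_le_min le_rfl (hKle t)
  have h3 := min_one_mul_le hK (norm_nonneg t)
  linarith

lemma IsBM.integral_levyIntegrand_evalAt (hB : IsBM Q B μ S) {t : E n} (ht : ∀ k, 0 ≤ t k)
    (θ : E n) : ∫ ω, levyIntegrand θ (evalAt B t ω) ∂Q = cexp (timeExponent μ S θ t) - 1 -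
      I * ((⟪θ, ∫ ω, (Metric.closedBall (0 : E n) 1).indicator id (evalAt B t ω) ∂Q⟫ : ℝ) : ℂ) := by
  have hm := measurable_evalAt hB.isLevyProcess.measurable t
  have hmi := measurable_indicator_closedBall_id (n := n)
  have h1 : Integrable (fun ω => (Metric.closedBall (0 : E n) 1).indicator id (evalAt B t ω)) Q :=
    Integrable.of_bound (hmi.comp hm).aestronglyMeasurable 1
      (ae_of_all _ fun ω => norm_indicator_closedBall_id_le _)
  have h2 : Integrable (fun ω => cexp (I * ((⟪θ, evalAt B t ω⟫ : ℝ) : ℂ))) Q := by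
    refine Integrable.of_bound (Measurable.aestronglyMeasurable (by fun_prop)) 1
      (ae_of_all _ fun ω => ?_)
    rw [mul_comm, Complex.norm_exp_ofReal_mul_I]
  have h3 : Integrable (fun ω => I * ((⟪θ, (Metric.closedBall (0 : E n) 1).indicator id
      (evalAt B t ω)⟫ : ℝ) : ℂ)) Q := (h1.const_inner θ).ofReal.const_mul I
  simp only [levyIntegrand, indicator_closedBall_inner]
  have h4 : Integrable (fun ω => cexp (I * ((⟪θ, evalAt B t ω⟫ : ℝ) : ℂ)) - 1) Q :=
    h2.sub (integrable_const _)
  rw [integral_sub h4 h3, integral_sub h2 (integrable_const _), integral_const_mul,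
    integral_complex_ofReal, integral_inner h1, ← hB.charFun_evalAt ht θ, charFun_apply,
    integral_map hm.aemeasurable (Measurable.aestronglyMeasurable (by fun_prop))]
  congr 2
  · congr 1
    ext ω
    rw [real_inner_comm, mul_comm]
  · simp

/-- The exponent of `B ⊙ T` at `θ` is `A(d) + ∫ (exp A(t) - 1) 𝒯(dt)`, where `A(t)` is the exponent
of `B(t)`. -/
theorem IsBM.levyKhintchine_weakSubord (hB : IsBM Q B μ S) (h00 : 𝒯 {0} = 0)
    (h0 : ∀ᵐ t ∂𝒯, ∀ k, 0 ≤ t k) (hint : Integrable (fun t : E n => min 1 ‖t‖) 𝒯)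
    {𝒳 : Measure (E n)} (hL : IsLevyMeasure 𝒳)
    (h𝒳 : ∀ A, MeasurableSet A → 0 ∉ A → 𝒳 A = ∫⁻ t, Q {ω | evalAt B t ω ∈ A} ∂𝒯) (d θ : E n) :
    levyKhintchine (diamondVec d μ +
      ∫ t, (∫ ω, (Metric.closedBall (0 : E n) 1).indicator id (evalAt B t ω) ∂Q) ∂𝒯)
      (diamondMat d S) 𝒳 θ =
      timeExponent μ S θ d + ∫ t, (cexp (timeExponent μ S θ t) - 1) ∂𝒯 := by
  have := sFinite_of_integrable_min_one_norm h00 hint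
  obtain ⟨B', hB', hBB'⟩ := hB.isLevyProcess.exists_measurable_modification
  have h𝒳' := eq_subordLevyMeasure hB' hBB' hL.zero h𝒳
  set b : E n → E n :=
    fun t => ∫ ω, (Metric.closedBall (0 : E n) 1).indicator id (evalAt B t ω) ∂Q with hb
  have hev : ∀ {F : Type} [NormedAddCommGroup F] [NormedSpace ℝ F] (f : E n → F) (t : E n),
      ∫ ω, f (evalAt B' t ω) ∂Q = ∫ ω, f (evalAt B t ω) ∂Q := by
    intro F _ _ f t
    refine integral_congr_ae ?_
    filter_upwards [hBB'] with ω hω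
    rw [evalAt_congr hω]
  have hexp := hB.integrable_exp_timeExponent_sub_one h0 hint
  have hi : ∀ θ, Integrable (fun t => ∫ ω, levyIntegrand θ (evalAt B t ω) ∂Q) 𝒯 := by
    intro θ
    have h1 := hL.integrable_levyIntegrand θ
    rw [h𝒳'] at h1
    have h2 := (integrable_evalAt_of_subordLevyMeasure hB' (levyIntegrand_zero_right θ)
      h1).integral_prod_left
    simpa only [hev] using h2
  have hib : ∀ θ, Integrable (fun t => I * ((⟪θ, b t⟫ : ℝ) : ℂ)) 𝒯 := by
    intro θ
    refine ((hexp θ).sub (hi θ)).congr ?_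
    filter_upwards [h0] with t ht
    simp only [Pi.sub_apply, hB.integral_levyIntegrand_evalAt ht, hb]
    ring
  -- the truncated means `b` are integrable although the truncated means of `‖B(t)‖` need not be,
  -- because `I ⟪θ, b t⟫` is the difference of two integrable functions for every `θ`
  have hib' : Integrable b 𝒯 := by
    refine Integrable.of_eval_piLp fun k => ?_
    have h1 := (hib (EuclideanSpace.single k 1)).im
    refine h1.congr (ae_of_all _ fun t => ?_)
    simp [PiLp.inner_apply]
  have key : ∫ x, levyIntegrand θ x ∂𝒳 = ∫ t, (cexp (timeExponent μ S θ t) - 1) ∂𝒯 -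
      I * ((⟪θ, ∫ t, b t ∂𝒯⟫ : ℝ) : ℂ) := by
    have h1 := hL.integrable_levyIntegrand θ
    rw [h𝒳'] at h1 ⊢
    rw [integral_subordLevyMeasure hB' (levyIntegrand_zero_right θ) h1]
    simp only [hev]
    have h2 : ∫ t, I * ((⟪θ, b t⟫ : ℝ) : ℂ) ∂𝒯 = I * ((⟪θ, ∫ t, b t ∂𝒯⟫ : ℝ) : ℂ) := by
      rw [integral_const_mul, integral_complex_ofReal, integral_inner hib']
    rw [← h2, ← integral_sub (hexp θ) (hib θ)]
    refine integral_congr_ae ?_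
    filter_upwards [h0] with t ht using hB.integral_levyIntegrand_evalAt ht θ
  change I * ((⟪diamondVec d μ + ∫ t, b t ∂𝒯, θ⟫ : ℝ) : ℂ) -
    ((θ ⬝ᵥ diamondMat d S *ᵥ θ : ℝ) : ℂ) / 2 + ∫ x, levyIntegrand θ x ∂𝒳 = _
  rw [key, inner_add_left, real_inner_comm θ (∫ t, b t ∂𝒯), timeExponent, halfQuad]
  push_cast
  ring

lemma IsBM.exists_integral_norm_evalAt_sq_le (hB : IsBM Q B μ S) :
    ∃ K : ℝ, 0 ≤ K ∧ ∀ t : E n, (∀ k, 0 ≤ t k) →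
      Integrable (fun ω => ‖evalAt B t ω‖ ^ 2) Q ∧
      ∫ ω, ‖evalAt B t ω‖ ^ 2 ∂Q ≤ K * (‖t‖ + ‖t‖ ^ 2) := by
  refine ⟨∑ k, (|S k k| + μ k ^ 2), by positivity, fun t ht => ?_⟩
  have h1 : ∀ ω, ‖evalAt B t ω‖ ^ 2 = ∑ k, B (t k).toNNReal ω k ^ 2 := by
    intro ω
    rw [EuclideanSpace.norm_sq_eq]
    simp [evalAt]
  have h2 : ∀ k, Integrable (fun ω => B (t k).toNNReal ω k ^ 2) Q := fun k =>
    (hB.memLp_two _ k).integrable_sq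
  simp only [h1]
  refine ⟨integrable_finsetSum _ fun k _ => h2 k, ?_⟩
  rw [integral_finsetSum _ fun k _ => h2 k, Finset.sum_mul]
  refine Finset.sum_le_sum fun k _ => ?_
  have h3 := variance_eq_sub (hB.memLp_two (t k).toNNReal k)
  rw [← covariance_self (hB.memLp_two (t k).toNNReal k).aemeasurable, hB.covariance_eval_self,
    hB.integral_eval, Real.coe_toNNReal _ (ht k)] at h3
  have h4 : ∫ ω, B (t k).toNNReal ω k ^ 2 ∂Q = t k * S k k + (t k * μ k) ^ 2 := by
    simp only [Pi.pow_apply] at h3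
    linarith
  have h5 : t k ≤ ‖t‖ := (le_abs_self _).trans (PiLp.norm_apply_le t k)
  have h6 : t k * S k k ≤ ‖t‖ * |S k k| := by
    refine (le_abs_self _).trans ?_
    rw [abs_mul, abs_of_nonneg (ht k)]
    gcongr
  have h7 : (t k * μ k) ^ 2 ≤ ‖t‖ ^ 2 * μ k ^ 2 := by
    rw [mul_pow]
    have := ht k
    gcongr
  rw [h4]
  nlinarith [mul_nonneg (sq_nonneg ‖t‖) (abs_nonneg (S k k)),
    mul_nonneg (norm_nonneg t) (sq_nonneg (μ k))]

/-- Subordination by a measure that integrates `1 ∧ ‖t‖` produces a Lévy measure, because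
`𝔼 ‖B(t)‖²` is of the order of `‖t‖` for small `t`. -/
lemma IsBM.isLevyMeasure_subordLevyMeasure (hB : IsBM Q B μ S) [SFinite 𝒯]
    (h0 : ∀ᵐ t ∂𝒯, ∀ k, 0 ≤ t k) (hint : Integrable (fun t : E n => min 1 ‖t‖) 𝒯)
    {B' : ℝ≥0 → Ω → E n} (hB' : Measurable (fun p : ℝ≥0 × Ω => B' p.1 p.2))
    (hBB' : ∀ᵐ ω ∂Q, ∀ t, B' t ω = B t ω) : IsLevyMeasure (subordLevyMeasure Q B' 𝒯) := by
  have hm := measurable_evalAt_uncurry hB'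
  refine ⟨by simp [subordLevyMeasure], ?_⟩
  obtain ⟨K, hK, hKle⟩ := hB.exists_integral_norm_evalAt_sq_le
  calc ∫⁻ x, ENNReal.ofReal (min 1 (‖x‖ ^ 2)) ∂(subordLevyMeasure Q B' 𝒯)
      ≤ ∫⁻ x, ENNReal.ofReal (min 1 (‖x‖ ^ 2)) ∂((𝒯.prod Q).map fun p => evalAt B' p.1 p.2) :=
        lintegral_mono' Measure.restrict_le_self le_rfl
    _ = ∫⁻ t, ∫⁻ ω, ENNReal.ofReal (min 1 (‖evalAt B' t ω‖ ^ 2)) ∂Q ∂𝒯 := by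
        rw [lintegral_map (by fun_prop) hm, lintegral_prod _ (by fun_prop)]
    _ ≤ ∫⁻ t, ENNReal.ofReal ((1 + 2 * K) * min 1 ‖t‖) ∂𝒯 := by
        refine lintegral_mono_ae ?_
        filter_upwards [h0] with t ht
        obtain ⟨h1, h2⟩ := hKle t ht
        have h3 : ∫⁻ ω, ENNReal.ofReal (min 1 (‖evalAt B' t ω‖ ^ 2)) ∂Q =
            ∫⁻ ω, ENNReal.ofReal (min 1 (‖evalAt B t ω‖ ^ 2)) ∂Q := by
          refine lintegral_congr_ae ?_
          filter_upwards [hBB'] with ω hω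
          rw [evalAt_congr hω]
        rw [h3]
        rcases le_total ‖t‖ 1 with h | h
        · calc ∫⁻ ω, ENNReal.ofReal (min 1 (‖evalAt B t ω‖ ^ 2)) ∂Q
              ≤ ∫⁻ ω, ENNReal.ofReal (‖evalAt B t ω‖ ^ 2) ∂Q :=
                lintegral_mono fun ω => ENNReal.ofReal_le_ofReal (min_le_right _ _)
            _ = ENNReal.ofReal (∫ ω, ‖evalAt B t ω‖ ^ 2 ∂Q) :=
                (ofReal_integral_eq_lintegral_ofReal h1 (ae_of_all _ fun ω => by positivity)).symm
            _ ≤ ENNReal.ofReal ((1 + 2 * K) * min 1 ‖t‖) := by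
                refine ENNReal.ofReal_le_ofReal (h2.trans ?_)
                rw [min_eq_right h]
                nlinarith [mul_nonneg hK (norm_nonneg t), norm_nonneg t]
        · calc ∫⁻ ω, ENNReal.ofReal (min 1 (‖evalAt B t ω‖ ^ 2)) ∂Q
              ≤ ∫⁻ _, ENNReal.ofReal 1 ∂Q :=
                lintegral_mono fun ω => ENNReal.ofReal_le_ofReal (min_le_left _ _)
            _ ≤ ENNReal.ofReal ((1 + 2 * K) * min 1 ‖t‖) := by
                rw [lintegral_const, measure_univ, mul_one, min_eq_left h]
                exact ENNReal.ofReal_le_ofReal (by linarith)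
    _ < ∞ := by
        have h1 := (hint.const_mul (1 + 2 * K)).2
        rwa [hasFiniteIntegral_iff_ofReal (ae_of_all _ fun t => by positivity)] at h1

end WeakSubordination

/-! ### The Lévy measure of a Thorin subordinator -/

/-- The Lévy measure of a Thorin subordinator with Thorin measure `U`: the superposition over `U`
of the Lévy measures of gamma subordinators along the rays through `u / ‖u‖²`. -/
def thorinLevyMeasure (U : Measure (E n)) : Measure (E n) :=
  (gammaLevyMeasure.prod U).map fun p : ℝ × E n => (p.1 / ‖p.2‖ ^ 2) • p.2

lemma measurable_thorin_ray : Measurable fun p : ℝ × E n => (p.1 / ‖p.2‖ ^ 2) • p.2 := by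
  fun_prop

lemma measurableSet_orthant : MeasurableSet (orthant n) := by
  have h1 : MeasurableSet {u : E n | ∀ k, 0 ≤ u k} := by
    rw [Set.ofPred_forall]
    exact MeasurableSet.iInter fun k => measurableSet_le measurable_const (by fun_prop)
  exact h1.inter (measurableSet_singleton (0 : E n)).compl

lemma smul_mem_orthant {c : ℝ} (hc : 0 < c) {u : E n} (hu : u ∈ orthant n) :
    c • u ∈ orthant n :=
  ⟨fun k => by simpa using mul_nonneg hc.le (hu.1 k), smul_ne_zero hc.ne' hu.2⟩

lemma IsThorinMeasure.sFinite {U : Measure (E n)} (hU : IsThorinMeasure U) : SFinite U :=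
  sFinite_of_lintegral_lt_top measurable_thorinWeight.ennreal_ofReal
    (hU.ae_mem_orthant.mono fun _ hu => (ENNReal.ofReal_pos.2 (thorinWeight_pos hu.2)).ne')
    hU.lintegral_lt_top

section ThorinLevyMeasure

variable {U : Measure (E n)}

lemma IsThorinMeasure.ae_prod (hU : IsThorinMeasure U) :
    ∀ᵐ p ∂(gammaLevyMeasure.prod U), 0 < p.1 ∧ p.2 ∈ orthant n := by
  have := hU.sFinite
  exact (Measure.quasiMeasurePreserving_fst.ae ae_pos_gammaLevyMeasure).and
    (Measure.quasiMeasurePreserving_snd.ae hU.ae_mem_orthant)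

lemma IsThorinMeasure.ae_mem_orthant_thorinLevyMeasure (hU : IsThorinMeasure U) :
    ∀ᵐ t ∂(thorinLevyMeasure U), t ∈ orthant n := by
  refine (ae_map_iff measurable_thorin_ray.aemeasurable measurableSet_orthant).2 ?_
  filter_upwards [hU.ae_prod] with p hp
  have := norm_pos_iff.2 hp.2.2
  have := hp.1
  exact smul_mem_orthant (by positivity) hp.2

lemma IsThorinMeasure.ae_nonneg_thorinLevyMeasure (hU : IsThorinMeasure U) :
    ∀ᵐ t ∂(thorinLevyMeasure U), ∀ k, 0 ≤ t k :=
  hU.ae_mem_orthant_thorinLevyMeasure.mono fun _ ht => ht.1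

lemma IsThorinMeasure.thorinLevyMeasure_zero (hU : IsThorinMeasure U) :
    thorinLevyMeasure U {0} = 0 := by
  refine measure_mono_null (fun t ht => ?_) hU.ae_mem_orthant_thorinLevyMeasure
  have : t = 0 := by simpa using ht
  simp [this, orthant]

/-- The integral of `1 ∧ ‖t‖` along the ray through `u` is of the order of `log (1 + 1 / ‖u‖)`. -/
lemma IsThorinMeasure.integrable_min_one_norm (hU : IsThorinMeasure U) :
    Integrable (fun t : E n => min 1 ‖t‖) (thorinLevyMeasure U) := by
  have := hU.sFinite
  rw [thorinLevyMeasure, integrable_map_measure (Measurable.aestronglyMeasurable (by fun_prop))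
    measurable_thorin_ray.aemeasurable]
  have hm : AEStronglyMeasurable (fun p : ℝ × E n => min 1 ‖(p.1 / ‖p.2‖ ^ 2) • p.2‖)
      (gammaLevyMeasure.prod U) := Measurable.aestronglyMeasurable (by fun_prop)
  have hnorm : ∀ u ∈ orthant n, ∀ᵐ r ∂gammaLevyMeasure,
      min 1 ‖(r / ‖u‖ ^ 2) • u‖ = min 1 (1 / ‖u‖ * r) := by
    intro u hu
    have hu' : ‖u‖ ≠ 0 := norm_ne_zero_iff.2 hu.2
    filter_upwards [ae_pos_gammaLevyMeasure] with r hr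
    rw [norm_smul, Real.norm_of_nonneg (by positivity)]
    congr 1
    field_simp
  refine (integrable_prod_iff' hm).2 ⟨?_, ?_⟩
  · filter_upwards [hU.ae_mem_orthant] with u hu
    exact (integral_min_one_gammaLevyMeasure_le (x := 1 / ‖u‖) (by positivity)).1.congr
      ((hnorm u hu).mono fun r hr => hr.symm)
  · have hw : Integrable (thorinWeight : E n → ℝ) U := by
      refine ⟨measurable_thorinWeight.aestronglyMeasurable, ?_⟩
      rw [hasFiniteIntegral_iff_ofReal
        (hU.ae_mem_orthant.mono fun u hu => (thorinWeight_pos hu.2).le)]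
      exact hU.lintegral_lt_top
    refine (hw.const_mul 2).mono' hm.norm.prod_swap.integral_prod_right' ?_
    filter_upwards [hU.ae_mem_orthant] with u hu
    have h1 : ∫ r, ‖min 1 ‖(r / ‖u‖ ^ 2) • u‖‖ ∂gammaLevyMeasure =
        ∫ r, min 1 (1 / ‖u‖ * r) ∂gammaLevyMeasure := by
      refine integral_congr_ae ?_
      filter_upwards [hnorm u hu] with r hr
      rw [Real.norm_of_nonneg (by positivity), hr]
    have h2 := (integral_min_one_gammaLevyMeasure_le (x := 1 / ‖u‖) (by positivity)).2
    have h3 := log_one_add_inv_norm_le hu.2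
    rw [Real.norm_of_nonneg (integral_nonneg fun r => norm_nonneg _)]
    exact h1.le.trans (by linarith)

/-- By Frullani's formula, the Lévy measure of a Thorin subordinator integrates `1 - exp A` for an
exponent `A` that is homogeneous along rays to a logarithm. -/
lemma IsThorinMeasure.integral_one_sub_exp (hU : IsThorinMeasure U) {A : E n → ℂ}
    (hA : ∀ c : ℝ, 0 ≤ c → ∀ t, A (c • t) = c * A t) (hre : ∀ t ∈ orthant n, (A t).re ≤ 0)
    (hi : Integrable (fun t => 1 - cexp (A t)) (thorinLevyMeasure U)) :
    ∫ t, (1 - cexp (A t)) ∂(thorinLevyMeasure U) = ∫ u, Complex.log (1 - A u / ‖u‖ ^ 2) ∂U := by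
  have := hU.sFinite
  have hi' : Integrable (fun p : ℝ × E n => 1 - cexp (A ((p.1 / ‖p.2‖ ^ 2) • p.2)))
    (gammaLevyMeasure.prod U) := hi.comp_measurable measurable_thorin_ray
  rw [thorinLevyMeasure, integral_map measurable_thorin_ray.aemeasurable hi.aestronglyMeasurable,
    integral_prod_symm _ hi']
  refine integral_congr_ae ?_
  filter_upwards [hU.ae_mem_orthant] with u hu
  have h1 : 0 ≤ (-(A u / ((‖u‖ ^ 2 : ℝ) : ℂ))).re := by
    rw [neg_re, div_ofReal_re]
    have := div_nonneg (neg_nonneg.2 (hre u hu)) (sq_nonneg ‖u‖)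
    rw [neg_div] at this
    exact this
  have h2 := (frullani_gammaLevyMeasure h1).2
  have h3 : (1 : ℂ) - A u / ‖u‖ ^ 2 = 1 + -(A u / ((‖u‖ ^ 2 : ℝ) : ℂ)) := by
    push_cast
    ring
  rw [h3, ← h2]
  refine integral_congr_ae ?_
  filter_upwards [ae_pos_gammaLevyMeasure] with r hr
  rw [hA _ (by positivity)]
  congr 2
  push_cast
  ring

lemma IsThorinMeasure.integral_one_sub_exp_neg_inner (hU : IsThorinMeasure U) {l : E n}
    (hl : ∀ k, 0 ≤ l k) :
    ∫ t, (1 - Real.exp (-⟪l, t⟫)) ∂(thorinLevyMeasure U) =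
      ∫ u, Real.log ((‖u‖ ^ 2 + ⟪l, u⟫) / ‖u‖ ^ 2) ∂U := by
  have h0 := hU.ae_nonneg_thorinLevyMeasure
  have h1 := integrable_one_sub_real_exp_neg_inner h0 hU.integrable_min_one_norm hl
  have h2 : ∀ t : E n, ((1 - Real.exp (-⟪l, t⟫) : ℝ) : ℂ) = 1 - cexp ((-⟪l, t⟫ : ℝ) : ℂ) :=
    fun t => by push_cast; rfl
  have h3 : Integrable (fun t : E n => ((1 - Real.exp (-⟪l, t⟫) : ℝ) : ℂ))
    (thorinLevyMeasure U) := h1.ofReal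
  simp only [h2] at h3
  have h4 := hU.integral_one_sub_exp (A := fun t => ((-⟪l, t⟫ : ℝ) : ℂ))
    (fun c _ t => by rw [real_inner_smul_right]; push_cast; ring)
    (fun t ht => by simpa using inner_nonneg_of_nonneg hl ht.1) h3
  simp only [← h2] at h4
  rw [integral_complex_ofReal] at h4
  rw [← ofReal_inj, h4, ← integral_complex_ofReal]
  refine integral_congr_ae ?_
  filter_upwards [hU.ae_mem_orthant] with u hu
  have h5 : 0 < ‖u‖ := norm_pos_iff.2 hu.2
  have h6 := inner_nonneg_of_nonneg hl hu.1
  rw [Complex.ofReal_log (by positivity)]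
  congr 1
  have h7 : (‖u‖ : ℂ) ≠ 0 := by exact_mod_cast h5.ne'
  push_cast
  field_simp
  ring

lemma IsThorinMeasure.isLevyMeasure (hU : IsThorinMeasure U) :
    IsLevyMeasure (thorinLevyMeasure U) := by
  refine ⟨hU.thorinLevyMeasure_zero, ?_⟩
  have h1 := hU.integrable_min_one_norm.2
  rw [hasFiniteIntegral_iff_ofReal (ae_of_all _ fun t => by positivity)] at h1
  refine lt_of_le_of_lt (lintegral_mono fun t => ENNReal.ofReal_le_ofReal ?_) h1
  rcases le_total ‖t‖ 1 with h | h
  · rw [min_eq_right h]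
    exact (min_le_right _ _).trans (by nlinarith [norm_nonneg t])
  · rw [min_eq_left h]
    exact min_le_left _ _

lemma IsThorinMeasure.finite_variation (hU : IsThorinMeasure U) :
    ∫⁻ t in Metric.closedBall 0 1, ‖t‖ₑ ∂(thorinLevyMeasure U) < ∞ := by
  have h1 := hU.integrable_min_one_norm.2
  rw [hasFiniteIntegral_iff_ofReal (ae_of_all _ fun t => by positivity)] at h1
  refine lt_of_le_of_lt ?_ h1
  calc ∫⁻ t in Metric.closedBall 0 1, ‖t‖ₑ ∂(thorinLevyMeasure U)
      = ∫⁻ t in Metric.closedBall 0 1, ENNReal.ofReal (min 1 ‖t‖) ∂(thorinLevyMeasure U) := by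
        refine setLIntegral_congr_fun Metric.isClosed_closedBall.measurableSet fun t ht => ?_
        have ht' : ‖t‖ ≤ 1 := by simpa using ht
        simp only [min_eq_right ht', ofReal_norm]
    _ ≤ _ := setLIntegral_le_lintegral _ _

end ThorinLevyMeasure

section ThorinSubordinator

variable {Ω : Type*} [MeasurableSpace Ω] {Q : Measure Ω} [IsProbabilityMeasure Q]
  {T : ℝ≥0 → Ω → E n} {d : E n} {U : Measure (E n)}

/-- The Lévy measure of a Thorin subordinator is determined by its Thorin measure. -/
lemma IsThorinSubordinator.eq_thorinLevyMeasure (hTU : IsThorinSubordinator Q T d U)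
    {𝒯 : Measure (E n)} (hT : IsSubordinator Q T d 𝒯) : 𝒯 = thorinLevyMeasure U := by
  have hU := hTU.isThorinMeasure
  have h0 : ∀ᵐ x ∂𝒯, ∀ k, 0 ≤ x k := by
    refine measure_mono_null (fun x hx => ?_) hT.support
    simpa using hx
  have h00 : ∀ᵐ x ∂𝒯, x ∈ orthant n := by
    filter_upwards [h0, measure_eq_zero_iff_ae_notMem.1 hT.isLevy.isLevyMeasure.zero] with x hx hx0
      using ⟨hx, by simpa using hx0⟩
  have hint := hT.isLevy.isLevyMeasure.integrable_min_one_norm hT.finite_variation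
  refine levyMeasure_ext_of_laplaceExponent h00 hU.ae_mem_orthant_thorinLevyMeasure hint
    hU.integrable_min_one_norm fun l hl => ?_
  have h1 := hT.laplace 1 hl (z := 1) (by simp)
  simp only [one_mul] at h1
  have h4 : ∫ ω, cexp (-((⟪l, T 1 ω⟫ : ℝ) : ℂ)) ∂Q =
      ((∫ ω, Real.exp (-⟪l, T 1 ω⟫) ∂Q : ℝ) : ℂ) := by
    rw [← integral_complex_ofReal]
    push_cast
    rfl
  rw [h4, hTU.laplace 1 l hl] at h1
  have h2 : ∫ x, (1 - cexp (-((⟪l, x⟫ : ℝ) : ℂ))) ∂𝒯 =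
      ((∫ x, (1 - Real.exp (-⟪l, x⟫)) ∂𝒯 : ℝ) : ℂ) := by
    rw [← integral_complex_ofReal]
    push_cast
    rfl
  rw [h2] at h1
  have h3 := Real.exp_injective (show Real.exp _ = Real.exp (-(((1 : ℝ≥0) : ℝ) * (⟪l, d⟫ +
    ∫ x, (1 - Real.exp (-⟪l, x⟫)) ∂𝒯))) by exact_mod_cast h1)
  rw [hU.integral_one_sub_exp_neg_inner hl]
  rw [real_inner_comm] at h3
  simp only [NNReal.coe_one, one_mul, neg_inj, add_right_inj] at h3
  exact h3.symm

/-- The Laplace transform of a Thorin subordinator on a complex half-line of frequencies. -/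
lemma IsThorinSubordinator.laplace_complex (hT : IsThorinSubordinator Q T d U) (t : ℝ≥0) {l : E n}
    (hl : ∀ k, 0 ≤ l k) {z : ℂ} (hz : 0 ≤ z.re) :
    ∫ ω, cexp (-(z * (⟪l, T t ω⟫ : ℝ))) ∂Q = cexp (-(((t : ℝ) : ℂ) * (z * (⟪l, d⟫ : ℝ) +
      ∫ x, (1 - cexp (-(z * (⟪l, x⟫ : ℝ)))) ∂(thorinLevyMeasure U)))) := by
  have hU := hT.isThorinMeasure
  have h0 := hU.ae_nonneg_thorinLevyMeasure
  have hint := hU.integrable_min_one_norm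
  have hTm := hT.isSubordinatorProcess.isLevyProcess.measurable t
  have hm : Measurable fun ω => (⟪l, T t ω⟫ : ℝ) := by fun_prop
  have hm2 : Measurable fun x : E n => (⟪l, x⟫ : ℝ) := by fun_prop
  have := Measure.isProbabilityMeasure_map (μ := Q) hm.aemeasurable
  have hν : ∀ᵐ x ∂(Q.map fun ω => (⟪l, T t ω⟫ : ℝ)), 0 ≤ x := by
    rw [ae_map_iff hm.aemeasurable measurableSet_Ici]
    filter_upwards [hT.isSubordinatorProcess.ae_nonneg] with ω hω
      using inner_nonneg_of_nonneg hl (hω t)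
  have hτ : ∀ᵐ x ∂((thorinLevyMeasure U).map fun x => (⟪l, x⟫ : ℝ)), 0 ≤ x := by
    rw [ae_map_iff hm2.aemeasurable measurableSet_Ici]
    filter_upwards [h0] with x hx using inner_nonneg_of_nonneg hl hx
  have key := laplace_eq_of_laplace_ofReal_eq (t := t) (d := ⟪l, d⟫) hν hτ
    (integrable_min_one_inner h0 hint hl) ?_ hz
  · rwa [integral_map hm.aemeasurable (Measurable.aestronglyMeasurable (by fun_prop)),
      integral_map hm2.aemeasurable (Measurable.aestronglyMeasurable (by fun_prop))] at key
  · intro y hy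
    rw [integral_map hm.aemeasurable (Measurable.aestronglyMeasurable (by fun_prop)),
      integral_map hm2.aemeasurable (Measurable.aestronglyMeasurable (by fun_prop))]
    have hyl : ∀ k, 0 ≤ (y • l) k := fun k => by simpa using mul_nonneg hy.le (hl k)
    have h1 := hT.laplace t (y • l) hyl
    rw [← hU.integral_one_sub_exp_neg_inner hyl] at h1
    have h2 : ∀ x : E n, -((y : ℂ) * ((⟪l, x⟫ : ℝ) : ℂ)) = ((-⟪y • l, x⟫ : ℝ) : ℂ) := by
      intro x
      rw [real_inner_smul_left]
      push_cast
      ring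
    have h3 : ∫ x, (1 - cexp ((-⟪y • l, x⟫ : ℝ) : ℂ)) ∂(thorinLevyMeasure U) =
        ((∫ x, (1 - Real.exp (-⟪y • l, x⟫)) ∂(thorinLevyMeasure U) : ℝ) : ℂ) := by
      rw [← integral_complex_ofReal]
      push_cast
      rfl
    have h4 : ∫ ω, cexp ((-⟪y • l, T t ω⟫ : ℝ) : ℂ) ∂Q =
        ((∫ ω, Real.exp (-⟪y • l, T t ω⟫) ∂Q : ℝ) : ℂ) := by
      rw [← integral_complex_ofReal]
      push_cast
      rfl
    simp only [h2]
    rw [h3, h4, h1, real_inner_smul_right, real_inner_comm]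
    push_cast
    congr 1
    ring

end ThorinSubordinator

/-- The integral over the Lévy measure of the Thorin subordinator, in terms of the Thorin
measure. -/
lemma IsBM.integral_exp_timeExponent_thorinLevyMeasure {Ω : Type*} [MeasurableSpace Ω]
    {Q : Measure Ω} [IsProbabilityMeasure Q] {B : ℝ≥0 → Ω → E n} {μ : E n}
    {S : Matrix (Fin n) (Fin n) ℝ} (hB : IsBM Q B μ S) {U : Measure (E n)}
    (hU : IsThorinMeasure U) (θ : E n) :
    ∫ t, (cexp (timeExponent μ S θ t) - 1) ∂(thorinLevyMeasure U) =
      ∫ u, thorinExponent μ S θ u ∂U := by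
  have h1 := hB.integrable_exp_timeExponent_sub_one hU.ae_nonneg_thorinLevyMeasure
    hU.integrable_min_one_norm θ
  have h2 : Integrable (fun t => 1 - cexp (timeExponent μ S θ t)) (thorinLevyMeasure U) := by
    refine h1.neg.congr (ae_of_all _ fun t => ?_)
    simp
  have h3 := hU.integral_one_sub_exp (fun c hc t => timeExponent_smul μ S θ hc t)
    (fun t ht => hB.re_timeExponent_nonpos ht.1 θ) h2
  simp only [thorinExponent, integral_neg]
  rw [← h3, ← integral_neg]
  simp

/-- The exponent of a weak variance generalised gamma convolution, together with the properties of
its parameters. -/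
theorem IsWVGGWith.isLevyProcess_and_hasExponent {Ω : Type*} [MeasurableSpace Ω] {P : Measure Ω}
    {X : ℝ≥0 → Ω → E n} {d μ : E n} {S : Matrix (Fin n) (Fin n) ℝ} {U : Measure (E n)}
    (h : IsWVGGWith P X d μ S U) :
    IsLevyProcess P X ∧ (∀ k, 0 ≤ d k) ∧ IsThorinMeasure U ∧
      (∀ t : E n, (∀ k, 0 ≤ t k) → (diamondMat t S).PosSemidef) ∧
      HasExponent P X fun θ => timeExponent μ S θ d + ∫ u, thorinExponent μ S θ u ∂U := by
  obtain ⟨Ω', _, Q, hQ, B, T, hB, hTU, -, 𝒯, 𝒳, hT, h𝒳, hX⟩ := h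
  have hU := hTU.isThorinMeasure
  refine ⟨hX.isLevyProcess, hTU.drift_nonneg, hU, fun t => hB.posSemidef_diamondMat, ?_⟩
  have h𝒯 := hTU.eq_thorinLevyMeasure hT
  subst h𝒯
  intro t θ
  rw [hX.hasExponent t θ, hB.levyKhintchine_weakSubord hU.thorinLevyMeasure_zero
    hU.ae_nonneg_thorinLevyMeasure hU.integrable_min_one_norm hX.isLevyMeasure h𝒳,
    hB.integral_exp_timeExponent_thorinLevyMeasure hU]

/-! ### Driftless weak variance generalised gamma convolutions -/

/-- The Gaussian component is absorbed into the generalised variance gamma convolution, which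
contains the centred Gaussian distributions as limits. -/
theorem IsWVGGZero.isBMAddGVGCZero {Ω : Type*} [MeasurableSpace Ω] {P : Measure Ω}
    [IsProbabilityMeasure P] {X : ℝ≥0 → Ω → E n} (hn : 0 < n) (h : IsWVGGZero P X) :
    IsBMAddGVGCZero P X := by
  obtain ⟨d, S, U, h⟩ := h
  obtain ⟨hX, hd, hU, hS, hΨ⟩ := h.isLevyProcess_and_hasExponent
  have := Measure.isProbabilityMeasure_map (μ := P) (hX.measurable 1).aemeasurable
  have h0 : diamondVec d (0 : E n) = 0 := by ext k; simp [diamondVec]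
  refine ⟨hX, 0, 0, ⟨P.map (X 1), this⟩, PosSemidef.zero, ?_, ?_⟩
  · refine ConvLimitClosure.of_thorinExponent hn hS hU
      (fun u hu c hc => exists_vgZero_charFun_eq_thorinExponent hS hu hc)
      (convLimitClosure_multivariateGaussian_zero (hS d hd)) fun θ => ?_
    simp only [ProbabilityMeasure.coe_mk]
    rw [hΨ 1 θ, NNReal.coe_one, ofReal_one, one_mul, Complex.exp_add,
      ← charFun_multivariateGaussian_diamond 0 (hS d hd) θ, h0]
  · change P.map (X 1) = (multivariateGaussian 0 0).conv (P.map (X 1))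
    refine Measure.ext_of_charFun (funext fun θ => ?_)
    rw [charFun_conv, charFun_multivariateGaussian' _ PosSemidef.zero]
    simp [halfQuad]

/-! ### The univariate classes -/

/-- The unit vector of the real line. -/
def oneVec : E 1 := toLp 2 fun _ => 1

lemma inner_oneVec (x : E 1) : (⟪oneVec, x⟫ : ℝ) = x 0 := by
  simp [oneVec, PiLp.inner_apply]

lemma inner_eq_mul (x y : E 1) : (⟪x, y⟫ : ℝ) = x 0 * y 0 := by
  simp [PiLp.inner_apply, mul_comm]

lemma norm_eq_of_mem_orthant {u : E 1} (hu : u ∈ orthant 1) : ‖u‖ = u 0 ∧ 0 < u 0 := by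
  have h1 : ‖u‖ = u 0 := by
    rw [EuclideanSpace.norm_eq]
    simp [hu.1 0]
  exact ⟨h1, h1 ▸ norm_pos_iff.2 hu.2⟩

lemma timeExponent_one (μ : E 1) (S : Matrix (Fin 1) (Fin 1) ℝ) (θ t : E 1) :
    timeExponent μ S θ t = t 0 * levyKhintchine μ S 0 θ := by
  rw [levyKhintchine_zero_measure, timeExponent]
  simp only [inner_eq_mul, diamondVec, halfQuad, diamondMat, dotProduct, Matrix.mulVec,
    Finset.univ_unique, Finset.sum_singleton, Matrix.of_apply, Fin.default_eq_zero, min_self]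
  push_cast
  ring

/-- In dimension one the points of the support contribute self-decomposable distributions:
`1 - (iαθ - βθ²)` factors into two linear terms, so that they are differences of gamma
variables. -/
theorem IsWVGG.isSD {Ω : Type*} [MeasurableSpace Ω] {P : Measure Ω} [IsProbabilityMeasure P]
    {X : ℝ≥0 → Ω → E 1} (h : IsWVGG P X) : IsSD P X := by
  obtain ⟨d, μ, S, U, h⟩ := h
  obtain ⟨hX, hd, hU, hS, hΨ⟩ := h.isLevyProcess_and_hasExponent
  have hP := Measure.isProbabilityMeasure_map (μ := P) (hX.measurable 1).aemeasurable
  refine ⟨hX, ?_⟩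
  let 𝒮 : Set (ProbabilityMeasure (E 1)) := {ρ | IsSelfDecomposable (ρ : Measure (E 1))}
  have key : ConvLimitClosure 𝒮 ⟨P.map (X 1), hP⟩ := by
    refine ConvLimitClosure.of_thorinExponent (μ := μ) one_pos hS hU (fun u hu c hc => ?_)
      (ρ₀ := ⟨multivariateGaussian (diamondVec d μ) (diamondMat d S), inferInstance⟩)
      (.base _ (isSelfDecomposable_multivariateGaussian _ (hS d hd))) fun θ => ?_
    · obtain ⟨hun, hu0⟩ := norm_eq_of_mem_orthant hu
      have hS0 : 0 ≤ S 0 0 := by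
        have h1 := halfQuad_nonneg (hS oneVec fun k => by simp [oneVec]) oneVec
        simp only [halfQuad, diamondMat, oneVec, dotProduct, Matrix.mulVec, Finset.univ_unique,
          Finset.sum_singleton, Matrix.of_apply, Fin.default_eq_zero, min_self] at h1
        linarith
      obtain ⟨ρ, hρ, hρc⟩ := exists_isSelfDecomposable_charFun_eq oneVec (μ 0 / u 0) hc
        (q := S 0 0 / (2 * u 0)) (by positivity)
      refine ⟨ρ, .base _ hρ, fun θ => ?_⟩
      rw [hρc, thorinExponent, timeExponent_one, levyKhintchine_zero_measure, hun, inner_oneVec,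
        inner_eq_mul, mul_neg]
      have hu0' : ((u 0 : ℝ) : ℂ) ≠ 0 := by exact_mod_cast hu0.ne'
      congr 5
      simp only [halfQuad, dotProduct, Matrix.mulVec, Finset.univ_unique, Finset.sum_singleton,
        Fin.default_eq_zero]
      push_cast
      field_simp
    · simp only [ProbabilityMeasure.coe_mk]
      rw [hΨ 1 θ, NNReal.coe_one, ofReal_one, one_mul, Complex.exp_add,
        ← charFun_multivariateGaussian_diamond μ (hS d hd) θ]
  exact key.isSelfDecomposable fun ρ hρ => hρ

/-- A gamma subordinator is the Thorin subordinator of a point mass. -/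
lemma IsGammaSubordinator.isThorinSubordinator {Ω : Type*} [MeasurableSpace Ω] {Q : Measure Ω}
    [IsProbabilityMeasure Q] {G : ℝ≥0 → Ω → E 1} {b : ℝ} (hb : 0 < b)
    (hG : IsGammaSubordinator Q G b b) :
    IsThorinSubordinator Q G 0 (ENNReal.ofReal b • Measure.dirac (b • oneVec)) := by
  have hbv : ∀ k, (b • oneVec) k = b := fun k => by simp [oneVec]
  have hmem : b • oneVec ∈ orthant 1 :=
    ⟨fun k => (hbv k).symm ▸ hb.le, fun h => hb.ne' (by simpa [h] using (hbv 0).symm)⟩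
  obtain ⟨hnorm, -⟩ := norm_eq_of_mem_orthant hmem
  rw [hbv] at hnorm
  refine ⟨hG.isSubordinatorProcess, fun k => by simp, ⟨?_, ?_⟩, fun t l hl => ?_⟩
  · have hm : MeasurableSet {u : E 1 | (∃ k, u k < 0) ∨ u = 0} := by
      have : {u : E 1 | (∃ k, u k < 0) ∨ u = 0} = (orthant 1)ᶜ := by
        ext u
        simp only [orthant, Set.mem_ofPred_eq, Set.mem_compl_iff, not_and_or, not_forall, not_le,
          not_not, ne_eq]
      rw [this]
      exact measurableSet_orthant.compl
    rw [Measure.smul_apply, Measure.dirac_apply' _ hm, Set.indicator_of_notMem, smul_zero]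
    rintro (⟨k, hk⟩ | h0)
    · exact absurd (hmem.1 k) (not_le.2 hk)
    · exact hmem.2 h0
  · rw [lintegral_smul_measure, lintegral_dirac' _ (by fun_prop)]
    exact ENNReal.mul_lt_top ENNReal.ofReal_lt_top ENNReal.ofReal_lt_top
  · have hl0 := hl 0
    have hgm := hG.isSubordinatorProcess.isLevyProcess.measurable t
    rw [integral_smul_measure, integral_dirac' _ _ (Measurable.stronglyMeasurable (by fun_prop)),
      ENNReal.toReal_ofReal hb.le, smul_eq_mul, hnorm, real_inner_smul_right, inner_zero_left,
      real_inner_comm, inner_oneVec, mul_zero, zero_add]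
    have h1 : (b ^ 2 + b * l 0) / b ^ 2 = 1 + l 0 / b := by field_simp
    rw [h1]
    rcases eq_or_ne t 0 with rfl | ht
    · have h2 : ∫ ω, Real.exp (-⟪l, G 0 ω⟫) ∂Q = ∫ _, (1 : ℝ) ∂Q := by
        refine integral_congr_ae ?_
        filter_upwards [hG.isSubordinatorProcess.isLevyProcess.zero] with ω hω
        simp [hω]
      rw [h2]
      simp
    · have ht' : 0 < t := pos_iff_ne_zero.2 ht
      have h2 := laplace_gammaMeasure (a := b * t) (r := b) (mul_pos hb (by exact_mod_cast ht'))
        hb (z := (l 0 : ℝ)) (by simpa using hl0)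
      rw [← hG.law t ht', integral_map (by fun_prop)
        (Measurable.aestronglyMeasurable (by fun_prop))] at h2
      have h3 : ∫ ω, cexp (-(((l 0 : ℝ) : ℂ) * ((G t ω 0 : ℝ) : ℂ))) ∂Q =
          ((∫ ω, Real.exp (-⟪l, G t ω⟫) ∂Q : ℝ) : ℂ) := by
        rw [← integral_complex_ofReal]
        simp only [inner_eq_mul]
        push_cast
        rfl
      have h4 : Complex.log (1 + (l 0 : ℝ) / (b : ℂ)) = ((Real.log (1 + l 0 / b) : ℝ) : ℂ) := by
        rw [Complex.ofReal_log (by positivity)]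
        push_cast
        rfl
      rw [h3, h4] at h2
      have h5 : ∫ ω, Real.exp (-⟪l, G t ω⟫) ∂Q =
        Real.exp (-(b * t * Real.log (1 + l 0 / b))) := by exact_mod_cast h2
      rw [h5]
      congr 1
      ring

/-- The processes of the definition serve as they are; only the parameters are translated. -/
theorem IsVG.isVGGOne {Ω : Type*} [MeasurableSpace Ω] {P : Measure Ω} {X : ℝ≥0 → Ω → E n}
    (h : IsVG P X) : IsVGGOne P X := by
  obtain ⟨b, μ, S, hb, hX, Ω', _, Q, hQ, B, G, hB, hG, hind, hXY⟩ := h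
  exact ⟨0, μ, S, _, hX, Ω', _, Q, hQ, B, G, hB, hG.isThorinSubordinator hb, hind, hXY⟩

lemma IsLevyProcess.aemeasurable_strongSubord {Ω : Type*} [MeasurableSpace Ω]
    {Q : Measure Ω} {B : ℝ≥0 → Ω → E n} (hB : IsLevyProcess Q B)
    {τ : ℝ≥0 → Ω → E n} {t : ℝ≥0} (hτ : Measurable (τ t)) :
    AEMeasurable (strongSubord B τ t) Q := by
  obtain ⟨B', hB', hBB'⟩ := hB.exists_measurable_modification
  refine ⟨fun ω => evalAt B' (τ t ω) ω,
    (measurable_evalAt_uncurry hB').comp (hτ.prodMk measurable_id), ?_⟩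
  filter_upwards [hBB'] with ω hω
  exact (evalAt_congr hω _).symm

section OneDim

variable {Ω : Type*} [MeasurableSpace Ω] {Q : Measure Ω} [IsProbabilityMeasure Q]
  {T : ℝ≥0 → Ω → E 1} {d : E 1} {U : Measure (E 1)}

/-- A univariate Thorin subordinator has the Lévy measure that is built from its Thorin measure. The
frequencies of a univariate characteristic function are imaginary multiples of one vector of the
orthant, so the complex Laplace transform determines it. -/
lemma IsThorinSubordinator.isSubordinator (hT : IsThorinSubordinator Q T d U) :
    IsSubordinator Q T d (thorinLevyMeasure U) := by
  have hU := hT.isThorinMeasure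
  refine ⟨hT.isSubordinatorProcess, hT.drift_nonneg, ?_, hU.finite_variation,
    hT.isSubordinatorProcess.isLevyProcess, PosSemidef.zero, hU.isLevyMeasure, fun t θ => ?_⟩
  · refine measure_mono_null (fun t ht => ?_) hU.ae_nonneg_thorinLevyMeasure
    obtain ⟨k, hk⟩ := ht
    exact fun h => absurd (h k) (not_le.2 hk)
  · have hTm := hT.isSubordinatorProcess.isLevyProcess.measurable t
    rw [levyKhintchine_of_finite_variation hU.integrable_min_one_norm, charFun_apply,
      integral_map hTm.aemeasurable (Measurable.aestronglyMeasurable (by fun_prop))]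
    have key := hT.laplace_complex t (l := oneVec) (fun k => by simp [oneVec])
      (z := -((θ 0 : ℝ) * I)) (by simp)
    simp only [inner_oneVec] at key
    have h1 : ∀ x : E 1, -(-(((θ 0 : ℝ) : ℂ) * I) * ((x 0 : ℝ) : ℂ)) = ((⟪x, θ⟫ : ℝ) : ℂ) * I := by
      intro x
      rw [inner_eq_mul]
      push_cast
      ring
    simp only [h1] at key
    rw [key]
    have h2 : ∀ x : E 1, (1 : ℂ) - cexp (((⟪x, θ⟫ : ℝ) : ℂ) * I) =
        -(cexp (I * ((⟪θ, x⟫ : ℝ) : ℂ)) - 1) := by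
      intro x
      rw [real_inner_comm, mul_comm I]
      ring
    simp only [h2]
    rw [integral_neg, inner_eq_mul]
    congr 1
    push_cast
    ring

/-- In dimension one strong and weak subordination produce the same exponent. -/
lemma hasExponent_strongSubord_one {B : ℝ≥0 → Ω → E 1} {μ : E 1} {S : Matrix (Fin 1) (Fin 1) ℝ}
    (hB : IsBM Q B μ S) (hT : IsThorinSubordinator Q T d U)
    (hind : IndepFun (fun ω t => B t ω) (fun ω t => T t ω) Q) :
    HasExponent Q (strongSubord B (broadcast 1 T)) fun θ =>
      timeExponent μ S θ d + ∫ x, (cexp (timeExponent μ S θ x) - 1) ∂(thorinLevyMeasure U) := by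
  intro t θ
  have hTm := hT.isSubordinatorProcess.isLevyProcess.measurable t
  have hbr : Measurable (broadcast 1 T t) := by
    unfold broadcast
    fun_prop
  have hτ : Measurable fun ω => (T t ω 0).toNNReal := Measurable.real_toNNReal (by fun_prop)
  have hindτ : IndepFun (fun ω t => B t ω) (fun ω => (T t ω 0).toNNReal) Q := by
    refine hind.comp (φ := id) (ψ := fun γ : ℝ≥0 → E 1 => (γ t 0).toNNReal) measurable_id ?_
    have : Measurable fun γ : ℝ≥0 → E 1 => γ t := measurable_pi_apply _
    exact Measurable.real_toNNReal (by fun_prop)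
  have key := integral_exp_at_indep_time hB.isLevyProcess hτ hindτ hB.hasExponent θ
  have hstrong : ∀ ω, strongSubord B (broadcast 1 T) t ω = B (T t ω 0).toNNReal ω := by
    intro ω
    ext k
    rw [Subsingleton.elim k 0]
    rfl
  rw [charFun_apply, integral_map (hB.isLevyProcess.aemeasurable_strongSubord hbr)
    (Measurable.aestronglyMeasurable (by fun_prop))]
  simp only [hstrong]
  rw [key]
  set Ψ := levyKhintchine μ S 0 θ with hΨ
  have hre : 0 ≤ (-Ψ).re := by
    have := halfQuad_nonneg hB.posSemidef θ
    simpa [hΨ, levyKhintchine_zero_measure] using this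
  have h1 := hT.laplace_complex t (l := oneVec) (fun k => by simp [oneVec]) hre
  simp only [inner_oneVec, timeExponent_one, ← hΨ] at h1 ⊢
  have h2 : ∫ ω, cexp (((T t ω 0).toNNReal : ℝ) * Ψ) ∂Q =
      ∫ ω, cexp (-(-Ψ * ((T t ω 0 : ℝ) : ℂ))) ∂Q := by
    refine integral_congr_ae ?_
    filter_upwards [hT.isSubordinatorProcess.ae_nonneg] with ω hω
    rw [Real.coe_toNNReal _ (hω t 0)]
    congr 1
    ring
  refine h2.trans (h1.trans ?_)
  have h3 : ∀ x : E 1, (1 : ℂ) - cexp (-(-Ψ * ((x 0 : ℝ) : ℂ))) =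
      -(cexp (((x 0 : ℝ) : ℂ) * Ψ) - 1) := by
    intro x
    rw [neg_mul, neg_neg, mul_comm]
    ring
  simp only [h3]
  rw [integral_neg]
  congr 1
  ring

end OneDim

/-- Strong subordination is weak subordination in dimension one, with the same `B` and `T`. -/
theorem IsVGGOne.isWVGG {Ω : Type*} [MeasurableSpace Ω] {P : Measure Ω} {X : ℝ≥0 → Ω → E 1}
    (h : IsVGGOne P X) : IsWVGG P X := by
  obtain ⟨d, μ, S, U, hX, Ω', _, Q, hQ, B, T, hB, hT, hind, Ψ, hΨX, hΨY⟩ := h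
  have hU := hT.isThorinMeasure
  have h0 := hU.ae_nonneg_thorinLevyMeasure
  have hint := hU.integrable_min_one_norm
  have := sFinite_of_integrable_min_one_norm hU.thorinLevyMeasure_zero hint
  obtain ⟨B', hB', hBB'⟩ := hB.isLevyProcess.exists_measurable_modification
  have h𝒳 : ∀ A, MeasurableSet A → 0 ∉ A →
      subordLevyMeasure Q B' (thorinLevyMeasure U) A =
        ∫⁻ t, Q {ω | evalAt B t ω ∈ A} ∂(thorinLevyMeasure U) :=
    fun A hA hA0 => subordLevyMeasure_apply hB' hBB' hA hA0
  have hL := hB.isLevyMeasure_subordLevyMeasure h0 hint hB' hBB'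
  refine ⟨d, μ, S, U, Ω', _, Q, hQ, B, T, hB, hT, hB, thorinLevyMeasure U,
    subordLevyMeasure Q B' (thorinLevyMeasure U), hT.isSubordinator, h𝒳, hX,
    hB.posSemidef_diamondMat hT.drift_nonneg, hL, fun t θ => ?_⟩
  rw [hB.levyKhintchine_weakSubord hU.thorinLevyMeasure_zero h0 hint hL h𝒳, hΨX t θ, ← hΨY t θ,
    hasExponent_strongSubord_one hB hT hind t θ]

/-! ### Transport of processes to a product space -/

section MeasurePreserving

variable {Ω₁ Ω₂ : Type*} [MeasurableSpace Ω₁] [MeasurableSpace Ω₂] {Q₁ : Measure Ω₁}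
  {Q₂ : Measure Ω₂} {f : Ω₂ → Ω₁} {X : ℝ≥0 → Ω₁ → E n}

lemma IsLevyProcess.comp_measurePreserving (hX : IsLevyProcess Q₁ X)
    (hf : MeasurePreserving f Q₂ Q₁) : IsLevyProcess Q₂ fun t ω => X t (f ω) where
  measurable t := (hX.measurable t).comp hf.measurable
  zero := hf.quasiMeasurePreserving.ae hX.zero
  indep m t ht := by
    have h1 := hX.indep m t ht
    rw [iIndepFun_iff_measure_inter_preimage_eq_mul] at h1 ⊢
    intro S A hA
    have hm : ∀ i : Fin m, Measurable fun ω => X (t i.succ) ω - X (t i.castSucc) ω := fun i =>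
      (hX.measurable _).sub (hX.measurable _)
    have h2 := h1 S hA
    rw [← hf.measure_preimage (MeasurableSet.nullMeasurableSet
      (Finset.measurableSet_biInter S fun i hi => hm i (hA i hi)))] at h2
    simp only [Set.preimage_iInter, ← Set.preimage_comp] at h2
    refine h2.trans (Finset.prod_congr rfl fun i hi => ?_)
    rw [← hf.measure_preimage (hm i (hA i hi)).nullMeasurableSet]
    rfl
  stationary s t := by
    have h1 := hX.stationary s t
    have hm : Measurable fun ω => X (s + t) ω - X s ω := (hX.measurable _).sub (hX.measurable _)
    rw [← hf.map_eq, Measure.map_map hm hf.measurable,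
      Measure.map_map (hX.measurable _) hf.measurable] at h1
    exact h1
  cadlag := hf.quasiMeasurePreserving.ae hX.cadlag

lemma HasExponent.comp_measurePreserving {Ψ : E n → ℂ} (hX : ∀ t, Measurable (X t))
    (h : HasExponent Q₁ X Ψ) (hf : MeasurePreserving f Q₂ Q₁) :
    HasExponent Q₂ (fun t ω => X t (f ω)) Ψ := by
  intro t θ
  rw [← h t θ, ← hf.map_eq, Measure.map_map (hX t) hf.measurable]
  rfl

lemma IsBM.comp_measurePreserving {μ : E n} {S : Matrix (Fin n) (Fin n) ℝ} (hX : IsBM Q₁ X μ S)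
    (hf : MeasurePreserving f Q₂ Q₁) : IsBM Q₂ (fun t ω => X t (f ω)) μ S where
  isLevyProcess := hX.isLevyProcess.comp_measurePreserving hf
  posSemidef := hX.posSemidef
  isLevyMeasure := hX.isLevyMeasure
  hasExponent := hX.hasExponent.comp_measurePreserving hX.isLevyProcess.measurable hf

lemma IsThorinSubordinator.comp_measurePreserving {d : E n} {U : Measure (E n)}
    (hX : IsThorinSubordinator Q₁ X d U) (hf : MeasurePreserving f Q₂ Q₁) :
    IsThorinSubordinator Q₂ (fun t ω => X t (f ω)) d U where
  isSubordinatorProcess :=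
    ⟨hX.isSubordinatorProcess.isLevyProcess.comp_measurePreserving hf,
      hf.quasiMeasurePreserving.ae hX.isSubordinatorProcess.monotone⟩
  drift_nonneg := hX.drift_nonneg
  isThorinMeasure := hX.isThorinMeasure
  laplace t l hl := by
    have hm := hX.isSubordinatorProcess.isLevyProcess.measurable t
    rw [← hX.laplace t l hl, ← hf.map_eq, integral_map hf.measurable.aemeasurable
      (Measurable.aestronglyMeasurable (by fun_prop))]

end MeasurePreserving

/-! ### The inclusion of weak in strong variance generalised gamma convolutions -/

/-- Weak subordination is strong subordination in dimension one. -/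
theorem IsWVGG.isVGGOne {Ω : Type*} [MeasurableSpace Ω] {P : Measure Ω} {X : ℝ≥0 → Ω → E 1}
    (h : IsWVGG P X) : IsVGGOne P X := by
  obtain ⟨d, μ, S, U, h⟩ := h
  obtain ⟨hX, -, hU, -, hΨ⟩ := h.isLevyProcess_and_hasExponent
  obtain ⟨Ω', _, Q, hQ, B, T, hB, hT, -⟩ := h
  -- weak subordination does not require `B` and `T` to be independent; independent copies live on
  -- the product space
  have hB' : IsBM (Q.prod Q) (fun t ω => B t ω.1) μ S :=
    hB.comp_measurePreserving measurePreserving_fst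
  have hT' : IsThorinSubordinator (Q.prod Q) (fun t ω => T t ω.2) d U :=
    hT.comp_measurePreserving measurePreserving_snd
  have hind : IndepFun (fun (ω : Ω' × Ω') t => B t ω.1) (fun (ω : Ω' × Ω') t => T t ω.2)
      (Q.prod Q) :=
    indepFun_prod (X := fun ω t => B t ω) (Y := fun ω t => T t ω)
      (measurable_pi_lambda _ hB.isLevyProcess.measurable)
      (measurable_pi_lambda _ hT.isSubordinatorProcess.isLevyProcess.measurable)
  have h1 := hasExponent_strongSubord_one hB' hT' hind
  simp only [hB.integral_exp_timeExponent_thorinLevyMeasure hU] at h1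
  exact ⟨d, μ, S, U, hX, Ω' × Ω', inferInstance, Q.prod Q, inferInstance, _, _, hB', hT', hind,
    _, hΨ, h1⟩

end VarianceGamma

end

theorem mainTheorem2 {Ω : Type*} [MeasurableSpace Ω] (P : Measure Ω) [IsProbabilityMeasure P] :
    (∀ X : ℝ≥0 → Ω → EuclideanSpace ℝ (Fin 1),
      (VarianceGamma.IsVG P X → VarianceGamma.IsVGGOne P X) ∧
      (VarianceGamma.IsVGGOne P X ↔ VarianceGamma.IsWVGG P X) ∧
      (VarianceGamma.IsWVGG P X → VarianceGamma.IsSD P X)) ∧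
    (∀ n : ℕ, 2 ≤ n → ∀ X : ℝ≥0 → Ω → EuclideanSpace ℝ (Fin n),
      (VarianceGamma.IsBMAddGVGCZero P X → VarianceGamma.IsSD P X) ∧
      (VarianceGamma.IsWVGGZero P X → VarianceGamma.IsBMAddGVGCZero P X)) := by
  refine ⟨fun X => ⟨fun h => h.isVGGOne, ⟨fun h => h.isWVGG, fun h => h.isVGGOne⟩,
    fun h => h.isSD⟩, fun n hn X => ⟨fun h => h.isSD, fun h => h.isBMAddGVGCZero (by omega)⟩⟩
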